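/- Let $N\ge 2$, $\alpha\in(0,1)$, $\lambda\in(0,\frac{\pi}{2})$ and $\Omega=S^{N-1}\times(-1,1)$. **Notation.** Let $\tilde u$ be the even solution on $(-\frac\pi2,\frac\pi2)$, unique up to an additive constant, of $\cos^{1-N}\theta\,\bigl(\cos^{N-1}\theta\;\tilde u'(\theta)\bigr)'=-1$. For $j\in\mathbb N\cup\{0\}$ put $\gamma_j=j(N-2+j)$ and $$\sigma_j(\lambda)=\tilde u'(\lambda)\bigl((N-1)\tan\lambda-f_j(\lambda)\bigr)-1,$$ where $f_j:[0,\frac\pi2)\to\mathbb R$ is the continuous function with $f_j(0)=0$ and $f_j'=-f_j^2+(N-1)\tan(\cdot)\,f_j+\gamma_j\cos^{-2}(\cdot)$ on $(0,\frac\pi2)$. Let $$\Delta_{g_\lambda}=\frac{1}{\lambda^2\cos^{N-1}(\lambda t)}\,\partial_t\bigl(\cos^{N-1}(\lambda t)\,\partial_t\bigr)+\frac{1}{\cos^2(\lambda t)}\,\Delta_{S^{N-1}},$$ where $\Delta_{S^{N-1}}$ acts on the variable $\sigma\in S^{N-1}$. For $\omega\in C^{2,\alpha}(S^{N-1})$ let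 $\psi_{\omega,\lambda}\in C(\overline\Omega)\cap C^2(\Omega)$ be the solution of $\Delta_{g_\lambda}\psi_{\omega,\lambda}=0$ in $\Omega$, $\psi_{\omega,\lambda}(\sigma,\pm1)=\omega(\sigma)$ for $\sigma\in S^{N-1}$, and put $$[\mathbb L_\lambda\omega](\sigma)=-\frac{\tilde u'(\lambda)}{\lambda}\,\partial_t\psi_{\omega,\lambda}(\sigma,1)+\tilde u''(\lambda)\,\omega(\sigma).$$ Let $V_\ell\subset L^2(S^{N-1})$ be the space of spherical harmonics of degree $\ell$ (restrictions to $S^{N-1}$ of homogeneous harmonic polynomials of degree $\ell$ on $\mathbb R^N$) and $P_\ell$ the orthogonal projection of $L^2(S^{N-1})$ onto $V_\ell$. For $k\in\mathbb N\cup\{0\}$ let $$H^k=\Bigl\{v\in L^2(S^{N-1}) : \sum_{\ell\ge0}(1+\ell^2)^k\langle P_\ell v,P_\ell v\rangle_{L^2}<\infty\Bigr\},\qquad \langle u,v\rangle_{H^k}=\sum_{\ell\ge0}(1+\ell^2)^k\langle P_\ell u,P_\ell v\rangle_{L^2}$$ (the usual Sobolev space $H^k(S^{N-1})$), and let $W^k_\ell=\{v\in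 H^k: P_\ell v=0\}$. **Proposition.** The functions $f_j$ exist and are unique. For every $\omega\in C^{2,\alpha}(S^{N-1})$ the solution $\psi_{\omega,\lambda}$ exists and is unique, and $\partial_t\psi_{\omega,\lambda}(\sigma,1)$ exists for every $\sigma\in S^{N-1}$; so $\mathbb L_\lambda$ is well defined on $C^{2,\alpha}(S^{N-1})$. Moreover $C^{2,\alpha}(S^{N-1})\subset H^2$, and $\mathbb L_\lambda$ extends to a continuous linear map $$\mathbb L_\lambda: H^2\to H^1,\qquad \mathbb L_\lambda v=\sum_{\ell\ge0}\sigma_\ell(\lambda)\,P_\ell v,$$ the series converging in $H^1$. For every $\ell\in\mathbb N\cup\{0\}$, the map $\mathbb L_\lambda-\sigma_\ell(\lambda)\,\mathrm{id}$ restricts to an isomorphism (a linear homeomorphism) $W^2_\ell\to W^1_\ell$. -/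

import Mathlib

open MeasureTheory Set

noncomputable section

namespace SerrinSphere

/-! ### The sphere, spherical harmonics and Sobolev spaces -/

/-- `ℝ^N` with its Euclidean norm. -/
abbrev Euc (N : ℕ) : Type := EuclideanSpace ℝ (Fin N)

/-- The unit sphere `S^{N-1}` in `ℝ^N`. -/
abbrev Sph (N : ℕ) : Type := Metric.sphere (0 : Euc N) 1

/-- The surface measure `dσ` of `S^{N-1}`. -/
abbrev sphMeasure (N : ℕ) : Measure (Sph N) := (volume : Measure (Euc N)).toSphere

/-- The real Hilbert space `L²(S^{N-1})`. -/
abbrev L2 (N : ℕ) : Type := Lp ℝ 2 (sphMeasure N)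

/-- The Laplacian `∑ᵢ ∂ᵢ²` on polynomials in `N` variables. -/
def polyLaplacian (N : ℕ) : MvPolynomial (Fin N) ℝ →ₗ[ℝ] MvPolynomial (Fin N) ℝ :=
  ∑ i, (MvPolynomial.pderiv i).toLinearMap ∘ₗ (MvPolynomial.pderiv i).toLinearMap

/-- The homogeneous harmonic polynomials of degree `l` in `N` variables. -/
def harmonicPoly (N l : ℕ) : Submodule ℝ (MvPolynomial (Fin N) ℝ) :=
  MvPolynomial.homogeneousSubmodule (Fin N) ℝ l ⊓ LinearMap.ker (polyLaplacian N)

/-- The restriction of a polynomial to the sphere, as a continuous function. -/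
def polyRestrict (N : ℕ) : MvPolynomial (Fin N) ℝ →ₗ[ℝ] C(Sph N, ℝ) where
  toFun p :=
    ⟨fun x => MvPolynomial.eval (fun i => (x : Euc N) i) p,
      (MvPolynomial.continuous_eval p).comp (by fun_prop)⟩
  map_add' p q := by ext x; simp
  map_smul' c p := by ext x; simp [MvPolynomial.smul_eval]

/-- The space `V_l` of spherical harmonics of degree `l`, as a subspace of `L²(S^{N-1})`. -/
def sphHarm (N l : ℕ) : Submodule ℝ (L2 N) :=
  (harmonicPoly N l).map
    ((ContinuousMap.toLp 2 (sphMeasure N) ℝ).toLinearMap ∘ₗ polyRestrict N)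

instance finiteDimensional_sphHarm (N l : ℕ) : FiniteDimensional ℝ (sphHarm N l) := by
  have h1 : (MvPolynomial.homogeneousSubmodule (Fin N) ℝ l).FG :=
    MvPolynomial.homogeneousSubmodule_fg (Fin N) ℝ l
  have : FiniteDimensional ℝ (MvPolynomial.homogeneousSubmodule (Fin N) ℝ l) :=
    Module.Finite.iff_fg.mpr h1
  have : FiniteDimensional ℝ (harmonicPoly N l) :=
    Submodule.finiteDimensional_of_le inf_le_left
  unfold sphHarm
  infer_instance

/-- The orthogonal projection `P_l` of `L²(S^{N-1})` onto `V_l`. -/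
def proj (N l : ℕ) : L2 N →L[ℝ] L2 N := (sphHarm N l).starProjection

/-- The `l`-th term `(1 + l²)^k ⟨P_l u, P_l v⟩` of the scalar product of `H^k`. -/
def sobTerm (N k : ℕ) (u v : L2 N) (l : ℕ) : ℝ :=
  (1 + (l : ℝ) ^ 2) ^ k * inner ℝ (proj N l u) (proj N l v)

theorem sobTerm_nonneg (N k : ℕ) (u : L2 N) (l : ℕ) : 0 ≤ sobTerm N k u u l :=
  mul_nonneg (by positivity) real_inner_self_nonneg

theorem abs_sobTerm_le (N k : ℕ) (u v : L2 N) (l : ℕ) :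
    |sobTerm N k u v l| ≤ sobTerm N k u u l + sobTerm N k v v l := by
  unfold sobTerm
  have hc : (0 : ℝ) ≤ (1 + (l : ℝ) ^ 2) ^ k := by positivity
  rw [abs_mul, abs_of_nonneg hc, ← mul_add]
  refine mul_le_mul_of_nonneg_left ?_ hc
  have h := abs_real_inner_le_norm (proj N l u) (proj N l v)
  rw [real_inner_self_eq_norm_sq, real_inner_self_eq_norm_sq]
  nlinarith [sq_nonneg (‖proj N l u‖ - ‖proj N l v‖), sq_nonneg ‖proj N l u‖,
    sq_nonneg ‖proj N l v‖]

theorem sobTerm_add_left (N k : ℕ) (u v w : L2 N) (l : ℕ) :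
    sobTerm N k (u + v) w l = sobTerm N k u w l + sobTerm N k v w l := by
  unfold sobTerm
  rw [map_add, inner_add_left, mul_add]

theorem sobTerm_comm (N k : ℕ) (u v : L2 N) (l : ℕ) :
    sobTerm N k u v l = sobTerm N k v u l := by
  unfold sobTerm
  rw [real_inner_comm]

theorem sobTerm_smul_left (N k : ℕ) (c : ℝ) (u v : L2 N) (l : ℕ) :
    sobTerm N k (c • u) v l = c * sobTerm N k u v l := by
  unfold sobTerm
  rw [map_smul, real_inner_smul_left, mul_left_comm]

theorem summable_sobTerm {N k : ℕ} {u v : L2 N} (hu : Summable (sobTerm N k u u))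
    (hv : Summable (sobTerm N k v v)) : Summable (sobTerm N k u v) :=
  Summable.of_norm_bounded (hu.add hv) (fun l => abs_sobTerm_le N k u v l)

/-- The functions `v ∈ L²(S^{N-1})` with `∑_l (1 + l²)^k ⟨P_l v, P_l v⟩ < ∞`. -/
def sobSubmodule (N k : ℕ) : Submodule ℝ (L2 N) where
  carrier := {v | Summable (sobTerm N k v v)}
  zero_mem' := by
    have : sobTerm N k 0 0 = fun _ => 0 := by ext l; simp [sobTerm]
    simp only [mem_ofPred_eq, this, summable_zero]
  add_mem' := by
    intro u v hu hv
    have : sobTerm N k (u + v) (u + v) = fun l =>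
        (sobTerm N k u u l + sobTerm N k v u l) + (sobTerm N k u v l + sobTerm N k v v l) := by
      ext l
      rw [sobTerm_add_left, sobTerm_comm N k u, sobTerm_comm N k v, sobTerm_add_left,
        sobTerm_add_left]
    simp only [mem_ofPred_eq, this]
    exact (hu.add (summable_sobTerm hv hu)).add ((summable_sobTerm hu hv).add hv)
  smul_mem' := by
    intro c u hu
    have : sobTerm N k (c • u) (c • u) = fun l => c * (c * sobTerm N k u u l) := by
      ext l
      rw [sobTerm_smul_left, sobTerm_comm, sobTerm_smul_left]
    simp only [mem_ofPred_eq, this]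
    exact (hu.mul_left c).mul_left c

/-- The Sobolev space `H^k = H^k(S^{N-1})`. It is a type of its own, because its topology is not
the one of `L²` but the one of the scalar product `∑_l (1 + l²)^k ⟨P_l u, P_l v⟩`. -/
def Sob (N k : ℕ) : Type := sobSubmodule N k

instance (N k : ℕ) : AddCommGroup (Sob N k) := inferInstanceAs (AddCommGroup (sobSubmodule N k))

instance (N k : ℕ) : Module ℝ (Sob N k) := inferInstanceAs (Module ℝ (sobSubmodule N k))

/-- The inclusion `H^k ⊂ L²`. -/
def Sob.toL2 {N k : ℕ} : Sob N k →ₗ[ℝ] L2 N := (sobSubmodule N k).subtype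

/-- The scalar product `⟨u, v⟩ = ∑_l (1 + l²)^k ⟨P_l u, P_l v⟩` on `H^k`. -/
@[reducible] def sobCore (N k : ℕ) : PreInnerProductSpace.Core ℝ (Sob N k) where
  inner u v := ∑' l, sobTerm N k u.toL2 v.toL2 l
  conj_inner_symm u v := by
    simp only [conj_trivial]
    exact tsum_congr fun l => sobTerm_comm N k _ _ l
  re_inner_nonneg u := by
    simp only [RCLike.re_to_real]
    exact tsum_nonneg fun l => sobTerm_nonneg N k _ l
  add_left u v w := by
    rw [map_add]
    refine Eq.trans ?_
      ((summable_sobTerm (u := u.toL2) (v := w.toL2) u.2 w.2).tsum_add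
        (summable_sobTerm (u := v.toL2) (v := w.toL2) v.2 w.2))
    exact tsum_congr fun l => sobTerm_add_left N k _ _ _ l
  smul_left u v c := by
    rw [map_smul, conj_trivial, ← tsum_mul_left]
    exact tsum_congr fun l => sobTerm_smul_left N k c _ _ l

/- Definiteness of the scalar product (that is, completeness of the spherical harmonics in `L²`) is
not needed to define the topology of `H^k`; hence the word `Seminormed`. -/
instance (N k : ℕ) : SeminormedAddCommGroup (Sob N k) :=
  @InnerProductSpace.Core.toSeminormedAddCommGroup ℝ (Sob N k) _ _ _ (sobCore N k)

instance (N k : ℕ) : InnerProductSpace ℝ (Sob N k) := InnerProductSpace.ofCore (sobCore N k)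

theorem inner_sob (N k : ℕ) (u v : Sob N k) :
    inner ℝ u v =
      ∑' l : ℕ, (1 + (l : ℝ) ^ 2) ^ k * inner ℝ (proj N l u.toL2) (proj N l v.toL2) := rfl

/-- `W^k_l = {v ∈ H^k : P_l v = 0}`, the `L²`-orthogonal complement of `V_l` in `H^k`. -/
def sobOrth (N k l : ℕ) : Submodule ℝ (Sob N k) :=
  LinearMap.ker ((proj N l).toLinearMap ∘ₗ (Sob.toL2 : Sob N k →ₗ[ℝ] L2 N))

/-! ### Calculus on the sphere and on `S^{N-1} × [-1, 1]` -/

/-- The extension `x ↦ f (x / |x|)` of a function on the sphere to `ℝ^N ∖ {0}` (value `0` at `0`).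
-/
def homExt {N : ℕ} (f : Sph N → ℝ) (x : Euc N) : ℝ :=
  if h : x = 0 then 0
  else f ⟨‖x‖⁻¹ • x, by
    simp [norm_smul, inv_mul_cancel₀ (norm_ne_zero_iff.mpr h)]⟩

/-- The Laplace-Beltrami operator of `S^{N-1}`: the Euclidean Laplacian of the extension that is
constant along rays, restricted to the sphere. -/
def sphLaplacian {N : ℕ} (f : Sph N → ℝ) (σ : Sph N) : ℝ :=
  Laplacian.laplacian (homExt f) (σ : Euc N)

/-- `f ∈ C^{2,α}(S^{N-1})`: the extension constant along rays is of class `C²` away from the origin,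
and its second derivative is `α`-Hölder continuous along the sphere. -/
def IsC2Holder {N : ℕ} (α : NNReal) (f : Sph N → ℝ) : Prop :=
  ContDiffOn ℝ 2 (homExt f) {0}ᶜ ∧
    ∃ C : NNReal, HolderOnWith C α (iteratedFDeriv ℝ 2 (homExt f)) (Metric.sphere (0 : Euc N) 1)

/-- The operator `Δ_{g_lam}` on functions `ψ(σ, t)`, that is
`1 / (lam² cos^{N-1}(lam t)) ∂_t (cos^{N-1}(lam t) ∂_t ψ) + 1 / cos²(lam t) Δ_{S^{N-1}} ψ`. -/
def cylLaplacian {N : ℕ} (lam : ℝ) (ψ : Sph N → ℝ → ℝ) (σ : Sph N) (t : ℝ) : ℝ :=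
  1 / (lam ^ 2 * Real.cos (lam * t) ^ (N - 1)) *
      deriv (fun s => Real.cos (lam * s) ^ (N - 1) * deriv (ψ σ) s) t +
    1 / Real.cos (lam * t) ^ 2 * sphLaplacian (fun τ => ψ τ t) σ

/-- `ψ` is a classical solution of `Δ_{g_lam} ψ = 0` in `Ω = S^{N-1} × (-1, 1)` with `ψ(σ, ±1) = ω(σ)`:
it is continuous on the closure of `Ω` and of class `C²` in `Ω`. -/
structure IsDirichletSolution {N : ℕ} (lam : ℝ) (ω : Sph N → ℝ) (ψ : Sph N → ℝ → ℝ) : Prop where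
  continuousOn : ContinuousOn (fun p : Sph N × ℝ => ψ p.1 p.2) (univ ×ˢ Icc (-1) 1)
  contDiffOn : ContDiffOn ℝ 2 (fun p : Euc N × ℝ => homExt (fun σ => ψ σ p.2) p.1)
    ({0}ᶜ ×ˢ Ioo (-1) 1)
  harmonic : ∀ σ, ∀ t ∈ Ioo (-1 : ℝ) 1, cylLaplacian lam ψ σ t = 0
  boundary : ∀ σ, ψ σ 1 = ω σ ∧ ψ σ (-1) = ω σ

open Classical in
/-- The solution `ψ_{ω,lam}` of the Dirichlet problem (`0` if there is none). -/
def dirichletSolution {N : ℕ} (lam : ℝ) (ω : Sph N → ℝ) : Sph N → ℝ → ℝ :=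
  if h : ∃ ψ, IsDirichletSolution lam ω ψ then h.choose else 0

/-! ### The profile `ũ`, the linearization and its eigenvalues -/

/-- The even solution `ũ` of `cos^{1-N} θ (cos^{N-1} θ ũ')' = -1` on `(-π/2, π/2)`, normalized by
`ũ(0) = 0`. -/
def profile (N : ℕ) (θ : ℝ) : ℝ :=
  -∫ s in (0 : ℝ)..θ, (∫ r in (0 : ℝ)..s, Real.cos r ^ (N - 1)) / Real.cos s ^ (N - 1)

/-- The linearized operator
`(L_lam ω)(σ) = -(ũ'(lam) / lam) ∂_t ψ_{ω,lam}(σ, 1) + ũ''(lam) ω(σ)`. -/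
def linOp {N : ℕ} (lam : ℝ) (ω : Sph N → ℝ) (σ : Sph N) : ℝ :=
  -(deriv (profile N) lam / lam) * derivWithin (dirichletSolution lam ω σ) (Icc (-1) 1) 1 +
    deriv (deriv (profile N)) lam * ω σ

/-- `f` solves `f' = -f² + (N-1) tan(x) f + γ_j / cos²(x)` on `(0, π/2)`, `f(0) = 0`, where
`γ_j = j (N - 2 + j)`. -/
structure IsRiccati (N j : ℕ) (f : ℝ → ℝ) : Prop where
  continuousOn : ContinuousOn f (Ico 0 (Real.pi / 2))
  initial : f 0 = 0
  ode : ∀ x ∈ Ioo 0 (Real.pi / 2), HasDerivAt f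
    (-f x ^ 2 + ((N : ℝ) - 1) * Real.tan x * f x + (j : ℝ) * ((N : ℝ) - 2 + j) / Real.cos x ^ 2) x

open Classical in
/-- The solution `f_j` of the initial value problem (`0` if there is none). -/
def riccati (N j : ℕ) : ℝ → ℝ :=
  if h : ∃ f, IsRiccati N j f then h.choose else 0

/-- `σ_j(lam) = ũ'(lam) ((N-1) tan lam - f_j(lam)) - 1`. -/
def eigval (N j : ℕ) (lam : ℝ) : ℝ :=
  deriv (profile N) lam * (((N : ℝ) - 1) * Real.tan lam - riccati N j lam) - 1

/-! The function `profile` is the even solution of its equation. -/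

theorem profile_neg (N : ℕ) (θ : ℝ) : profile N (-θ) = profile N θ := by
  have h (s : ℝ) : (∫ r in (0 : ℝ)..(-s), Real.cos r ^ (N - 1)) =
      -∫ r in (0 : ℝ)..s, Real.cos r ^ (N - 1) := by
    have := intervalIntegral.integral_comp_neg (a := 0) (b := s)
      (fun r : ℝ => Real.cos r ^ (N - 1))
    simp only [Real.cos_neg, neg_zero] at this
    rw [this, intervalIntegral.integral_symm]
  have := intervalIntegral.integral_comp_neg (a := 0) (b := θ)
    (fun s : ℝ => (∫ r in (0 : ℝ)..s, Real.cos r ^ (N - 1)) / Real.cos s ^ (N - 1))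
  simp only [Real.cos_neg, neg_zero, h, neg_div, intervalIntegral.integral_neg] at this
  unfold profile
  rw [intervalIntegral.integral_symm, ← this]; simp

theorem hasDerivAt_profile (N : ℕ) {θ : ℝ} (hθ : θ ∈ Ioo (-(Real.pi / 2)) (Real.pi / 2)) :
    HasDerivAt (profile N)
      (-((∫ r in (0 : ℝ)..θ, Real.cos r ^ (N - 1)) / Real.cos θ ^ (N - 1))) θ := by
  have hc : ContinuousOn
      (fun s : ℝ => (∫ r in (0 : ℝ)..s, Real.cos r ^ (N - 1)) / Real.cos s ^ (N - 1))
      (Ioo (-(Real.pi / 2)) (Real.pi / 2)) := by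
    refine ContinuousOn.div ?_ (by fun_prop) fun s hs =>
      pow_ne_zero _ (Real.cos_pos_of_mem_Ioo hs).ne'
    exact (intervalIntegral.continuous_primitive
      (fun a b => (by fun_prop : Continuous fun r : ℝ => Real.cos r ^ (N - 1)).intervalIntegrable
        a b) 0).continuousOn
  have h0 : (0 : ℝ) ∈ Ioo (-(Real.pi / 2)) (Real.pi / 2) := by
    constructor <;> linarith [Real.pi_pos]
  have hsub : uIcc 0 θ ⊆ Ioo (-(Real.pi / 2)) (Real.pi / 2) := ordConnected_Ioo.uIcc_subset h0 hθ
  exact (intervalIntegral.integral_hasDerivAt_right (hc.mono hsub).intervalIntegrable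
    (hc.stronglyMeasurableAtFilter isOpen_Ioo _ hθ)
    (hc.continuousAt (isOpen_Ioo.mem_nhds hθ))).neg

theorem profile_ode (N : ℕ) {θ : ℝ} (hθ : θ ∈ Ioo (-(Real.pi / 2)) (Real.pi / 2)) :
    HasDerivAt (fun x => Real.cos x ^ (N - 1) * deriv (profile N) x)
      (-Real.cos θ ^ (N - 1)) θ := by
  have hcos : Continuous fun r : ℝ => Real.cos r ^ (N - 1) := by fun_prop
  have h : HasDerivAt (fun x => -∫ r in (0 : ℝ)..x, Real.cos r ^ (N - 1))
      (-Real.cos θ ^ (N - 1)) θ :=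
    (intervalIntegral.integral_hasDerivAt_right (hcos.intervalIntegrable _ _)
      (hcos.stronglyMeasurableAtFilter _ _) hcos.continuousAt).neg
  refine h.congr_of_eventuallyEq ?_
  filter_upwards [isOpen_Ioo.mem_nhds hθ] with x hx
  rw [(hasDerivAt_profile N hx).deriv]
  have := pow_ne_zero (N - 1) (Real.cos_pos_of_mem_Ioo hx).ne'
  field_simp

end SerrinSphere

end

open SerrinSphere

/-! The operator is diagonal in spherical harmonics, by separation of variables. For `Y ∈ V_l`, the
function `Y(σ) y(λt)` is harmonic for `Δ_{g_λ}` exactly when `(cos^{N-1} y')' = γ_l cos^{N-3} y`.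
The boundary data agree at `t = ±1`, so the even solution `y_l` is the relevant one, and `f_l =
y_l'/y_l` solves the Riccati problem. Normalized to be `1` at `t = 1`, the solution has normal
derivative `λ f_l(λ)`. Since `ũ'' = (N-1) tan · ũ' - 1`, the operator multiplies `V_l` by `-ũ' f_l +
ũ'' = σ_l`.

What remains on the Sobolev side is about multipliers. The map `v ↦ ∑ m_l P_l v` is bounded `H² →
H¹` if `|m_l| ≤ C (1 + l²)^{1/2}`, and it is an isomorphism `W²_l → W¹_l` if moreover `|m_j| ≥ c (1
+ j²)^{1/2}` for `j ≠ l` (`exists_equiv_of_multiplier`). For `m_j = σ_j - σ_l = -ũ'(λ) (f_j -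
f_l)(λ)` this follows from `ũ'(λ) < 0` and three ODE comparisons: `f_j` is strictly increasing in
`j` (`riccati_lt_riccati`), `f_j(λ) ≥ j tanh(jλ)` (`riccati_ge`) and `f_j ≤ C (j + 1)`
(`exists_riccati_le`).

The harmonic analysis is built from Green's identity on the sphere. It makes the `V_l` orthogonal,
and it yields `P_l Δf = -γ_l P_l f`, which puts `C²` into `H²`. Completeness comes from the
decomposition of polynomials on the sphere into harmonic ones and from Stone-Weierstrass.

For the Dirichlet problem, uniqueness is the maximum principle, with barrier `ũ(λt) - ũ(λ)`.
Existence uses the separated series: its time factors decay like `e^{-lλ(1-|t|)}`, which beats the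
growth of harmonic polynomials near the sphere and makes the series `C²` inside. Finite sums and the
maximum principle give continuity at the boundary. For the normal derivative, `Δω` is approximated
uniformly by finite sums of harmonics; the barrier turns this into uniform approximation of
difference quotients at `t = 1` (`exists_normal_derivative`). -/

open MeasureTheory Set
open scoped Topology

noncomputable section

namespace SerrinSphere

/-! ### Partial derivatives and the Laplacian -/

/-- The standard basis vector `eᵢ` of `ℝ^N`. -/
def stdVec {N : ℕ} (i : Fin N) : Euc N := EuclideanSpace.single i 1

/-- The partial derivative `∂ᵢ f`. -/
def pd {N : ℕ} (i : Fin N) (f : Euc N → ℝ) (x : Euc N) : ℝ := fderiv ℝ f x (stdVec i)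

theorem stdVec_apply {N : ℕ} (i j : Fin N) : stdVec i j = if j = i then (1 : ℝ) else 0 := by
  simp [stdVec]

theorem pd_congr {N : ℕ} {i : Fin N} {f g : Euc N → ℝ} {x : Euc N} (h : f =ᶠ[𝓝 x] g) :
    pd i f x = pd i g x := by
  unfold pd; rw [h.fderiv_eq]

theorem pd_add {N : ℕ} {i : Fin N} {f g : Euc N → ℝ} {x : Euc N} (hf : DifferentiableAt ℝ f x)
    (hg : DifferentiableAt ℝ g x) : pd i (fun y => f y + g y) x = pd i f x + pd i g x := by
  unfold pd; rw [fderiv_fun_add hf hg]; rfl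

theorem pd_mul {N : ℕ} {i : Fin N} {f g : Euc N → ℝ} {x : Euc N} (hf : DifferentiableAt ℝ f x)
    (hg : DifferentiableAt ℝ g x) :
    pd i (fun y => f y * g y) x = f x * pd i g x + g x * pd i f x := by
  unfold pd; rw [fderiv_fun_mul hf hg]; simp

theorem contDiffAt_pd {N : ℕ} {i : Fin N} {f : Euc N → ℝ} {x : Euc N} {n m : WithTop ℕ∞}
    (hf : ContDiffAt ℝ n f x) (h : m + 1 ≤ n) : ContDiffAt ℝ m (pd i f) x := by
  exact (hf.fderiv_right h).clm_apply contDiffAt_const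

theorem laplacian_eq_sum_pd {N : ℕ} {f : Euc N → ℝ} {x : Euc N} (hf : ContDiffAt ℝ 2 f x) :
    Laplacian.laplacian f x = ∑ i, pd i (pd i f) x := by
  rw [InnerProductSpace.laplacian_eq_iteratedFDeriv_orthonormalBasis f
    (EuclideanSpace.basisFun (Fin N) ℝ)]
  refine Finset.sum_congr rfl fun i _ => ?_
  have hd : DifferentiableAt ℝ (fderiv ℝ f) x :=
    (hf.fderiv_right (m := 1) (by norm_num)).differentiableAt (by norm_num)
  rw [iteratedFDeriv_two_apply]
  unfold pd
  rw [fderiv_clm_apply hd (differentiableAt_const _)]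
  simp [stdVec]

theorem laplacian_mul {N : ℕ} {f g : Euc N → ℝ} {x : Euc N} (hf : ContDiffAt ℝ 2 f x)
    (hg : ContDiffAt ℝ 2 g x) :
    Laplacian.laplacian (fun y => f y * g y) x = f x * Laplacian.laplacian g x +
      2 * ∑ i, pd i f x * pd i g x + g x * Laplacian.laplacian f x := by
  rw [laplacian_eq_sum_pd (hf.mul hg), laplacian_eq_sum_pd hf, laplacian_eq_sum_pd hg,
    Finset.mul_sum, Finset.mul_sum, Finset.mul_sum, ← Finset.sum_add_distrib,
    ← Finset.sum_add_distrib]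
  refine Finset.sum_congr rfl fun i _ => ?_
  have hf1 : ContDiffAt ℝ 1 (pd i f) x := contDiffAt_pd hf (by norm_num)
  have hg1 : ContDiffAt ℝ 1 (pd i g) x := contDiffAt_pd hg (by norm_num)
  have h : pd i (fun y => f y * g y) =ᶠ[𝓝 x] fun y => f y * pd i g y + g y * pd i f y := by
    filter_upwards [hf.eventually (by simp), hg.eventually (by simp)] with y h1 h2
    exact pd_mul (h1.differentiableAt (by norm_num)) (h2.differentiableAt (by norm_num))
  have hf' := hf.differentiableAt (by norm_num)
  have hg' := hg.differentiableAt (by norm_num)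
  have hf1' := hf1.differentiableAt (by norm_num)
  have hg1' := hg1.differentiableAt (by norm_num)
  rw [pd_congr h, pd_add (hf'.fun_mul hg1') (hg'.fun_mul hf1'), pd_mul hf' hg1', pd_mul hg' hf1']
  ring

/-! ### Polynomial functions on `ℝ^N` -/

/-- The function on `ℝ^N` defined by a polynomial. -/
def evalE {N : ℕ} (p : MvPolynomial (Fin N) ℝ) (x : Euc N) : ℝ :=
  MvPolynomial.eval (fun i => x i) p

@[simp] theorem evalE_add {N : ℕ} (p q : MvPolynomial (Fin N) ℝ) (x : Euc N) :
    evalE (p + q) x = evalE p x + evalE q x := by simp [evalE]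

@[simp] theorem evalE_mul {N : ℕ} (p q : MvPolynomial (Fin N) ℝ) (x : Euc N) :
    evalE (p * q) x = evalE p x * evalE q x := by simp [evalE]

@[simp] theorem evalE_sum {N : ℕ} {ι : Type*} (s : Finset ι) (p : ι → MvPolynomial (Fin N) ℝ)
    (x : Euc N) : evalE (∑ i ∈ s, p i) x = ∑ i ∈ s, evalE (p i) x := by simp [evalE]

@[simp] theorem evalE_X {N : ℕ} (i : Fin N) (x : Euc N) : evalE (MvPolynomial.X i) x = x i := by
  simp [evalE]

@[simp] theorem evalE_C {N : ℕ} (c : ℝ) (x : Euc N) :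
    evalE (MvPolynomial.C c : MvPolynomial (Fin N) ℝ) x = c := by simp [evalE]

theorem contDiff_evalE {N : ℕ} (p : MvPolynomial (Fin N) ℝ) {n : WithTop ℕ∞} :
    ContDiff ℝ n (evalE p) := by
  induction p using MvPolynomial.induction_on with
  | C c => simpa [funext (evalE_C c)] using contDiff_const
  | add p q hp hq => simpa [funext (evalE_add p q)] using hp.add hq
  | mul_X p i hp =>
    have : evalE (p * MvPolynomial.X i) = fun x => evalE p x * x i := by ext x; simp
    rw [this]
    exact hp.mul (by fun_prop)

theorem pd_evalE {N : ℕ} (p : MvPolynomial (Fin N) ℝ) (i : Fin N) :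
    pd i (evalE p) = evalE (MvPolynomial.pderiv i p) := by
  induction p using MvPolynomial.induction_on with
  | C c =>
    ext x
    have : evalE (MvPolynomial.C c : MvPolynomial (Fin N) ℝ) = fun _ => c := by ext x; simp
    rw [this]
    simp [pd, evalE]
  | add p q hp hq =>
    ext x
    have : evalE (p + q) = fun x => evalE p x + evalE q x := by ext x; simp
    rw [this, pd_add ((contDiff_evalE p (n := 1)).differentiable (by norm_num) x)
      ((contDiff_evalE q (n := 1)).differentiable (by norm_num) x), hp, hq]
    simp
  | mul_X p j hp =>
    ext x
    have : evalE (p * MvPolynomial.X j) = fun x => evalE p x * x j := by ext x; simp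
    have hj : pd i (fun x : Euc N => x j) x = if j = i then 1 else 0 := by
      have : HasFDerivAt (fun x : Euc N => x j) (EuclideanSpace.proj j : Euc N →L[ℝ] ℝ) x :=
        (EuclideanSpace.proj j : Euc N →L[ℝ] ℝ).hasFDerivAt
      unfold pd
      rw [this.fderiv]
      simp [stdVec_apply]
    rw [this, pd_mul ((contDiff_evalE p (n := 1)).differentiable (by norm_num) x)
      (by fun_prop), hp, hj]
    simp [MvPolynomial.pderiv_X, Pi.single_apply]
    split_ifs <;> simp [evalE]

theorem laplacian_evalE {N : ℕ} (p : MvPolynomial (Fin N) ℝ) (x : Euc N) :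
    Laplacian.laplacian (evalE p) x = evalE (polyLaplacian N p) x := by
  rw [laplacian_eq_sum_pd (contDiff_evalE p).contDiffAt]
  simp [pd_evalE, polyLaplacian]

theorem evalE_injective {N : ℕ} : Function.Injective (evalE : MvPolynomial (Fin N) ℝ → _) := by
  intro p q h
  refine MvPolynomial.funext fun x => ?_
  exact congrFun h (WithLp.toLp 2 x)

theorem polyRestrict_apply {N : ℕ} (p : MvPolynomial (Fin N) ℝ) (x : Sph N) :
    polyRestrict N p x = evalE p x := rfl

theorem evalE_smul_arg {N m : ℕ} {p : MvPolynomial (Fin N) ℝ} (hp : p.IsHomogeneous m) (c : ℝ)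
    (x : Euc N) : evalE p (c • x) = c ^ m * evalE p x := by
  unfold evalE
  rw [MvPolynomial.eval_eq, MvPolynomial.eval_eq, Finset.mul_sum]
  refine Finset.sum_congr rfl fun d hd => ?_
  have h : ∑ i ∈ d.support, d i = m := by
    have := hp.degree_eq_sum_deg_support hd
    simpa using this.symm
  have : ∏ i ∈ d.support, (c • x) i ^ d i = c ^ m * ∏ i ∈ d.support, x i ^ d i := by
    simp only [PiLp.smul_apply, smul_eq_mul, mul_pow, Finset.prod_mul_distrib]
    rw [Finset.prod_pow_eq_pow_sum, h]
  rw [this]; ring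

/-! ### Extensions that are constant along rays -/

theorem homExt_coe {N : ℕ} (f : Sph N → ℝ) (σ : Sph N) : homExt f (σ : Euc N) = f σ := by
  have h1 : ‖(σ : Euc N)‖ = 1 := by simp
  have h0 : (σ : Euc N) ≠ 0 := by rw [← norm_ne_zero_iff, h1]; norm_num
  simp [homExt, h0]

theorem coe_ne_zero {N : ℕ} (σ : Sph N) : (σ : Euc N) ≠ 0 := by
  rw [← norm_ne_zero_iff]; simp

/-- The radial projection of `ℝ^N ∖ {0}` to the unit sphere. -/
def toSph {N : ℕ} (x : Euc N) (h : x ≠ 0) : Sph N :=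
  ⟨‖x‖⁻¹ • x, by simp [norm_smul, inv_mul_cancel₀ (norm_ne_zero_iff.mpr h)]⟩

theorem homExt_of_ne {N : ℕ} (f : Sph N → ℝ) {x : Euc N} (h : x ≠ 0) :
    homExt f x = f (toSph x h) := by simp [homExt, h, toSph]

theorem homExt_smul_arg {N : ℕ} (f : Sph N → ℝ) {c : ℝ} (hc : 0 < c) (x : Euc N) :
    homExt f (c • x) = homExt f x := by
  by_cases h : x = 0
  · simp [h]
  have h' : c • x ≠ 0 := smul_ne_zero hc.ne' h
  rw [homExt_of_ne f h, homExt_of_ne f h']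
  congr 1
  ext1
  simp only [toSph, norm_smul, Real.norm_of_nonneg hc.le, smul_smul]
  congr 1
  field_simp

/-- Homogeneity gives `p(x/|x|) = |x|^{-m} p(x)`. The factor is written as a real power of `|x|²`,
which is smooth off the origin and has simple derivatives. -/
theorem homExt_polyRestrict {N m : ℕ} {p : MvPolynomial (Fin N) ℝ} (hp : p.IsHomogeneous m)
    {x : Euc N} (h : x ≠ 0) :
    homExt (polyRestrict N p) x = (‖x‖ ^ 2) ^ (-(m : ℝ) / 2) * evalE p x := by
  rw [homExt_of_ne _ h, polyRestrict_apply, toSph, evalE_smul_arg hp]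
  congr 1
  rw [← Real.rpow_natCast ‖x‖ 2, ← Real.rpow_mul (norm_nonneg x), ← Real.rpow_natCast,
    Real.inv_rpow (norm_nonneg x), ← Real.rpow_neg (norm_nonneg x)]
  congr 1
  push_cast; ring

theorem homExt_smul_fun {N : ℕ} (c : ℝ) (f : Sph N → ℝ) :
    homExt (fun σ => c * f σ) = fun x => c * homExt f x := by
  ext x
  by_cases h : x = 0
  · simp [homExt, h]
  · simp [homExt, h]

theorem homExt_add {N : ℕ} (f g : Sph N → ℝ) :
    homExt (fun σ => f σ + g σ) = fun x => homExt f x + homExt g x := by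
  ext x
  by_cases h : x = 0
  · simp [homExt, h]
  · simp [homExt, h]

/-- `f` is twice continuously differentiable on the sphere. -/
def IsC2 {N : ℕ} (f : Sph N → ℝ) : Prop := ContDiffOn ℝ 2 (homExt f) {0}ᶜ

theorem IsC2.contDiffAt {N : ℕ} {f : Sph N → ℝ} (hf : IsC2 f) {x : Euc N} (hx : x ≠ 0) :
    ContDiffAt ℝ 2 (homExt f) x :=
  ContDiffOn.contDiffAt hf (isOpen_compl_singleton.mem_nhds hx)

theorem IsC2.add {N : ℕ} {f g : Sph N → ℝ} (hf : IsC2 f) (hg : IsC2 g) :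
    IsC2 (fun σ => f σ + g σ) := by
  unfold IsC2; rw [homExt_add]; exact ContDiffOn.add hf hg

theorem IsC2.const_mul {N : ℕ} {f : Sph N → ℝ} (hf : IsC2 f) (c : ℝ) :
    IsC2 (fun σ => c * f σ) := by
  unfold IsC2; rw [homExt_smul_fun]; exact contDiffOn_const.mul hf

theorem IsC2.continuous {N : ℕ} {f : Sph N → ℝ} (hf : IsC2 f) : Continuous f := by
  have h : f = fun σ : Sph N => homExt f (σ : Euc N) := by ext σ; rw [homExt_coe]
  rw [h, continuous_iff_continuousAt]
  intro σ
  exact ContinuousAt.comp (g := homExt f) (hf.contDiffAt (coe_ne_zero σ)).continuousAt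
    continuous_subtype_val.continuousAt

theorem isC2_const {N : ℕ} (c : ℝ) : IsC2 (fun _ : Sph N => c) := by
  refine ContDiffOn.congr (f := fun _ => c) contDiffOn_const fun x hx => ?_
  rw [homExt_of_ne _ hx]

theorem sphLaplacian_add {N : ℕ} {f g : Sph N → ℝ} (hf : IsC2 f) (hg : IsC2 g) (σ : Sph N) :
    sphLaplacian (fun τ => f τ + g τ) σ = sphLaplacian f σ + sphLaplacian g σ := by
  unfold sphLaplacian
  rw [homExt_add]
  exact (hf.contDiffAt (coe_ne_zero σ)).laplacian_add (hg.contDiffAt (coe_ne_zero σ))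

theorem sphLaplacian_const_mul {N : ℕ} {f : Sph N → ℝ} (hf : IsC2 f) (c : ℝ) (σ : Sph N) :
    sphLaplacian (fun τ => c * f τ) σ = c * sphLaplacian f σ := by
  unfold sphLaplacian
  rw [homExt_smul_fun]
  exact InnerProductSpace.laplacian_smul c (hf.contDiffAt (coe_ne_zero σ))

theorem sphLaplacian_const {N : ℕ} (c : ℝ) (σ : Sph N) :
    sphLaplacian (fun _ => c) σ = 0 := by
  unfold sphLaplacian
  have : homExt (fun _ : Sph N => c) =ᶠ[𝓝 (σ : Euc N)] fun _ => c := by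
    filter_upwards [isOpen_compl_singleton.mem_nhds (coe_ne_zero σ)] with x hx
    rw [homExt_of_ne _ hx]
  rw [InnerProductSpace.laplacian_congr_nhds this |>.eq_of_nhds]
  simp

/-- Radial derivatives of extensions that are constant along rays vanish. -/
theorem sum_mul_pd_homExt {N : ℕ} {f : Sph N → ℝ} (hf : IsC2 f) {x : Euc N} (hx : x ≠ 0) :
    ∑ i, x i * pd i (homExt f) x = 0 := by
  have hd := ((hf.contDiffAt hx).differentiableAt (by norm_num)).hasFDerivAt
  have h1 : ∑ i, x i * pd i (homExt f) x = fderiv ℝ (homExt f) x x := by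
    have e : x = ∑ i, x i • stdVec i := by
      conv_lhs => rw [← (EuclideanSpace.basisFun (Fin N) ℝ).sum_repr x]
      simp [stdVec]
    have h (A : Euc N →L[ℝ] ℝ) : ∑ i, x i * A (stdVec i) = A x := by
      conv_rhs => rw [e]
      simp
    exact h _
  -- The derivative of `t ↦ F(tx)` at `1` is computed twice: by the chain rule, and from the
  -- constancy of `F` along the ray.
  have h2 : HasDerivAt (fun t : ℝ => homExt f (t • x)) (fderiv ℝ (homExt f) x x) 1 := by
    have hg : HasDerivAt (fun t : ℝ => t • x) x 1 := by
      simpa using (hasDerivAt_id (1 : ℝ)).smul_const x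
    have hd' : HasFDerivAt (homExt f) (fderiv ℝ (homExt f) x) ((1 : ℝ) • x) := by simpa using hd
    exact hd'.comp_hasDerivAt 1 hg
  have h3 : HasDerivAt (fun t : ℝ => homExt f (t • x)) 0 1 := by
    refine (hasDerivAt_const (1 : ℝ) (homExt f x)).congr_of_eventuallyEq ?_
    filter_upwards [Ioi_mem_nhds (zero_lt_one' ℝ)] with t ht
    exact homExt_smul_arg f ht x
  rw [h1, h2.unique h3]

/-- The extension is homogeneous of degree `0`, so its Laplacian is homogeneous of degree `-2`. -/
theorem laplacian_homExt {N : ℕ} (f : Sph N → ℝ) {x : Euc N} (hx : x ≠ 0) :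
    Laplacian.laplacian (homExt f) x = ‖x‖⁻¹ ^ 2 * sphLaplacian f (toSph x hx) := by
  have hc : (0 : ℝ) < ‖x‖⁻¹ := inv_pos.mpr (norm_pos_iff.mpr hx)
  have h : (fun y => homExt f (‖x‖⁻¹ • y)) = homExt f := by
    ext y; exact homExt_smul_arg f hc y
  have h1 : fderiv ℝ (homExt f) = fun y => ‖x‖⁻¹ • fderiv ℝ (homExt f) (‖x‖⁻¹ • y) := by
    ext1 y
    conv_lhs => rw [← h]
    exact fderiv_comp_smul _
  have h2 : fderiv ℝ (fderiv ℝ (homExt f)) x =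
      ‖x‖⁻¹ • ‖x‖⁻¹ • fderiv ℝ (fderiv ℝ (homExt f)) (‖x‖⁻¹ • x) := by
    conv_lhs => rw [h1]
    have := fderiv_comp_smul (𝕜 := ℝ) (f := fderiv ℝ (homExt f)) (x := x) ‖x‖⁻¹
    -- Scaling by an invertible constant commutes with `fderiv` even where the function is not
    -- differentiable; `f` is arbitrary here.
    have hi : Invertible ‖x‖⁻¹ := invertibleOfNonzero hc.ne'
    refine (fderiv_const_smul_of_invertible (𝕜 := ℝ) (f := fun y => fderiv ℝ (homExt f) (‖x‖⁻¹ • y))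
      ‖x‖⁻¹).trans ?_
    rw [this]
  unfold sphLaplacian
  rw [InnerProductSpace.laplacian_eq_iteratedFDeriv_stdOrthonormalBasis]
  simp only [iteratedFDeriv_two_apply, h2, toSph, Finset.mul_sum]
  refine Finset.sum_congr rfl fun i _ => ?_
  simp
  ring

theorem hasFDerivAt_normSq_rpow {N : ℕ} (a : ℝ) {x : Euc N} (hx : x ≠ 0) :
    HasFDerivAt (fun y : Euc N => (‖y‖ ^ 2) ^ a)
      ((a * (‖x‖ ^ 2) ^ (a - 1)) • ((2 : ℝ) • innerSL ℝ x)) x := by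
  have h := (hasStrictFDerivAt_norm_sq x).hasFDerivAt
  have := h.rpow_const (p := a) (Or.inl (by positivity))
  refine this.congr_fderiv ?_
  ext y
  simp [two_smul]

theorem pd_normSq_rpow {N : ℕ} (a : ℝ) (i : Fin N) {x : Euc N} (hx : x ≠ 0) :
    pd i (fun y : Euc N => (‖y‖ ^ 2) ^ a) x = 2 * a * ((‖x‖ ^ 2) ^ (a - 1) * x i) := by
  unfold pd
  rw [(hasFDerivAt_normSq_rpow a hx).fderiv]
  have : inner ℝ x (stdVec i) = x i := by simp [stdVec, EuclideanSpace.inner_single_right]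
  simp [this]
  ring

theorem contDiffAt_normSq_rpow {N : ℕ} (a : ℝ) {x : Euc N} (hx : x ≠ 0) {n : WithTop ℕ∞} :
    ContDiffAt ℝ n (fun y : Euc N => (‖y‖ ^ 2) ^ a) x :=
  ((contDiff_norm_sq ℝ).contDiffAt).rpow_const_of_ne (by positivity)

theorem pd_coord {N : ℕ} (i j : Fin N) (x : Euc N) :
    pd i (fun y : Euc N => y j) x = if j = i then 1 else 0 := by
  have : HasFDerivAt (fun x : Euc N => x j) (EuclideanSpace.proj j : Euc N →L[ℝ] ℝ) x :=
    (EuclideanSpace.proj j : Euc N →L[ℝ] ℝ).hasFDerivAt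
  unfold pd
  rw [this.fderiv]
  simp [stdVec_apply]

theorem sum_sq_coe_sph {N : ℕ} (σ : Sph N) : ∑ i, (σ : Euc N) i ^ 2 = 1 := by
  have h1 : ‖(σ : Euc N)‖ = 1 := by simp
  have := EuclideanSpace.norm_sq_eq (σ : Euc N)
  rw [h1] at this
  simpa using this.symm

theorem laplacian_normSq_rpow {N : ℕ} (a : ℝ) (σ : Sph N) :
    Laplacian.laplacian (fun y : Euc N => (‖y‖ ^ 2) ^ a) (σ : Euc N) =
      4 * a * (a - 1) + 2 * a * N := by
  have hx := coe_ne_zero σ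
  have h1 : ‖(σ : Euc N)‖ = 1 := by simp
  rw [laplacian_eq_sum_pd (contDiffAt_normSq_rpow a hx)]
  have h (i : Fin N) : pd i (pd i fun y : Euc N => (‖y‖ ^ 2) ^ a) (σ : Euc N) =
      4 * a * (a - 1) * (σ : Euc N) i ^ 2 + 2 * a := by
    have e : (pd i fun y : Euc N => (‖y‖ ^ 2) ^ a) =ᶠ[𝓝 (σ : Euc N)]
        fun y => (2 * a * y i) * (‖y‖ ^ 2) ^ (a - 1) := by
      filter_upwards [isOpen_compl_singleton.mem_nhds hx] with y hy
      rw [pd_normSq_rpow a i hy]; ring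
    rw [pd_congr e, pd_mul (by fun_prop)
      ((contDiffAt_normSq_rpow (a - 1) hx (n := 1)).differentiableAt (by norm_num)),
      pd_normSq_rpow _ _ hx, pd_mul (by fun_prop) (by fun_prop), pd_coord, h1]
    have : pd i (fun _ : Euc N => 2 * a) (σ : Euc N) = 0 := by simp [pd]
    rw [this]
    simp
    ring
  simp only [h, Finset.sum_add_distrib, ← Finset.mul_sum, sum_sq_coe_sph]
  simp
  ring

theorem isC2_polyRestrict {N m : ℕ} {p : MvPolynomial (Fin N) ℝ} (hp : p.IsHomogeneous m) :
    IsC2 (polyRestrict N p) := by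
  intro x hx
  refine ContDiffAt.contDiffWithinAt ?_
  refine ((contDiffAt_normSq_rpow (-(m : ℝ) / 2) hx).mul
    (contDiff_evalE p).contDiffAt).congr_of_eventuallyEq ?_
  filter_upwards [isOpen_compl_singleton.mem_nhds hx] with y hy
  exact homExt_polyRestrict hp hy

theorem sum_mul_evalE_pderiv {N m : ℕ} {p : MvPolynomial (Fin N) ℝ} (hp : p.IsHomogeneous m)
    (x : Euc N) : ∑ i, x i * evalE (MvPolynomial.pderiv i p) x = m * evalE p x := by
  have := congrArg (fun q => evalE q x) hp.sum_X_mul_pderiv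
  simpa [nsmul_eq_mul, evalE] using this

/-- The Laplace-Beltrami operator on restrictions of homogeneous polynomials. -/
theorem sphLaplacian_polyRestrict {N m : ℕ} {p : MvPolynomial (Fin N) ℝ} (hp : p.IsHomogeneous m)
    (σ : Sph N) : sphLaplacian (polyRestrict N p) σ =
      evalE (polyLaplacian N p) σ - m * ((N : ℝ) - 2 + m) * evalE p σ := by
  have hx := coe_ne_zero σ
  have h1 : ‖(σ : Euc N)‖ = 1 := by simp
  unfold sphLaplacian
  have e : homExt (polyRestrict N p) =ᶠ[𝓝 (σ : Euc N)]
      fun y => (‖y‖ ^ 2) ^ (-(m : ℝ) / 2) * evalE p y := by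
    filter_upwards [isOpen_compl_singleton.mem_nhds hx] with y hy
    exact homExt_polyRestrict hp hy
  rw [(InnerProductSpace.laplacian_congr_nhds e).eq_of_nhds,
    laplacian_mul (contDiffAt_normSq_rpow _ hx) (contDiff_evalE p).contDiffAt,
    laplacian_evalE, laplacian_normSq_rpow]
  -- On the sphere the gradient of `|x|^{-m}` is `-m x`, so Euler's identity for `p` evaluates the
  -- cross term.
  have h2 : ∑ i, pd i (fun y : Euc N => (‖y‖ ^ 2) ^ (-(m : ℝ) / 2)) σ * pd i (evalE p) σ =
      -m * (m * evalE p σ) := by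
    rw [← sum_mul_evalE_pderiv hp, Finset.mul_sum]
    refine Finset.sum_congr rfl fun i _ => ?_
    rw [pd_normSq_rpow _ _ hx, pd_evalE, h1]
    simp
    ring
  rw [h2, h1]
  simp
  ring

theorem sphLaplacian_harmonic {N m : ℕ} {p : MvPolynomial (Fin N) ℝ} (hp : p ∈ harmonicPoly N m)
    (σ : Sph N) : sphLaplacian (polyRestrict N p) σ =
      -(m * ((N : ℝ) - 2 + m)) * polyRestrict N p σ := by
  have h1 : p.IsHomogeneous m := hp.1
  have h2 : polyLaplacian N p = 0 := hp.2
  rw [sphLaplacian_polyRestrict h1, h2, polyRestrict_apply]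
  simp [evalE]

/-! ### Integration on the sphere -/

/-- Integration by parts against the constant `1`; compact support removes the boundary term. -/
theorem integral_pd_eq_zero {N : ℕ} {W : Euc N → ℝ} (hW : ContDiff ℝ 1 W)
    (hc : HasCompactSupport W) (i : Fin N) : ∫ x, pd i W x = 0 := by
  have hcont : Continuous (pd i W) :=
    (hW.continuous_fderiv (by norm_num)).clm_apply continuous_const
  have hcs : HasCompactSupport (pd i W) := by
    refine hc.fderiv (𝕜 := ℝ) |>.mono ?_
    intro x hx
    simp only [Function.mem_support, pd] at hx ⊢
    intro h
    exact hx (by rw [h]; rfl)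
  have h := integral_mul_fderiv_eq_neg_fderiv_mul_of_integrable (μ := (volume : Measure (Euc N)))
    (f := fun _ => (1 : ℝ)) (g := W) (v := stdVec i) (by simp)
    (by simp only [one_mul]; exact hcont.integrable_of_hasCompactSupport hcs)
    (by simpa using hW.continuous.integrable_of_hasCompactSupport hc)
    (fun _ _ => differentiableAt_const _) (fun x _ => hW.differentiable (by norm_num) x)
  simpa [pd] using h

theorem toSph_eq {N : ℕ} (x : ({0}ᶜ : Set (Euc N))) :
    (homeomorphUnitSphereProd (Euc N) x).1 = toSph x.1 x.2 := by
  ext1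
  simp [toSph, homeomorphUnitSphereProd]

instance nontrivial_euc {N : ℕ} [Fact (2 ≤ N)] : Nontrivial (Euc N) := by
  have : 2 ≤ N := Fact.out
  have : Nonempty (Fin N) := ⟨⟨0, by omega⟩⟩
  infer_instance

/-- Polar coordinates, after discarding the null set `{0}`. This transfers integral identities from
`ℝ^N` to the sphere, once the radial integral is known to be nonzero. -/
theorem integral_radial_mul {N : ℕ} [Fact (2 ≤ N)] (φ : ℝ → ℝ) (g : Sph N → ℝ) :
    ∫ x : Euc N, φ ‖x‖ * homExt g x =
      (∫ r : Ioi (0 : ℝ), φ r ∂(Measure.volumeIoiPow (Module.finrank ℝ (Euc N) - 1))) *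
        ∫ σ, g σ ∂(sphMeasure N) := by
  have h1 : ∫ x : Euc N, φ ‖x‖ * homExt g x =
      ∫ x : ({0}ᶜ : Set (Euc N)), φ ‖x.1‖ * homExt g x.1 ∂((volume : Measure (Euc N)).comap (↑)) := by
    rw [integral_subtype_comap (measurableSet_singleton _).compl
      (fun x : Euc N => φ ‖x‖ * homExt g x), restrict_compl_singleton]
  rw [h1, mul_comm, ← integral_prod_mul]
  rw [← ((volume : Measure (Euc N)).measurePreserving_homeomorphUnitSphereProd).integral_comp
    (Homeomorph.measurableEmbedding _)]
  refine integral_congr_ae (Filter.Eventually.of_forall fun x => ?_)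
  simp only [homeomorphUnitSphereProd_apply_snd_coe, toSph_eq]
  rw [homExt_of_ne g x.2, mul_comm]

/-- A smooth bump function of `|x|²` supported away from the origin. -/
def annulusBump : ContDiffBump (1 : ℝ) := ⟨1 / 4, 1 / 2, by norm_num, by norm_num⟩

theorem annulusBump_eq_zero {s : ℝ} (hs : s ≤ 1 / 2 ∨ 3 / 2 ≤ s) : annulusBump s = 0 := by
  apply annulusBump.zero_of_le_dist
  change 1 / 2 ≤ |s - 1|
  rcases hs with h | h
  · rw [abs_of_nonpos (by linarith)]; linarith
  · rw [abs_of_nonneg (by linarith)]; linarith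

theorem contDiff_bump_normSq {N : ℕ} {n : ℕ∞} :
    ContDiff ℝ n (fun x : Euc N => annulusBump (‖x‖ ^ 2)) :=
  annulusBump.contDiff.comp (contDiff_norm_sq ℝ)

theorem bump_eventually_zero {N : ℕ} :
    ∀ᶠ x : Euc N in 𝓝 0, annulusBump (‖x‖ ^ 2) = 0 := by
  have : ∀ᶠ x : Euc N in 𝓝 0, ‖x‖ ^ 2 < 1 / 2 := by
    have hc : ContinuousAt (fun x : Euc N => ‖x‖ ^ 2) 0 := by fun_prop
    exact hc.eventually_lt continuousAt_const (by norm_num)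
  filter_upwards [this] with x hx
  exact annulusBump_eq_zero (Or.inl hx.le)

theorem hasCompactSupport_bump_mul {N : ℕ} (V : Euc N → ℝ) :
    HasCompactSupport (fun x => annulusBump (‖x‖ ^ 2) * V x) := by
  refine HasCompactSupport.of_support_subset_isCompact (isCompact_closedBall (0 : Euc N) 2) ?_
  intro x hx
  by_contra h
  have h2 : 2 < ‖x‖ := by simpa using h
  exact hx (by simp [annulusBump_eq_zero (s := ‖x‖ ^ 2) (Or.inr (by nlinarith))])

theorem pd_bump_normSq {N : ℕ} (i : Fin N) (x : Euc N) :
    pd i (fun x : Euc N => annulusBump (‖x‖ ^ 2)) x =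
      2 * deriv annulusBump (‖x‖ ^ 2) * x i := by
  have h1 := (hasStrictFDerivAt_norm_sq x).hasFDerivAt
  have h2 : HasDerivAt annulusBump (deriv annulusBump (‖x‖ ^ 2)) (‖x‖ ^ 2) :=
    (annulusBump.contDiff (n := 1)).differentiable (by norm_num) _ |>.hasDerivAt
  have h3 := h2.comp_hasFDerivAt x h1
  have : inner ℝ x (stdVec i) = x i := by simp [stdVec, EuclideanSpace.inner_single_right]
  unfold pd
  have e : (fun x : Euc N => annulusBump (‖x‖ ^ 2)) = annulusBump ∘ fun x => ‖x‖ ^ 2 := rfl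
  rw [e, h3.fderiv]
  simp [this]
  ring

/-- The cutoff vanishes near the origin, so a singularity of `V` there is harmless. -/
theorem contDiff_bump_mul {N : ℕ} {V : Euc N → ℝ} (hV : ∀ x ≠ 0, ContDiffAt ℝ 1 V x) :
    ContDiff ℝ 1 (fun x => annulusBump (‖x‖ ^ 2) * V x) := by
  rw [contDiff_iff_contDiffAt]
  intro x
  by_cases hx : x = 0
  · subst hx
    refine (contDiffAt_const (c := (0 : ℝ))).congr_of_eventuallyEq ?_
    filter_upwards [bump_eventually_zero] with y hy
    simp [hy]
  · exact (contDiff_bump_normSq (n := 1)).contDiffAt.mul (hV x hx)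

/-- The flux form `G ∂ᵢF - F ∂ᵢG` for the extensions `F`, `G` of `f`, `g`. -/
def flux {N : ℕ} (f g : Sph N → ℝ) (i : Fin N) (x : Euc N) : ℝ :=
  homExt g x * pd i (homExt f) x + (-homExt f x) * pd i (homExt g) x

theorem contDiffAt_flux {N : ℕ} {f g : Sph N → ℝ} (hf : IsC2 f) (hg : IsC2 g) (i : Fin N)
    {x : Euc N} (hx : x ≠ 0) : ContDiffAt ℝ 1 (flux f g i) x := by
  have h1 := hf.contDiffAt hx
  have h2 := hg.contDiffAt hx
  exact ((h2.of_le (by norm_num)).mul (contDiffAt_pd h1 (by norm_num))).add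
    ((h1.of_le (by norm_num)).neg.mul (contDiffAt_pd h2 (by norm_num)))

theorem pd_flux {N : ℕ} {f g : Sph N → ℝ} (hf : IsC2 f) (hg : IsC2 g) (i : Fin N)
    {x : Euc N} (hx : x ≠ 0) : pd i (flux f g i) x =
      homExt g x * pd i (pd i (homExt f)) x - homExt f x * pd i (pd i (homExt g)) x := by
  have h1 := hf.contDiffAt hx
  have h2 := hg.contDiffAt hx
  have d1 := h1.differentiableAt (by norm_num)
  have d2 := h2.differentiableAt (by norm_num)
  have d1' := (contDiffAt_pd (i := i) (m := 1) h1 (by norm_num)).differentiableAt (by norm_num)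
  have d2' := (contDiffAt_pd (i := i) (m := 1) h2 (by norm_num)).differentiableAt (by norm_num)
  have e : pd i (fun y => -homExt f y) x = -pd i (homExt f) x := by
    unfold pd; rw [fderiv_fun_neg]; rfl
  unfold flux
  rw [pd_add (d2.fun_mul d1') (d1.fun_neg.fun_mul d2'), pd_mul d2 d1', pd_mul d1.fun_neg d2', e]
  ring

/-- The gradient of the cutoff is radial, and the two extensions have no radial derivative, so the
terms with `deriv annulusBump` vanish. Only the cutoff times `G ΔF - F ΔG` survives, and this is
homogeneous of degree `-2`. -/
theorem sum_pd_bump_flux {N : ℕ} {f g : Sph N → ℝ} (hf : IsC2 f) (hg : IsC2 g) (x : Euc N) :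
    ∑ i, pd i (fun x => annulusBump (‖x‖ ^ 2) * flux f g i x) x =
      (annulusBump (‖x‖ ^ 2) * ‖x‖⁻¹ ^ 2) *
        homExt (fun σ => sphLaplacian f σ * g σ - f σ * sphLaplacian g σ) x := by
  by_cases hx : x = 0
  · have h0 (i : Fin N) : pd i (fun x => annulusBump (‖x‖ ^ 2) * flux f g i x) x = 0 := by
      have : (fun x => annulusBump (‖x‖ ^ 2) * flux f g i x) =ᶠ[𝓝 x] fun _ => 0 := by
        rw [hx]
        filter_upwards [bump_eventually_zero] with y hy
        simp [hy]
      rw [pd_congr this]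
      simp [pd]
    simp only [h0, Finset.sum_const_zero]
    simp [hx]
  · have h1 := hf.contDiffAt hx
    have h2 := hg.contDiffAt hx
    have hi (i : Fin N) : pd i (fun x => annulusBump (‖x‖ ^ 2) * flux f g i x) x =
        annulusBump (‖x‖ ^ 2) * (homExt g x * pd i (pd i (homExt f)) x) -
        annulusBump (‖x‖ ^ 2) * (homExt f x * pd i (pd i (homExt g)) x) +
        2 * deriv annulusBump (‖x‖ ^ 2) * homExt g x * (x i * pd i (homExt f) x) -
        2 * deriv annulusBump (‖x‖ ^ 2) * homExt f x * (x i * pd i (homExt g) x) := by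
      rw [pd_mul ((contDiff_bump_normSq (n := 1)).differentiable (by norm_num) x)
        ((contDiffAt_flux hf hg i hx).differentiableAt (by norm_num)), pd_flux hf hg i hx,
        pd_bump_normSq]
      unfold flux
      ring
    simp only [hi, Finset.sum_add_distrib, Finset.sum_sub_distrib, ← Finset.mul_sum,
      sum_mul_pd_homExt hf hx, sum_mul_pd_homExt hg hx, ← laplacian_eq_sum_pd h1,
      ← laplacian_eq_sum_pd h2, laplacian_homExt _ hx, homExt_of_ne _ hx]
    ring

/-- If the radial integral vanished, polar coordinates with `g = 1` would give integral zero to a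
continuous nonnegative function on `ℝ^N` that is positive at a unit vector. -/
theorem integral_bump_ne_zero {N : ℕ} [Fact (2 ≤ N)] :
    (∫ r : Ioi (0 : ℝ), annulusBump ((r : ℝ) ^ 2) * (r : ℝ)⁻¹ ^ 2
      ∂(Measure.volumeIoiPow (Module.finrank ℝ (Euc N) - 1))) ≠ 0 := by
  intro h0
  have h := integral_radial_mul (N := N) (fun r => annulusBump (r ^ 2) * r⁻¹ ^ 2) (fun _ => 1)
  rw [h0, zero_mul] at h
  set F : Euc N → ℝ := fun x => annulusBump (‖x‖ ^ 2) * ((‖x‖⁻¹ ^ 2) * homExt (fun _ => 1) x)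
  have hF : ContDiff ℝ 1 F := by
    refine contDiff_bump_mul fun x hx => ?_
    refine ContDiffAt.mul ?_ (((isC2_const 1).contDiffAt hx).of_le (by norm_num))
    exact ((contDiffAt_norm ℝ hx).inv (norm_ne_zero_iff.mpr hx)).pow 2
  have hpos : 0 ≤ F := by
    intro x
    by_cases hx : x = 0
    · simp [F, hx]
    · simp only [F, homExt_of_ne _ hx]
      have := annulusBump.nonneg (x := ‖x‖ ^ 2)
      simp only [Pi.zero_apply]
      positivity
  have hint : ∫ x, F x = 0 := by
    rw [← h]; congr 1; ext x; simp only [F]; ring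
  have hz := (hF.continuous.integral_pos_of_hasCompactSupport_nonneg_nonzero (μ := volume) (x := ?_)
    (hasCompactSupport_bump_mul _) hpos ?_).ne'
  · exact hz hint
  · exact stdVec ⟨0, by have : 2 ≤ N := Fact.out; omega⟩
  · have h1 : ‖(stdVec ⟨0, by have : 2 ≤ N := Fact.out; omega⟩ : Euc N)‖ = 1 := by
      simp [stdVec]
    have h2 : (stdVec ⟨0, by have : 2 ≤ N := Fact.out; omega⟩ : Euc N) ≠ 0 := by
      rw [← norm_ne_zero_iff, h1]; norm_num
    have h3 : annulusBump 1 = 1 :=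
      annulusBump.one_of_mem_closedBall (by simp [annulusBump])
    simp [F, h1, homExt_of_ne _ h2, h3]

/-- Green's identity on the sphere, before splitting the integral. -/
theorem integral_sphLaplacian_sub {N : ℕ} [Fact (2 ≤ N)] {f g : Sph N → ℝ} (hf : IsC2 f)
    (hg : IsC2 g) :
    ∫ σ, (sphLaplacian f σ * g σ - f σ * sphLaplacian g σ) ∂(sphMeasure N) = 0 := by
  have h := integral_radial_mul (N := N) (fun r => annulusBump (r ^ 2) * r⁻¹ ^ 2)
    (fun σ => sphLaplacian f σ * g σ - f σ * sphLaplacian g σ)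
  have hC (i : Fin N) := contDiff_bump_mul fun x hx => contDiffAt_flux hf hg i hx
  have hs (i : Fin N) : HasCompactSupport fun x => annulusBump (‖x‖ ^ 2) * flux f g i x :=
    hasCompactSupport_bump_mul _
  rw [integral_congr_ae (Filter.Eventually.of_forall fun x => (sum_pd_bump_flux hf hg x).symm),
    integral_finsetSum _ fun i _ => ?_, Finset.sum_eq_zero fun i _ =>
      integral_pd_eq_zero (hC i) (hs i) i] at h
  · exact (mul_eq_zero.mp h.symm).resolve_left integral_bump_ne_zero
  · refine Continuous.integrable_of_hasCompactSupport
      (((hC i).continuous_fderiv (by norm_num)).clm_apply continuous_const) ?_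
    refine (hs i).fderiv (𝕜 := ℝ) |>.mono ?_
    intro x hx
    simp only [Function.mem_support, pd] at hx ⊢
    intro h
    exact hx (by rw [h]; rfl)

theorem IsC2.continuous_sphLaplacian {N : ℕ} {f : Sph N → ℝ} (hf : IsC2 f) :
    Continuous (sphLaplacian f) := by
  rw [continuous_iff_continuousAt]
  intro σ
  have hx := coe_ne_zero σ
  have h : Laplacian.laplacian (homExt f) =ᶠ[𝓝 (σ : Euc N)]
      fun x => ∑ i, pd i (pd i (homExt f)) x := by
    filter_upwards [isOpen_compl_singleton.mem_nhds hx] with y hy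
    exact laplacian_eq_sum_pd (hf.contDiffAt hy)
  have hc : ContinuousAt (Laplacian.laplacian (homExt f)) (σ : Euc N) := by
    refine ContinuousAt.congr (f := fun x => ∑ i, pd i (pd i (homExt f)) x) ?_ h.symm
    refine tendsto_finsetSum _ fun i _ => ?_
    exact (contDiffAt_pd (m := 0) (contDiffAt_pd (m := 1) (hf.contDiffAt hx) (by norm_num))
      (by norm_num)).continuousAt
  exact ContinuousAt.comp (g := Laplacian.laplacian (homExt f)) hc
    continuous_subtype_val.continuousAt

theorem integrable_of_continuous {N : ℕ} {f : Sph N → ℝ} (hf : Continuous f) :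
    Integrable f (sphMeasure N) :=
  hf.integrable_of_hasCompactSupport (HasCompactSupport.of_compactSpace f)

theorem integral_sphLaplacian_mul {N : ℕ} [Fact (2 ≤ N)] {f g : Sph N → ℝ} (hf : IsC2 f)
    (hg : IsC2 g) : ∫ σ, sphLaplacian f σ * g σ ∂(sphMeasure N) =
      ∫ σ, f σ * sphLaplacian g σ ∂(sphMeasure N) := by
  have h := integral_sphLaplacian_sub hf hg
  have h1 := integrable_of_continuous (hf.continuous_sphLaplacian.mul hg.continuous)
  have h2 := integrable_of_continuous (hf.continuous.mul hg.continuous_sphLaplacian)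
  exact sub_eq_zero.mp ((integral_sub h1 h2).symm.trans h)

/-! ### Orthogonality and completeness of the spherical harmonics -/

/-- The class in `L²(S^{N-1})` of a continuous function. -/
def toLtwo {N : ℕ} : C(Sph N, ℝ) →L[ℝ] L2 N := ContinuousMap.toLp 2 (sphMeasure N) ℝ

theorem inner_toLtwo {N : ℕ} (f g : C(Sph N, ℝ)) :
    inner ℝ (toLtwo f) (toLtwo g) = ∫ σ, f σ * g σ ∂(sphMeasure N) := by
  unfold toLtwo
  rw [ContinuousMap.inner_toLp]
  simp [mul_comm]

theorem toLtwo_injective {N : ℕ} : Function.Injective (toLtwo : C(Sph N, ℝ) → L2 N) :=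
  ContinuousMap.toLp_injective (sphMeasure N)

theorem coeFn_toLtwo {N : ℕ} (f : C(Sph N, ℝ)) : toLtwo f =ᵐ[sphMeasure N] f :=
  ContinuousMap.coeFn_toLp (sphMeasure N) f

theorem mem_sphHarm {N l : ℕ} {v : L2 N} :
    v ∈ sphHarm N l ↔ ∃ p ∈ harmonicPoly N l, toLtwo (polyRestrict N p) = v := by
  simp [sphHarm, toLtwo]

/-- `γ_l = l (N - 2 + l)`. -/
def gam (N l : ℕ) : ℝ := l * ((N : ℝ) - 2 + l)

theorem gam_lt_gam {N : ℕ} (hN : 2 ≤ N) {j k : ℕ} (h : j < k) : gam N j < gam N k := by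
  have hN' : (2 : ℝ) ≤ N := by exact_mod_cast hN
  have h' : (j : ℝ) < k := by exact_mod_cast h
  have hj : (0 : ℝ) ≤ j := by positivity
  unfold gam
  nlinarith

theorem gam_injective {N : ℕ} (hN : 2 ≤ N) : Function.Injective (gam N) :=
  StrictMono.injective fun _ _ h => gam_lt_gam hN h

theorem sq_le_gam {N : ℕ} (hN : 2 ≤ N) (l : ℕ) : (l : ℝ) ^ 2 ≤ gam N l := by
  have hN' : (2 : ℝ) ≤ N := by exact_mod_cast hN
  have hl : (0 : ℝ) ≤ l := by positivity
  unfold gam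
  nlinarith

theorem isC2_harmonic {N l : ℕ} {p : MvPolynomial (Fin N) ℝ} (hp : p ∈ harmonicPoly N l) :
    IsC2 (polyRestrict N p) := isC2_polyRestrict (m := l) hp.1

theorem sphLaplacian_harmonic_gam {N l : ℕ} {p : MvPolynomial (Fin N) ℝ}
    (hp : p ∈ harmonicPoly N l) (σ : Sph N) :
    sphLaplacian (polyRestrict N p) σ = -gam N l * polyRestrict N p σ :=
  sphLaplacian_harmonic hp σ

/-- Eigenfunctions of a symmetric operator for the distinct eigenvalues `-γ_l` and `-γ_m` are
orthogonal. -/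
theorem integral_harmonic_mul_harmonic {N : ℕ} [hN : Fact (2 ≤ N)] {l m : ℕ} (hlm : l ≠ m)
    {p q : MvPolynomial (Fin N) ℝ} (hp : p ∈ harmonicPoly N l) (hq : q ∈ harmonicPoly N m) :
    ∫ σ, polyRestrict N p σ * polyRestrict N q σ ∂(sphMeasure N) = 0 := by
  have h := integral_sphLaplacian_mul (isC2_harmonic hp) (isC2_harmonic hq)
  simp only [sphLaplacian_harmonic_gam hp, sphLaplacian_harmonic_gam hq] at h
  have h1 : ∀ σ, -gam N l * polyRestrict N p σ * polyRestrict N q σ =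
      -gam N l * (polyRestrict N p σ * polyRestrict N q σ) := fun σ => by ring
  have h2 : ∀ σ, polyRestrict N p σ * (-gam N m * polyRestrict N q σ) =
      -gam N m * (polyRestrict N p σ * polyRestrict N q σ) := fun σ => by ring
  simp only [h1, h2, integral_const_mul] at h
  have h3 : (gam N m - gam N l) *
      ∫ σ, polyRestrict N p σ * polyRestrict N q σ ∂(sphMeasure N) = 0 := by linarith
  exact (mul_eq_zero.mp h3).resolve_left
    (sub_ne_zero.mpr fun h => hlm (gam_injective hN.out h.symm))

theorem orthogonalFamily_sphHarm {N : ℕ} [Fact (2 ≤ N)] :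
    OrthogonalFamily ℝ (fun l => sphHarm N l) fun l => (sphHarm N l).subtypeₗᵢ := by
  intro l m hlm u v
  obtain ⟨p, hp, hpu⟩ := mem_sphHarm.mp u.2
  obtain ⟨q, hq, hqv⟩ := mem_sphHarm.mp v.2
  change inner ℝ (u : L2 N) (v : L2 N) = 0
  rw [← hpu, ← hqv, inner_toLtwo]
  exact integral_harmonic_mul_harmonic hlm hp hq

/-! ### Decomposition of polynomials on the sphere, and density -/

/-- `|x|²` as a polynomial. -/
def normSqPoly (N : ℕ) : MvPolynomial (Fin N) ℝ := ∑ i, MvPolynomial.X i ^ 2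

theorem isHomogeneous_normSqPoly (N : ℕ) : (normSqPoly N).IsHomogeneous 2 :=
  MvPolynomial.IsHomogeneous.sum _ _ _ fun i _ => MvPolynomial.isHomogeneous_X_pow i 2

theorem polyRestrict_normSqPoly_mul {N : ℕ} (p : MvPolynomial (Fin N) ℝ) :
    polyRestrict N (normSqPoly N * p) = polyRestrict N p := by
  ext σ
  have := sum_sq_coe_sph σ
  simp [polyRestrict, normSqPoly, this]

theorem isHomogeneous_polyLaplacian {N m : ℕ} {p : MvPolynomial (Fin N) ℝ}
    (hp : p.IsHomogeneous (m + 2)) : (polyLaplacian N p).IsHomogeneous m := by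
  simp only [polyLaplacian, LinearMap.sum_apply]
  exact MvPolynomial.IsHomogeneous.sum _ _ _ fun i _ => (hp.pderiv (i := i)).pderiv

theorem polyLaplacian_eq_zero {N m : ℕ} (hm : m < 2) {p : MvPolynomial (Fin N) ℝ}
    (hp : p.IsHomogeneous m) : polyLaplacian N p = 0 := by
  simp only [polyLaplacian, LinearMap.sum_apply]
  refine Finset.sum_eq_zero fun i _ => ?_
  have h : (MvPolynomial.pderiv i p).totalDegree = 0 := by
    have := (hp.pderiv (i := i)).totalDegree_le
    omega
  rw [MvPolynomial.totalDegree_eq_zero_iff_eq_C] at h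
  change MvPolynomial.pderiv i (MvPolynomial.pderiv i p) = 0
  rw [h]; simp

/-- The finite sums of spherical harmonics, as continuous functions on the sphere. -/
def harmSpan (N : ℕ) (s : Set ℕ) : Submodule ℝ C(Sph N, ℝ) :=
  ⨆ l ∈ s, (harmonicPoly N l).map (polyRestrict N)

theorem inner_eq_zero_of_mem_harmSpan {N : ℕ} [Fact (2 ≤ N)] {s : Set ℕ} {l : ℕ} (hl : l ∉ s)
    {f : C(Sph N, ℝ)} (hf : f ∈ harmSpan N s) {p : MvPolynomial (Fin N) ℝ}
    (hp : p ∈ harmonicPoly N l) : inner ℝ (toLtwo (polyRestrict N p)) (toLtwo f) = 0 := by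
  have h : harmSpan N s ≤
      LinearMap.ker ((innerSL ℝ (toLtwo (polyRestrict N p))).comp toLtwo).toLinearMap := by
    refine iSup₂_le fun m hm => ?_
    rintro _ ⟨q, hq, rfl⟩
    rw [LinearMap.mem_ker]
    change inner ℝ (toLtwo (polyRestrict N p)) (toLtwo (polyRestrict N q)) = 0
    rw [inner_toLtwo]
    exact integral_harmonic_mul_harmonic (by rintro rfl; exact hl hm) hp hq
  exact h hf

theorem eq_zero_of_polyRestrict_eq_zero {N m : ℕ} {p : MvPolynomial (Fin N) ℝ} (hN : 2 ≤ N)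
    (hp : p.IsHomogeneous m) (h : polyRestrict N p = 0) : p = 0 := by
  apply evalE_injective
  have key (x : Euc N) (hx : x ≠ 0) : evalE p x = 0 := by
    have h1 : x = ‖x‖ • (toSph x hx : Euc N) := by
      simp [toSph, smul_smul, mul_inv_cancel₀ (norm_ne_zero_iff.mpr hx)]
    have h2 : evalE p (toSph x hx : Euc N) = 0 := by
      rw [← polyRestrict_apply, h]; rfl
    rw [h1, evalE_smul_arg hp, h2, mul_zero]
  have : Fact (2 ≤ N) := ⟨hN⟩
  have hd : Dense ({0}ᶜ : Set (Euc N)) := dense_compl_singleton 0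
  have hc : Continuous (evalE p) := (contDiff_evalE p (n := 0)).continuous
  have h0 : evalE (0 : MvPolynomial (Fin N) ℝ) = fun _ => 0 := by ext x; simp [evalE]
  rw [h0]
  exact Continuous.ext_on hd hc continuous_const fun x hx => key x hx

/-- The restriction to the sphere of a homogeneous polynomial is a sum of spherical harmonics. -/
theorem polyRestrict_mem_harmSpan {N : ℕ} [hN : Fact (2 ≤ N)] (m : ℕ) :
    ∀ p : MvPolynomial (Fin N) ℝ, p.IsHomogeneous m → polyRestrict N p ∈ harmSpan N (Iic m) := by
  induction m using Nat.strong_induction_on with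
  | _ m ih =>
    intro p hp
    have hmono {a b : ℕ} (hab : a ≤ b) : harmSpan N (Iic a) ≤ harmSpan N (Iic b) :=
      biSup_mono fun l hl => le_trans hl hab
    have hharm {q : MvPolynomial (Fin N) ℝ} (hq : q ∈ harmonicPoly N m) :
        polyRestrict N q ∈ harmSpan N (Iic m) :=
      Submodule.mem_iSup_of_mem m (Submodule.mem_iSup_of_mem (mem_Iic.mpr le_rfl)
        (Submodule.mem_map_of_mem hq))
    rcases Nat.lt_or_ge m 2 with hm | hm
    · exact hharm ⟨hp, polyLaplacian_eq_zero hm hp⟩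
    · obtain ⟨k, rfl⟩ := Nat.exists_eq_add_of_le' hm
      have : FiniteDimensional ℝ (MvPolynomial.homogeneousSubmodule (Fin N) ℝ k) :=
        Module.Finite.iff_fg.mpr (MvPolynomial.homogeneousSubmodule_fg (Fin N) ℝ k)
      -- `q ↦ Δ(|x|² q)` is an endomorphism of the finite-dimensional space of forms of degree `k`,
      -- so injectivity will give surjectivity.
      let T : MvPolynomial (Fin N) ℝ →ₗ[ℝ] MvPolynomial (Fin N) ℝ :=
        polyLaplacian N ∘ₗ LinearMap.mulLeft ℝ (normSqPoly N)
      have hmul {q : MvPolynomial (Fin N) ℝ} (hq : q.IsHomogeneous k) :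
          (normSqPoly N * q).IsHomogeneous (k + 2) := by
        have := (isHomogeneous_normSqPoly N).mul hq
        rwa [add_comm] at this
      have hT : ∀ q ∈ MvPolynomial.homogeneousSubmodule (Fin N) ℝ k,
          T q ∈ MvPolynomial.homogeneousSubmodule (Fin N) ℝ k := fun q hq =>
        isHomogeneous_polyLaplacian (hmul hq)
      -- If `|x|² q` is harmonic, it is orthogonal to all harmonics of degree at most `k`. On the
      -- sphere it equals `q`, a sum of such harmonics by induction; so `q` is orthogonal to itself.
      have hinj : Function.Injective (T.restrict hT) := by
        rw [← LinearMap.ker_eq_bot, LinearMap.ker_eq_bot']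
        rintro ⟨q, hq⟩ h0
        have hTq : polyLaplacian N (normSqPoly N * q) = 0 := congrArg Subtype.val h0
        have hh : normSqPoly N * q ∈ harmonicPoly N (k + 2) := ⟨hmul hq, hTq⟩
        have h1 := inner_eq_zero_of_mem_harmSpan (s := Iic k) (by simp)
          (ih k (by omega) q hq) hh
        rw [polyRestrict_normSqPoly_mul, inner_self_eq_zero] at h1
        have h2 : polyRestrict N q = 0 := toLtwo_injective (by rw [h1, map_zero])
        ext1
        exact eq_zero_of_polyRestrict_eq_zero hN.out hq h2
      have hsurj := LinearMap.injective_iff_surjective.mp hinj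
      obtain ⟨⟨q, hq⟩, hq'⟩ := hsurj ⟨polyLaplacian N p, isHomogeneous_polyLaplacian hp⟩
      have hq'' : polyLaplacian N (normSqPoly N * q) = polyLaplacian N p :=
        congrArg Subtype.val hq'
      -- `q` solves `Δ(|x|² q) = Δp`. Subtracting `|x|² q` makes `p` harmonic, and on the sphere the
      -- subtracted part is `q`, of lower degree.
      have hh : p - normSqPoly N * q ∈ harmonicPoly N (k + 2) := by
        refine ⟨hp.sub (hmul hq), ?_⟩
        change polyLaplacian N (p - normSqPoly N * q) = 0
        rw [map_sub, hq'', sub_self]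
      have e : polyRestrict N p =
          polyRestrict N (p - normSqPoly N * q) + polyRestrict N q := by
        rw [map_sub, polyRestrict_normSqPoly_mul]; abel
      rw [e]
      exact Submodule.add_mem _ (hharm hh) (hmono (by omega) (ih k (by omega) q hq))

theorem polyRestrict_mem_harmSpan_univ {N : ℕ} [Fact (2 ≤ N)] (p : MvPolynomial (Fin N) ℝ) :
    polyRestrict N p ∈ harmSpan N univ := by
  rw [← MvPolynomial.sum_homogeneousComponent p, map_sum]
  refine Submodule.sum_mem _ fun m _ => ?_
  have hmono : harmSpan N (Iic m) ≤ harmSpan N univ := biSup_mono fun l _ => mem_univ l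
  exact hmono (polyRestrict_mem_harmSpan m _ (MvPolynomial.homogeneousComponent_isHomogeneous m p))

theorem exists_of_mem_harmSpan {N : ℕ} {f : C(Sph N, ℝ)} (hf : f ∈ harmSpan N univ) :
    ∃ (s : Finset ℕ) (q : ℕ → MvPolynomial (Fin N) ℝ), (∀ l, q l ∈ harmonicPoly N l) ∧
      f = ∑ l ∈ s, polyRestrict N (q l) := by
  simp only [harmSpan, mem_univ, iSup_pos] at hf
  obtain ⟨g, hg, hsum⟩ := (Submodule.mem_iSup_iff_exists_finsupp _ _).mp hf
  choose q hq hq' using hg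
  exact ⟨g.support, q, hq, by rw [← hsum]; exact Finset.sum_congr rfl fun l _ => (hq' l).symm⟩

/-- Stone-Weierstrass for the algebra of restricted polynomials (the coordinates separate points),
followed by the decomposition of a polynomial into harmonics. -/
theorem exists_harmonic_approx {N : ℕ} [Fact (2 ≤ N)] (g : C(Sph N, ℝ)) {ε : ℝ} (hε : 0 < ε) :
    ∃ (s : Finset ℕ) (q : ℕ → MvPolynomial (Fin N) ℝ), (∀ l, q l ∈ harmonicPoly N l) ∧
      ∀ σ, |g σ - ∑ l ∈ s, polyRestrict N (q l) σ| < ε := by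
  let A : Subalgebra ℝ C(Sph N, ℝ) :=
    { carrier := range (polyRestrict N)
      mul_mem' := by
        rintro _ _ ⟨p, rfl⟩ ⟨q, rfl⟩
        exact ⟨p * q, by ext x; simp [polyRestrict]⟩
      add_mem' := by
        rintro _ _ ⟨p, rfl⟩ ⟨q, rfl⟩
        exact ⟨p + q, map_add _ _ _⟩
      algebraMap_mem' := fun r => ⟨MvPolynomial.C r, by ext x; simp [polyRestrict]⟩ }
  have hA : A.SeparatesPoints := by
    intro x y hxy
    have : ∃ i, (x : Euc N) i ≠ (y : Euc N) i := by
      by_contra! h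
      exact hxy (Subtype.ext (PiLp.ext h))
    obtain ⟨i, hi⟩ := this
    exact ⟨_, ⟨polyRestrict N (MvPolynomial.X i), ⟨_, rfl⟩, rfl⟩, by simpa [polyRestrict] using hi⟩
  have htop := ContinuousMap.subalgebra_topologicalClosure_eq_top_of_separatesPoints A hA
  have hg : g ∈ closure (A : Set C(Sph N, ℝ)) := by
    have : g ∈ A.topologicalClosure := by rw [htop]; trivial
    exact this
  obtain ⟨_, ⟨p, rfl⟩, hp⟩ := Metric.mem_closure_iff.mp hg ε hε
  obtain ⟨s, q, hq, hsum⟩ := exists_of_mem_harmSpan (polyRestrict_mem_harmSpan_univ p)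
  refine ⟨s, q, hq, fun σ => ?_⟩
  have h1 := (ContinuousMap.dist_apply_le_dist (f := g) (g := polyRestrict N p) σ).trans_lt hp
  rw [hsum, Real.dist_eq] at h1
  simpa using h1

/-- Uniform approximation implies `L²` approximation on a finite measure space, and continuous
functions are dense in `L²`. -/
theorem dense_iSup_sphHarm {N : ℕ} [Fact (2 ≤ N)] :
    ⊤ ≤ (⨆ l, sphHarm N l).topologicalClosure := by
  have hd : DenseRange (toLtwo : C(Sph N, ℝ) → L2 N) :=
    ContinuousMap.toLp_denseRange ℝ (sphMeasure N) ℝ ENNReal.ofNat_ne_top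
  have hsub : range (toLtwo : C(Sph N, ℝ) → L2 N) ⊆
      ((⨆ l, sphHarm N l).topologicalClosure : Set (L2 N)) := by
    rintro _ ⟨g, rfl⟩
    have hg : g ∈ closure (harmSpan N univ : Set C(Sph N, ℝ)) := by
      rw [Metric.mem_closure_iff]
      intro ε hε
      obtain ⟨s, q, hq, h⟩ := exists_harmonic_approx g (half_pos hε)
      refine ⟨∑ l ∈ s, polyRestrict N (q l), Submodule.sum_mem _ fun l _ =>
        polyRestrict_mem_harmSpan_univ _, ?_⟩
      refine lt_of_le_of_lt ((ContinuousMap.dist_le (by positivity)).mpr fun σ => ?_)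
        (half_lt_self hε)
      rw [Real.dist_eq]
      simpa using (h σ).le
    have h2 : MapsTo toLtwo (harmSpan N univ : Set C(Sph N, ℝ)) (⨆ l, sphHarm N l : Submodule ℝ (L2 N)) := by
      intro f hf
      obtain ⟨s, q, hq, rfl⟩ := exists_of_mem_harmSpan hf
      rw [map_sum]
      exact Submodule.sum_mem _ fun l _ =>
        Submodule.mem_iSup_of_mem l (mem_sphHarm.mpr ⟨q l, hq l, rfl⟩)
    exact map_mem_closure toLtwo.continuous hg h2
  intro v _
  have := (Submodule.isClosed_topologicalClosure (⨆ l, sphHarm N l)).closure_subset_iff.mpr hsub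
  exact this (hd v)

theorem isHilbertSum_sphHarm {N : ℕ} [Fact (2 ≤ N)] :
    IsHilbertSum ℝ (fun l => sphHarm N l) fun l => (sphHarm N l).subtypeₗᵢ :=
  IsHilbertSum.mkInternal _ orthogonalFamily_sphHarm dense_iSup_sphHarm

/-! ### Fourier expansion in spherical harmonics -/

theorem proj_mem {N : ℕ} (l : ℕ) (v : L2 N) : proj N l v ∈ sphHarm N l :=
  Submodule.starProjection_apply_mem _ v

theorem proj_of_mem {N : ℕ} [Fact (2 ≤ N)] {l m : ℕ} {v : L2 N} (hv : v ∈ sphHarm N m) :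
    proj N l v = if l = m then v else 0 := by
  split_ifs with h
  · subst h
    exact (Submodule.starProjection_eq_self_iff).mpr hv
  · refine (Submodule.starProjection_apply_eq_zero_iff _).mpr ?_
    rw [Submodule.mem_orthogonal]
    intro u hu
    exact orthogonalFamily_sphHarm h ⟨u, hu⟩ ⟨v, hv⟩

theorem proj_hasSum {N : ℕ} [Fact (2 ≤ N)] {c : ℕ → L2 N} (hc : ∀ l, c l ∈ sphHarm N l) {v : L2 N}
    (h : HasSum c v) (l : ℕ) : proj N l v = c l := by
  have h1 := h.mapL (proj N l)
  simp only [proj_of_mem (hc _)] at h1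
  have h2 := hasSum_single (f := fun m => if l = m then c m else 0) l fun m hm => if_neg (Ne.symm hm)
  rw [if_pos rfl] at h2
  exact h1.unique h2

theorem hasSum_proj {N : ℕ} [Fact (2 ≤ N)] (v : L2 N) : HasSum (fun l => proj N l v) v := by
  have h := isHilbertSum_sphHarm (N := N)
  have h1 := h.hasSum_linearIsometryEquiv_symm (h.linearIsometryEquiv v)
  rw [LinearIsometryEquiv.symm_apply_apply] at h1
  have h2 := proj_hasSum (fun l => (h.linearIsometryEquiv v l).2) h1
  rw [funext h2]
  exact h1

theorem summable_iff_of_mem {N : ℕ} [Fact (2 ≤ N)] {c : ℕ → L2 N} (hc : ∀ l, c l ∈ sphHarm N l) :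
    Summable c ↔ Summable fun l => ‖c l‖ ^ 2 :=
  orthogonalFamily_sphHarm.summable_iff_norm_sq_summable fun l => (⟨c l, hc l⟩ : sphHarm N l)

theorem summable_proj_norm_sq {N : ℕ} [Fact (2 ≤ N)] (v : L2 N) :
    Summable fun l => ‖proj N l v‖ ^ 2 :=
  (summable_iff_of_mem fun l => proj_mem l v).mp (hasSum_proj v).summable

theorem norm_proj_le {N : ℕ} (l : ℕ) (v : L2 N) : ‖proj N l v‖ ≤ ‖v‖ :=
  Submodule.norm_starProjection_apply_le _ v

theorem eq_of_proj_eq {N : ℕ} [Fact (2 ≤ N)] {u v : L2 N} (h : ∀ l, proj N l u = proj N l v) :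
    u = v := by
  have h1 := hasSum_proj u
  rw [funext h] at h1
  exact h1.unique (hasSum_proj v)

theorem proj_eq_of_inner {N l : ℕ} {u w : L2 N} (hw : w ∈ sphHarm N l)
    (h : ∀ p ∈ harmonicPoly N l, inner ℝ u (toLtwo (polyRestrict N p)) =
      inner ℝ w (toLtwo (polyRestrict N p))) : proj N l u = w := by
  refine (Submodule.eq_starProjection_of_mem_of_inner_eq_zero hw fun z hz => ?_)
  obtain ⟨p, hp, rfl⟩ := mem_sphHarm.mp hz
  rw [inner_sub_left, h p hp, sub_self]

/-- `P_l Δ ω = -γ_l P_l ω`. -/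
theorem proj_sphLaplacian {N : ℕ} [Fact (2 ≤ N)] {f : Sph N → ℝ} (hf : IsC2 f) (l : ℕ) :
    proj N l (toLtwo ⟨sphLaplacian f, hf.continuous_sphLaplacian⟩) =
      -gam N l • proj N l (toLtwo ⟨f, hf.continuous⟩) := by
  refine proj_eq_of_inner (Submodule.smul_mem _ _ (proj_mem l _)) fun p hp => ?_
  have h1 : inner ℝ (proj N l (toLtwo ⟨f, hf.continuous⟩)) (toLtwo (polyRestrict N p)) =
      inner ℝ (toLtwo ⟨f, hf.continuous⟩) (toLtwo (polyRestrict N p)) := by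
    have := Submodule.starProjection_inner_eq_zero (K := sphHarm N l)
      (toLtwo ⟨f, hf.continuous⟩) _ (mem_sphHarm.mpr ⟨p, hp, rfl⟩)
    rw [inner_sub_left] at this
    exact (sub_eq_zero.mp this).symm
  rw [real_inner_smul_left, h1, inner_toLtwo, inner_toLtwo]
  simp only [ContinuousMap.coe_mk]
  rw [integral_sphLaplacian_mul hf (isC2_harmonic hp), ← integral_const_mul]
  refine integral_congr_ae (Filter.Eventually.of_forall fun σ => ?_)
  simp only [sphLaplacian_harmonic_gam hp]
  ring

/-! ### Multipliers on the Sobolev spaces -/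

theorem norm_sq_sob {N k : ℕ} (u : Sob N k) :
    ‖u‖ ^ 2 = ∑' l : ℕ, (1 + (l : ℝ) ^ 2) ^ k * ‖proj N l u.toL2‖ ^ 2 := by
  rw [← real_inner_self_eq_norm_sq, inner_sob]
  simp only [real_inner_self_eq_norm_sq]

/-- An element of `H^k`, given as an element of `L²` with summable Fourier coefficients. -/
def Sob.mk {N k : ℕ} (v : L2 N)
    (h : Summable fun l : ℕ => (1 + (l : ℝ) ^ 2) ^ k * ‖proj N l v‖ ^ 2) : Sob N k :=
  (⟨v, by
    change Summable (sobTerm N k v v)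
    simpa only [funext_iff.mpr fun l => show sobTerm N k v v l = _ by
      rw [sobTerm, real_inner_self_eq_norm_sq]] using h⟩ : sobSubmodule N k)

@[simp] theorem Sob.toL2_mk {N k : ℕ} (v : L2 N)
    (h : Summable fun l : ℕ => (1 + (l : ℝ) ^ 2) ^ k * ‖proj N l v‖ ^ 2) :
    (Sob.mk v h).toL2 = v := rfl

theorem Sob.summable {N k : ℕ} (u : Sob N k) :
    Summable fun l : ℕ => (1 + (l : ℝ) ^ 2) ^ k * ‖proj N l u.toL2‖ ^ 2 := by
  have h : Summable (sobTerm N k u.toL2 u.toL2) := u.2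
  simpa only [funext_iff.mpr fun l => show sobTerm N k u.toL2 u.toL2 l = _ by
      rw [sobTerm, real_inner_self_eq_norm_sq]] using h

theorem Sob.toL2_injective {N k : ℕ} : Function.Injective (Sob.toL2 : Sob N k → L2 N) :=
  Subtype.val_injective

theorem Sob.ext_proj {N k : ℕ} [Fact (2 ≤ N)] {u v : Sob N k}
    (h : ∀ l, proj N l u.toL2 = proj N l v.toL2) : u = v :=
  Sob.toL2_injective (eq_of_proj_eq h)

/-- The hypothesis dominates the `H^b` coefficients of the image by the `H^a` coefficients of `v`.
The weights are at least `1`, so the orthogonal series converges in `L²` as well. -/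
theorem exists_multiplier {N : ℕ} [Fact (2 ≤ N)] {a b : ℕ} {m : ℕ → ℝ} {C : ℝ}
    (hm : ∀ l : ℕ, (1 + (l : ℝ) ^ 2) ^ b * m l ^ 2 ≤ C * (1 + (l : ℝ) ^ 2) ^ a) (v : Sob N a) :
    ∃ w : Sob N b, ∀ l, proj N l w.toL2 = m l • proj N l v.toL2 := by
  have hmem (l : ℕ) : m l • proj N l v.toL2 ∈ sphHarm N l := Submodule.smul_mem _ _ (proj_mem l _)
  have hbd (l : ℕ) : (1 + (l : ℝ) ^ 2) ^ b * ‖m l • proj N l v.toL2‖ ^ 2 ≤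
      C * ((1 + (l : ℝ) ^ 2) ^ a * ‖proj N l v.toL2‖ ^ 2) := by
    rw [norm_smul, mul_pow, Real.norm_eq_abs, sq_abs, ← mul_assoc, ← mul_assoc]
    exact mul_le_mul_of_nonneg_right (hm l) (by positivity)
  have hs1 : Summable fun l : ℕ => (1 + (l : ℝ) ^ 2) ^ b * ‖m l • proj N l v.toL2‖ ^ 2 :=
    Summable.of_nonneg_of_le (fun l => by positivity) hbd (v.summable.mul_left C)
  have hs2 : Summable fun l : ℕ => ‖m l • proj N l v.toL2‖ ^ 2 := by
    refine Summable.of_nonneg_of_le (fun l => by positivity) (fun l => ?_) hs1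
    exact le_mul_of_one_le_left (by positivity)
      (one_le_pow₀ (by nlinarith [sq_nonneg (l : ℝ)]))
  have hs3 := (summable_iff_of_mem hmem).mpr hs2
  have hp := proj_hasSum hmem hs3.hasSum
  exact ⟨Sob.mk (∑' l, m l • proj N l v.toL2) (by simpa only [hp] using hs1), hp⟩

/-- The operator `v ↦ ∑ m_l P_l v` as a bounded operator `H^a → H^b`. -/
def multiplier {N : ℕ} [Fact (2 ≤ N)] {a b : ℕ} {m : ℕ → ℝ} {C : ℝ}
    (hm : ∀ l : ℕ, (1 + (l : ℝ) ^ 2) ^ b * m l ^ 2 ≤ C * (1 + (l : ℝ) ^ 2) ^ a) :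
    Sob N a →L[ℝ] Sob N b :=
  LinearMap.mkContinuous
    { toFun := fun v => (exists_multiplier hm v).choose
      map_add' := fun u v => Sob.ext_proj fun l => by
        rw [(exists_multiplier hm _).choose_spec]
        simp only [map_add, (exists_multiplier hm _).choose_spec, smul_add]
      map_smul' := fun c v => Sob.ext_proj fun l => by
        rw [(exists_multiplier hm _).choose_spec]
        simp only [map_smul, (exists_multiplier hm _).choose_spec, RingHom.id_apply]
        rw [smul_comm] }
    (Real.sqrt C) fun v => by
      have hC : 0 ≤ C := by
        have := hm 0
        simp only [Nat.cast_zero] at this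
        norm_num at this
        exact (sq_nonneg _).trans this
      refine abs_le_of_sq_le_sq' ?_ (by positivity) |>.2
      rw [mul_pow, Real.sq_sqrt hC, norm_sq_sob, norm_sq_sob, ← tsum_mul_left]
      refine Summable.tsum_le_tsum (fun l => ?_) (Sob.summable _) (v.summable.mul_left C)
      simp only [LinearMap.coe_mk, AddHom.coe_mk]
      rw [(exists_multiplier hm v).choose_spec, norm_smul, mul_pow, Real.norm_eq_abs, sq_abs,
        ← mul_assoc, ← mul_assoc]
      exact mul_le_mul_of_nonneg_right (hm l) (by positivity)

theorem proj_multiplier {N : ℕ} [Fact (2 ≤ N)] {a b : ℕ} {m : ℕ → ℝ} {C : ℝ}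
    (hm : ∀ l : ℕ, (1 + (l : ℝ) ^ 2) ^ b * m l ^ 2 ≤ C * (1 + (l : ℝ) ^ 2) ^ a) (v : Sob N a)
    (l : ℕ) : proj N l (multiplier hm v).toL2 = m l • proj N l v.toL2 :=
  (exists_multiplier hm v).choose_spec l

/-- The squared `H^k` distance from `w` to a partial sum is the tail of the convergent series for
`‖w‖²`. -/
theorem hasSum_sob {N k : ℕ} [Fact (2 ≤ N)] {w : Sob N k} {p : ℕ → Sob N k}
    (hp : ∀ l, (p l).toL2 = proj N l w.toL2) : HasSum p w := by
  rw [HasSum, SummationFilter.unconditional_filter]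
  rw [tendsto_iff_norm_sub_tendsto_zero]
  set f : ℕ → ℝ := fun l => (1 + (l : ℝ) ^ 2) ^ k * ‖proj N l w.toL2‖ ^ 2 with hf
  have hsum : Summable f := w.summable
  have key (s : Finset ℕ) : ‖∑ l ∈ s, p l - w‖ ^ 2 = ∑' l, f l - ∑ l ∈ s, f l := by
    have h1 (l : ℕ) : proj N l (∑ j ∈ s, p j - w).toL2 =
        if l ∈ s then 0 else -proj N l w.toL2 := by
      rw [map_sub, map_sum, map_sub, map_sum]
      simp only [hp, proj_of_mem (proj_mem _ _)]
      rw [Finset.sum_ite_eq]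
      split_ifs <;> simp
    rw [norm_sq_sob]
    have h2 (l : ℕ) : (1 + (l : ℝ) ^ 2) ^ k * ‖proj N l (∑ j ∈ s, p j - w).toL2‖ ^ 2 =
        f l - if l ∈ s then f l else 0 := by
      rw [h1]
      split_ifs <;> simp [hf]
    have h3 : HasSum (fun l => if l ∈ s then f l else 0) (∑ l ∈ s, f l) := by
      have : HasSum (fun l => if l ∈ s then f l else 0) (∑ l ∈ s, if l ∈ s then f l else 0) := hasSum_sum_of_ne_finset_zero (f := fun l => if l ∈ s then f l else 0) (s := s)
        (fun l hl => if_neg hl)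
      rwa [Finset.sum_congr rfl fun l hl => if_pos hl] at this
    rw [tsum_congr h2, (hsum.tsum_sub h3.summable), h3.tsum_eq]
  have hlim : Filter.Tendsto (fun s : Finset ℕ => ‖∑ l ∈ s, p l - w‖ ^ 2) Filter.atTop (𝓝 0) := by
    simp only [key]
    have : Filter.Tendsto (fun s : Finset ℕ => ∑ l ∈ s, f l) Filter.atTop (𝓝 (∑' l, f l)) :=
      hsum.hasSum
    simpa using this.const_sub (∑' l, f l)
  have := hlim.sqrt
  simpa using this

theorem exists_sob_proj {N k : ℕ} [Fact (2 ≤ N)] (v : L2 N) (l : ℕ) :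
    ∃ p : Sob N k, p.toL2 = proj N l v := by
  refine ⟨Sob.mk (proj N l v) ?_, rfl⟩
  refine summable_of_ne_finset_zero (s := {l}) fun j hj => ?_
  rw [proj_of_mem (proj_mem l v), if_neg (by simpa using hj)]
  simp

theorem mem_sobOrth {N k l : ℕ} {v : Sob N k} : v ∈ sobOrth N k l ↔ proj N l v.toL2 = 0 :=
  Iff.rfl

/-- A multiplier comparable to `l` is an isomorphism `W^2_l → W^1_l`, whatever its `l`-th value. -/
theorem exists_equiv_of_multiplier {N : ℕ} [Fact (2 ≤ N)] {m : ℕ → ℝ} {C : ℝ} {l : ℕ}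
    (hm : ∀ j : ℕ, m j ^ 2 ≤ C * (1 + (j : ℝ) ^ 2))
    (hm' : ∀ j : ℕ, j ≠ l → 1 + (j : ℝ) ^ 2 ≤ C * m j ^ 2) :
    ∃ A : sobOrth N 2 l ≃L[ℝ] sobOrth N 1 l, ∀ (v : sobOrth N 2 l) (j : ℕ),
      proj N j (A v : Sob N 1).toL2 = m j • proj N j (v : Sob N 2).toL2 := by
  have h1 (j : ℕ) : (1 + (j : ℝ) ^ 2) ^ 1 * m j ^ 2 ≤ C * (1 + (j : ℝ) ^ 2) ^ 2 := by
    have := mul_le_mul_of_nonneg_left (hm j) (show 0 ≤ 1 + (j : ℝ) ^ 2 by positivity)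
    nlinarith
  have hC : 0 ≤ C := by
    have := (sq_nonneg _).trans (hm 0)
    simpa using this
  -- The inverse multiplier. Its value at `l`, where `m` may vanish, is immaterial, because `P_l`
  -- vanishes on both spaces.
  set m' : ℕ → ℝ := fun j => if j = l then 0 else (m j)⁻¹ with hmdef
  have hne (j : ℕ) (hj : j ≠ l) : m j ≠ 0 := by
    intro h0
    have := hm' j hj
    rw [h0] at this
    nlinarith [sq_nonneg (j : ℝ)]
  have h2 (j : ℕ) : (1 + (j : ℝ) ^ 2) ^ 2 * m' j ^ 2 ≤ C * (1 + (j : ℝ) ^ 2) ^ 1 := by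
    by_cases hj : j = l
    · simp only [hmdef, if_pos hj]
      have : 0 ≤ C * (1 + (j : ℝ) ^ 2) ^ 1 := by positivity
      simpa using this
    · simp only [hmdef, if_neg hj]
      have h3 : 0 < m j ^ 2 := by have := hne j hj; positivity
      rw [inv_pow, ← div_eq_mul_inv, div_le_iff₀ h3, pow_one]
      have := mul_le_mul_of_nonneg_left (hm' j hj) (show 0 ≤ 1 + (j : ℝ) ^ 2 by positivity)
      nlinarith
  let F : sobOrth N 2 l →L[ℝ] sobOrth N 1 l :=
    ((multiplier (N := N) h1).comp (sobOrth N 2 l).subtypeL).codRestrict _ fun v => by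
      have hv : proj N l (v : Sob N 2).toL2 = 0 := v.2
      rw [mem_sobOrth]
      change proj N l (multiplier (N := N) h1 v).toL2 = 0
      rw [proj_multiplier, hv, smul_zero]
  let G : sobOrth N 1 l →L[ℝ] sobOrth N 2 l :=
    ((multiplier (N := N) h2).comp (sobOrth N 1 l).subtypeL).codRestrict _ fun v => by
      have hv : proj N l (v : Sob N 1).toL2 = 0 := v.2
      rw [mem_sobOrth]
      change proj N l (multiplier (N := N) h2 v).toL2 = 0
      rw [proj_multiplier, hv, smul_zero]
  have hF (v : sobOrth N 2 l) (j : ℕ) :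
      proj N j (F v : Sob N 1).toL2 = m j • proj N j (v : Sob N 2).toL2 :=
    proj_multiplier h1 _ j
  have hG (v : sobOrth N 1 l) (j : ℕ) :
      proj N j (G v : Sob N 2).toL2 = m' j • proj N j (v : Sob N 1).toL2 :=
    proj_multiplier h2 _ j
  refine ⟨ContinuousLinearEquiv.equivOfInverse F G (fun v => ?_) (fun v => ?_), hF⟩
  · refine Subtype.ext (Sob.ext_proj fun j => ?_)
    rw [hG, hF]
    by_cases hj : j = l
    · have hv : proj N l (v : Sob N 2).toL2 = 0 := v.2
      rw [hj, hv, smul_zero, smul_zero]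
    · simp only [hmdef, if_neg hj]
      rw [smul_smul, inv_mul_cancel₀ (hne j hj), one_smul]
  · refine Subtype.ext (Sob.ext_proj fun j => ?_)
    rw [hF, hG]
    by_cases hj : j = l
    · have hv : proj N l (v : Sob N 1).toL2 = 0 := v.2
      rw [hj, hv, smul_zero, smul_zero]
    · simp only [hmdef, if_neg hj]
      rw [smul_smul, mul_inv_cancel₀ (hne j hj), one_smul]

/-- A `C²` function on the sphere belongs to `H²`. -/
theorem IsC2.summable_sob {N : ℕ} [hN : Fact (2 ≤ N)] {f : Sph N → ℝ} (hf : IsC2 f) :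
    Summable fun l : ℕ =>
      (1 + (l : ℝ) ^ 2) ^ 2 * ‖proj N l (toLtwo ⟨f, hf.continuous⟩)‖ ^ 2 := by
  have h1 := summable_proj_norm_sq (toLtwo ⟨sphLaplacian f, hf.continuous_sphLaplacian⟩)
  have h2 := summable_proj_norm_sq (toLtwo ⟨f, hf.continuous⟩)
  refine Summable.of_nonneg_of_le (fun l => by positivity) (fun l => ?_)
    ((h1.mul_left 2).add (h2.mul_left 2))
  rw [proj_sphLaplacian hf, norm_smul, mul_pow, Real.norm_eq_abs, sq_abs, ← mul_assoc, ← add_mul]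
  -- What remains is `(1 + l²)² ≤ 2 γ_l² + 2`, a consequence of `l² ≤ γ_l`.
  refine mul_le_mul_of_nonneg_right ?_ (by positivity)
  have h3 := sq_le_gam hN.out l
  have h4 : 0 ≤ (l : ℝ) ^ 2 := by positivity
  nlinarith [sq_nonneg ((l : ℝ) ^ 2 - 1)]

/-! ### A linear second order equation, solved by a Volterra series -/

theorem hasDerivAt_primitive {R : ℝ} (hR : 0 < R) {g : ℝ → ℝ} (hg : ContinuousOn g (Ioo (-R) R))
    {x : ℝ} (hx : x ∈ Ioo (-R) R) : HasDerivAt (fun x => ∫ s in (0 : ℝ)..x, g s) (g x) x := by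
  have h0 : (0 : ℝ) ∈ Ioo (-R) R := ⟨by linarith, hR⟩
  have hsub : uIcc 0 x ⊆ Ioo (-R) R := ordConnected_Ioo.uIcc_subset h0 hx
  exact intervalIntegral.integral_hasDerivAt_right (hg.mono hsub).intervalIntegrable
    (hg.stronglyMeasurableAtFilter isOpen_Ioo _ hx) (hg.continuousAt (isOpen_Ioo.mem_nhds hx))

theorem integral_neg_of_even {g : ℝ → ℝ} (hg : ∀ x, g (-x) = g x) (x : ℝ) :
    (∫ s in (0 : ℝ)..(-x), g s) = -∫ s in (0 : ℝ)..x, g s := by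
  have := intervalIntegral.integral_comp_neg (a := 0) (b := x) g
  simp only [hg, neg_zero] at this
  rw [this, intervalIntegral.integral_symm]

theorem integral_neg_of_odd {g : ℝ → ℝ} (hg : ∀ x, g (-x) = -g x) (x : ℝ) :
    (∫ s in (0 : ℝ)..(-x), g s) = ∫ s in (0 : ℝ)..x, g s := by
  have := intervalIntegral.integral_comp_neg (a := 0) (b := x) g
  simp only [hg, neg_zero, intervalIntegral.integral_neg] at this
  rw [intervalIntegral.integral_symm, ← this, neg_neg]

/-- The iterates of `g ↦ ∫ (∫ q g) / p`, starting with `1`. -/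
def volterraTerm (p q : ℝ → ℝ) : ℕ → ℝ → ℝ
  | 0 => fun _ => 1
  | n + 1 => fun x => ∫ s in (0 : ℝ)..x, (∫ r in (0 : ℝ)..s, q r * volterraTerm p q n r) / p s

/-- The flux `∫ q Yₙ` of the `n`-th Volterra iterate. -/
def volterraFlux (p q : ℝ → ℝ) (n : ℕ) (s : ℝ) : ℝ :=
  ∫ r in (0 : ℝ)..s, q r * volterraTerm p q n r

theorem volterraTerm_succ (p q : ℝ → ℝ) (n : ℕ) (x : ℝ) :
    volterraTerm p q (n + 1) x = ∫ s in (0 : ℝ)..x, volterraFlux p q n s / p s := rfl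

theorem volterraTerm_neg {p q : ℝ → ℝ} (hp : ∀ x, p (-x) = p x) (hq : ∀ x, q (-x) = q x) (n : ℕ)
    (x : ℝ) : volterraTerm p q n (-x) = volterraTerm p q n x := by
  induction n generalizing x with
  | zero => rfl
  | succ n ih =>
    rw [volterraTerm_succ, volterraTerm_succ]
    refine integral_neg_of_odd (fun s => ?_) x
    have : volterraFlux p q n (-s) = -volterraFlux p q n s :=
      integral_neg_of_even (fun r => by rw [hq, ih]) s
    rw [this, hp, neg_div]

theorem volterraFlux_neg {p q : ℝ → ℝ} (hp : ∀ x, p (-x) = p x) (hq : ∀ x, q (-x) = q x) (n : ℕ)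
    (x : ℝ) : volterraFlux p q n (-x) = -volterraFlux p q n x :=
  integral_neg_of_even (fun r => by rw [hq, volterraTerm_neg hp hq]) x

section

variable {R : ℝ} {p q : ℝ → ℝ}

theorem continuousOn_volterraTerm (hR : 0 < R) (hp : ContinuousOn p (Ioo (-R) R))
    (hq : ContinuousOn q (Ioo (-R) R)) (hpos : ∀ x ∈ Ioo (-R) R, 0 < p x) (n : ℕ) :
    ContinuousOn (volterraTerm p q n) (Ioo (-R) R) := by
  induction n with
  | zero => exact continuousOn_const
  | succ n ih =>
    have h1 : ContinuousOn (volterraFlux p q n) (Ioo (-R) R) := fun x hx =>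
      (hasDerivAt_primitive hR (hq.mul ih) hx).continuousAt.continuousWithinAt
    have h2 : ContinuousOn (fun s => volterraFlux p q n s / p s) (Ioo (-R) R) :=
      h1.div hp fun x hx => (hpos x hx).ne'
    exact fun x hx => (hasDerivAt_primitive hR h2 hx).continuousAt.continuousWithinAt

theorem hasDerivAt_volterraFlux (hR : 0 < R) (hp : ContinuousOn p (Ioo (-R) R))
    (hq : ContinuousOn q (Ioo (-R) R)) (hpos : ∀ x ∈ Ioo (-R) R, 0 < p x) (n : ℕ) {x : ℝ}
    (hx : x ∈ Ioo (-R) R) :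
    HasDerivAt (volterraFlux p q n) (q x * volterraTerm p q n x) x :=
  hasDerivAt_primitive hR (hq.mul (continuousOn_volterraTerm hR hp hq hpos n)) hx

theorem continuousOn_volterraFlux (hR : 0 < R) (hp : ContinuousOn p (Ioo (-R) R))
    (hq : ContinuousOn q (Ioo (-R) R)) (hpos : ∀ x ∈ Ioo (-R) R, 0 < p x) (n : ℕ) :
    ContinuousOn (volterraFlux p q n) (Ioo (-R) R) := fun _ hx =>
  (hasDerivAt_volterraFlux hR hp hq hpos n hx).continuousAt.continuousWithinAt

theorem hasDerivAt_volterraTerm (hR : 0 < R) (hp : ContinuousOn p (Ioo (-R) R))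
    (hq : ContinuousOn q (Ioo (-R) R)) (hpos : ∀ x ∈ Ioo (-R) R, 0 < p x) (n : ℕ) {x : ℝ}
    (hx : x ∈ Ioo (-R) R) :
    HasDerivAt (volterraTerm p q (n + 1)) (volterraFlux p q n x / p x) x :=
  hasDerivAt_primitive hR ((continuousOn_volterraFlux hR hp hq hpos n).div hp
    fun x hx => (hpos x hx).ne') hx

/-- With `K = P Q b`, each step of the iteration gains a factor `Kx/(n+1)`, hence the exponential
series. The flux estimate spends one factor `x ≤ b`, so that the second integration alone produces
`x/(n+1)`. Positivity of `p` and `q` is what keeps all iterates nonnegative. -/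
theorem volterra_bounds (hR : 0 < R) (hp : ContinuousOn p (Ioo (-R) R))
    (hq : ContinuousOn q (Ioo (-R) R)) (hpos : ∀ x ∈ Ioo (-R) R, 0 < p x)
    (hqpos : ∀ x ∈ Ioo (-R) R, 0 ≤ q x) {b P Q : ℝ} (hb : b < R)
    (hP : ∀ x ∈ Icc 0 b, (p x)⁻¹ ≤ P) (hQ : ∀ x ∈ Icc 0 b, q x ≤ Q) (n : ℕ) :
    ∀ x ∈ Icc 0 b, (0 ≤ volterraTerm p q n x ∧
        volterraTerm p q n x ≤ (P * (Q * b) * x) ^ n / n.factorial) ∧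
      0 ≤ volterraFlux p q n x ∧
        volterraFlux p q n x ≤ Q * b * ((P * (Q * b) * x) ^ n / n.factorial) := by
  have hsub {x : ℝ} (hx : x ∈ Icc 0 b) : x ∈ Ioo (-R) R := ⟨by linarith [hx.1], by linarith [hx.2]⟩
  have hsubI {x : ℝ} (hx : x ∈ Icc 0 b) : uIcc 0 x ⊆ Ioo (-R) R := by
    rw [uIcc_of_le hx.1]
    exact fun y hy => hsub ⟨hy.1, hy.2.trans hx.2⟩
  set K := P * (Q * b) with hK
  have hflux (n : ℕ) (h : ∀ x ∈ Icc 0 b, 0 ≤ volterraTerm p q n x ∧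
      volterraTerm p q n x ≤ (K * x) ^ n / n.factorial) (x : ℝ) (hx : x ∈ Icc 0 b) :
      0 ≤ volterraFlux p q n x ∧ volterraFlux p q n x ≤ Q * b * ((K * x) ^ n / n.factorial) := by
    have hb0 : 0 ≤ b := hx.1.trans hx.2
    have h0 : (0 : ℝ) ∈ Icc 0 b := ⟨le_rfl, hb0⟩
    have hQ0 : 0 ≤ Q := (hqpos 0 (hsub h0)).trans (hQ 0 h0)
    have hP0 : 0 ≤ P := (inv_nonneg.mpr (hpos 0 (hsub h0)).le).trans (hP 0 h0)
    have hK0 : 0 ≤ K := by positivity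
    have hx0 := hx.1
    constructor
    · refine intervalIntegral.integral_nonneg hx.1 fun r hr => ?_
      have hr' : r ∈ Icc 0 b := ⟨hr.1, hr.2.trans hx.2⟩
      exact mul_nonneg (hqpos r (hsub hr')) (h r hr').1
    · have hle : volterraFlux p q n x ≤ ∫ r in (0 : ℝ)..x, Q * ((K * x) ^ n / n.factorial) := by
        refine intervalIntegral.integral_mono_on hx.1 ?_ (by simp) fun r hr => ?_
        · exact ((hq.mul (continuousOn_volterraTerm hR hp hq hpos n)).mono
            (hsubI hx)).intervalIntegrable
        · have hr' : r ∈ Icc 0 b := ⟨hr.1, hr.2.trans hx.2⟩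
          have hr0 := hr.1
          refine mul_le_mul (hQ r hr') ((h r hr').2.trans ?_) (h r hr').1 hQ0
          have := mul_le_mul_of_nonneg_left hr.2 hK0
          gcongr
      refine hle.trans ?_
      rw [intervalIntegral.integral_const, sub_zero, smul_eq_mul, ← mul_assoc, mul_comm x]
      have := hx.2
      gcongr
  induction n with
  | zero =>
    have h : ∀ x ∈ Icc 0 b, 0 ≤ volterraTerm p q 0 x ∧
        volterraTerm p q 0 x ≤ (K * x) ^ 0 / (Nat.factorial 0) := fun x _ => by
      simp [volterraTerm]
    exact fun x hx => ⟨h x hx, hflux 0 h x hx⟩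
  | succ n ih =>
    have h : ∀ x ∈ Icc 0 b, 0 ≤ volterraTerm p q (n + 1) x ∧
        volterraTerm p q (n + 1) x ≤ (K * x) ^ (n + 1) / (Nat.factorial (n + 1)) := by
      intro x hx
      have hb0 : 0 ≤ b := hx.1.trans hx.2
      have h0 : (0 : ℝ) ∈ Icc 0 b := ⟨le_rfl, hb0⟩
      have hQ0 : 0 ≤ Q := (hqpos 0 (hsub h0)).trans (hQ 0 h0)
      have hP0 : 0 ≤ P := (inv_nonneg.mpr (hpos 0 (hsub h0)).le).trans (hP 0 h0)
      have hK0 : 0 ≤ K := by positivity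
      constructor
      · refine intervalIntegral.integral_nonneg hx.1 fun s hs => ?_
        have hs' : s ∈ Icc 0 b := ⟨hs.1, hs.2.trans hx.2⟩
        exact div_nonneg (ih s hs').2.1 (hpos s (hsub hs')).le
      · have hle : volterraTerm p q (n + 1) x ≤
            ∫ s in (0 : ℝ)..x, (K ^ (n + 1) / n.factorial) * s ^ n := by
          refine intervalIntegral.integral_mono_on hx.1 ?_
            (Continuous.intervalIntegrable (by fun_prop) _ _) fun s hs => ?_
          · exact (((continuousOn_volterraFlux hR hp hq hpos n).div hp
              fun x hx => (hpos x hx).ne').mono (hsubI hx)).intervalIntegrable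
          · have hs' : s ∈ Icc 0 b := ⟨hs.1, hs.2.trans hx.2⟩
            have hs0 := hs.1
            have h1 := (ih s hs').2.2
            have h2 : volterraFlux p q n s * (p s)⁻¹ ≤
                Q * b * ((K * s) ^ n / n.factorial) * P :=
              mul_le_mul h1 (hP s hs') (inv_nonneg.mpr (hpos s (hsub hs')).le) (by positivity)
            refine h2.trans (le_of_eq ?_)
            rw [mul_pow, pow_succ, hK]
            ring
        refine hle.trans (le_of_eq ?_)
        rw [intervalIntegral.integral_const_mul, integral_pow, Nat.factorial_succ, mul_pow]
        push_cast
        have : (n.factorial : ℝ) ≠ 0 := by positivity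
        have : (n : ℝ) + 1 ≠ 0 := by positivity
        field_simp
        ring
    exact fun x hx => ⟨h x hx, hflux (n + 1) h x hx⟩

/-- Global solvability of `(p y')' = q y`, `y(0) = 1`, `y'(0) = 0` for even `p > 0` and `q ≥ 0`. -/
theorem exists_even_solution (hR : 0 < R) (hp : ContinuousOn p (Ioo (-R) R))
    (hq : ContinuousOn q (Ioo (-R) R)) (hpos : ∀ x ∈ Ioo (-R) R, 0 < p x)
    (hqpos : ∀ x ∈ Ioo (-R) R, 0 ≤ q x) (hpe : ∀ x, p (-x) = p x) (hqe : ∀ x, q (-x) = q x) :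
    ∃ y w : ℝ → ℝ, (∀ x ∈ Ioo (-R) R, HasDerivAt y (w x / p x) x) ∧
      (∀ x ∈ Ioo (-R) R, HasDerivAt w (q x * y x) x) ∧ (∀ x, y (-x) = y x) ∧ w 0 = 0 ∧ y 0 = 1 ∧
      (∀ x ∈ Ico 0 R, 1 ≤ y x) ∧ ∀ x ∈ Ico 0 R, 0 ≤ w x := by
  have hbdd (b : ℝ) (hb0 : 0 ≤ b) (hb : b < R) : ∃ P Q : ℝ, 0 ≤ P ∧ 0 ≤ Q ∧
      (∀ x ∈ Icc (-b) b, (p x)⁻¹ ≤ P) ∧ ∀ x ∈ Icc (-b) b, q x ≤ Q := by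
    have hsub : Icc (-b) b ⊆ Ioo (-R) R := fun x hx => ⟨by linarith [hx.1], by linarith [hx.2]⟩
    obtain ⟨P, hP⟩ := isCompact_Icc.bddAbove_image
      ((hp.inv₀ fun x hx => (hpos x hx).ne').mono hsub)
    obtain ⟨Q, hQ⟩ := isCompact_Icc.bddAbove_image (hq.mono hsub)
    have hP' : ∀ x ∈ Icc (-b) b, (p x)⁻¹ ≤ P := fun x hx => hP (mem_image_of_mem _ hx)
    have hQ' : ∀ x ∈ Icc (-b) b, q x ≤ Q := fun x hx => hQ (mem_image_of_mem _ hx)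
    have h0 : (0 : ℝ) ∈ Icc (-b) b := ⟨by linarith, hb0⟩
    exact ⟨P, Q, (inv_nonneg.mpr (hpos 0 (hsub h0)).le).trans (hP' 0 h0),
      (hqpos 0 (hsub h0)).trans (hQ' 0 h0), hP', hQ'⟩
  -- The iterates are even and their fluxes odd, so the bounds on `[0, b]` carry over to `[-b, b]`.
  have habs (b : ℝ) (hb0 : 0 ≤ b) (hb : b < R) : ∃ P Q : ℝ, 0 ≤ P ∧ 0 ≤ Q ∧
      (∀ x ∈ Icc (-b) b, (p x)⁻¹ ≤ P) ∧ (∀ x ∈ Icc (-b) b, q x ≤ Q) ∧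
      ∀ n, ∀ x ∈ Icc (-b) b, |volterraTerm p q n x| ≤ (P * (Q * b) * b) ^ n / n.factorial ∧
        |volterraFlux p q n x| ≤ Q * b * ((P * (Q * b) * b) ^ n / n.factorial) := by
    obtain ⟨P, Q, hP0, hQ0, hP, hQ⟩ := hbdd b hb0 hb
    refine ⟨P, Q, hP0, hQ0, hP, hQ, fun n x hx => ?_⟩
    have hx' : |x| ∈ Icc 0 b := ⟨abs_nonneg x, abs_le.mpr hx⟩
    have hsub : Icc 0 b ⊆ Icc (-b) b := Icc_subset_Icc_left (by linarith)
    have h := volterra_bounds hR hp hq hpos hqpos hb (fun x hx => hP x (hsub hx))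
      (fun x hx => hQ x (hsub hx)) n |x| hx'
    have e1 : |volterraTerm p q n x| = volterraTerm p q n |x| := by
      rcases abs_cases x with ⟨hc, _⟩ | ⟨hc, _⟩
      · rw [hc] at h ⊢; exact abs_of_nonneg h.1.1
      · rw [hc] at h ⊢
        rw [volterraTerm_neg hpe hqe] at h ⊢; exact abs_of_nonneg h.1.1
    have e2 : |volterraFlux p q n x| = volterraFlux p q n |x| := by
      rcases abs_cases x with ⟨hc, _⟩ | ⟨hc, _⟩
      · rw [hc] at h ⊢; exact abs_of_nonneg h.2.1
      · rw [hc] at h ⊢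
        rw [volterraFlux_neg hpe hqe] at h ⊢
        rw [abs_of_nonpos (by linarith [h.2.1])]
    have hle : (P * (Q * b) * |x|) ^ n / n.factorial ≤ (P * (Q * b) * b) ^ n / n.factorial := by
      have := hx'.2
      gcongr
    rw [e1, e2]
    exact ⟨h.1.2.trans hle, h.2.2.trans (mul_le_mul_of_nonneg_left hle (by positivity))⟩
  set y : ℝ → ℝ := fun x => ∑' n, volterraTerm p q n x with hy
  set w : ℝ → ℝ := fun x => ∑' n, volterraFlux p q n x with hw
  have hsumm (b : ℝ) (hb0 : 0 ≤ b) (hb : b < R) (x : ℝ) (hx : x ∈ Icc (-b) b) :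
      Summable fun n => volterraTerm p q n x := by
    obtain ⟨P, Q, hP0, hQ0, hP, hQ, h⟩ := habs b hb0 hb
    exact Summable.of_norm_bounded (Real.summable_pow_div_factorial _) fun n => (h n x hx).1
  have hsumm' (x : ℝ) (hx : x ∈ Ioo (-R) R) : Summable fun n => volterraTerm p q n x :=
    hsumm |x| (abs_nonneg x) (abs_lt.mpr hx) x ⟨neg_abs_le x, le_abs_self x⟩
  refine ⟨y, w, fun x hx => ?_, fun x hx => ?_, fun x => ?_, ?_, ?_, fun x hx => ?_, fun x hx => ?_⟩
  · obtain ⟨b, hb1, hb2⟩ := exists_between (abs_lt.mpr hx)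
    have hb0 : 0 ≤ b := (abs_nonneg x).trans hb1.le
    obtain ⟨P, Q, hP0, hQ0, hP, hQ, h⟩ := habs b hb0 hb2
    have hsub : Ioo (-b) b ⊆ Ioo (-R) R := Ioo_subset_Ioo (by linarith) hb2.le
    -- The series is differentiated term by term without its constant zeroth term, which is added
    -- back afterwards; the index shift turns derivatives of terms into fluxes.
    have h1 := hasDerivAt_tsum_of_isPreconnected (t := Ioo (-b) b) (y₀ := 0) (y := x)
      (g := fun n => volterraTerm p q (n + 1)) (g' := fun n s => volterraFlux p q n s / p s)
      (u := fun n => Q * b * ((P * (Q * b) * b) ^ n / n.factorial) * P)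
      (((Real.summable_pow_div_factorial _).mul_left _).mul_right _) isOpen_Ioo
      (convex_Ioo _ _).isPreconnected
      (fun n s hs => hasDerivAt_volterraTerm hR hp hq hpos n (hsub hs))
      (fun n s hs => by
        have hs' := Ioo_subset_Icc_self hs
        rw [Real.norm_eq_abs, div_eq_mul_inv, abs_mul,
          abs_of_pos (inv_pos.mpr (hpos s (hsub hs)))]
        exact mul_le_mul (h n s hs').2 (hP s hs') (inv_nonneg.mpr (hpos s (hsub hs)).le)
          (by positivity))
      ⟨by linarith [abs_nonneg x], by linarith [abs_nonneg x]⟩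
      ((summable_nat_add_iff 1).mpr
        (hsumm b hb0 hb2 0 ⟨by linarith [abs_nonneg x], by linarith [abs_nonneg x]⟩))
      (abs_lt.mp hb1)
    have h2 : HasDerivAt (fun z => 1 + ∑' n, volterraTerm p q (n + 1) z)
        (∑' n, volterraFlux p q n x / p x) x := h1.const_add 1
    rw [tsum_div_const] at h2
    refine h2.congr_of_eventuallyEq ?_
    filter_upwards [isOpen_Ioo.mem_nhds hx] with z hz
    rw [hy]
    exact (hsumm' z hz).tsum_eq_zero_add
  · obtain ⟨b, hb1, hb2⟩ := exists_between (abs_lt.mpr hx)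
    have hb0 : 0 ≤ b := (abs_nonneg x).trans hb1.le
    obtain ⟨P, Q, hP0, hQ0, hP, hQ, h⟩ := habs b hb0 hb2
    have hsub : Ioo (-b) b ⊆ Ioo (-R) R := Ioo_subset_Ioo (by linarith) hb2.le
    have h1 := hasDerivAt_tsum_of_isPreconnected (t := Ioo (-b) b) (y₀ := 0) (y := x)
      (g := fun n => volterraFlux p q n) (g' := fun n s => q s * volterraTerm p q n s)
      (u := fun n => Q * ((P * (Q * b) * b) ^ n / n.factorial))
      ((Real.summable_pow_div_factorial _).mul_left _) isOpen_Ioo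
      (convex_Ioo _ _).isPreconnected
      (fun n s hs => hasDerivAt_volterraFlux hR hp hq hpos n (hsub hs))
      (fun n s hs => by
        have hs' := Ioo_subset_Icc_self hs
        rw [Real.norm_eq_abs, abs_mul, abs_of_nonneg (hqpos s (hsub hs))]
        exact mul_le_mul (hQ s hs') (h n s hs').1 (abs_nonneg _) hQ0)
      ⟨by linarith [abs_nonneg x], by linarith [abs_nonneg x]⟩
      (by simp [volterraFlux])
      (abs_lt.mp hb1)
    rwa [tsum_mul_left] at h1
  · simp only [hy, volterraTerm_neg hpe hqe]
  · simp [hw, volterraFlux]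
  · have : (fun n => volterraTerm p q n 0) = fun n => if n = 0 then 1 else 0 := by
      ext n
      cases n with
      | zero => simp [volterraTerm]
      | succ n => simp [volterraTerm_succ]
    simp only [hy, this, tsum_ite_eq]
  · have hx' : x ∈ Ioo (-R) R := ⟨by linarith [hx.1], hx.2⟩
    obtain ⟨P, Q, hP0, hQ0, hP, hQ⟩ := hbdd x hx.1 hx.2
    have hsub : Icc 0 x ⊆ Icc (-x) x := Icc_subset_Icc_left (by linarith [hx.1])
    have h0 (n : ℕ) : 0 ≤ volterraTerm p q n x :=
      (volterra_bounds hR hp hq hpos hqpos hx.2 (fun x hx => hP x (hsub hx))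
        (fun x hx => hQ x (hsub hx)) n x ⟨hx.1, le_rfl⟩).1.1
    exact (hsumm' x hx').le_tsum 0 fun n _ => h0 n
  · obtain ⟨P, Q, hP0, hQ0, hP, hQ⟩ := hbdd x hx.1 hx.2
    have hsub : Icc 0 x ⊆ Icc (-x) x := Icc_subset_Icc_left (by linarith [hx.1])
    exact tsum_nonneg fun n =>
      (volterra_bounds hR hp hq hpos hqpos hx.2 (fun x hx => hP x (hsub hx))
        (fun x hx => hQ x (hsub hx)) n x ⟨hx.1, le_rfl⟩).2.1

end

/-! ### The radial factors and the Riccati equation -/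

theorem cos_pos_of_lt {x : ℝ} (hx : x ∈ Ioo (-(Real.pi / 2)) (Real.pi / 2)) : 0 < Real.cos x :=
  Real.cos_pos_of_mem_Ioo hx

theorem gam_nonneg {N : ℕ} (hN : 2 ≤ N) (l : ℕ) : 0 ≤ gam N l :=
  (sq_nonneg _).trans (sq_le_gam hN l)

/-- The even solution of `(cos^{N-1} y')' = γ_l cos^{N-3} y` and its derivative. -/
structure IsRadialFactor (N l : ℕ) (y y' : ℝ → ℝ) : Prop where
  deriv_y : ∀ x ∈ Ioo (-(Real.pi / 2)) (Real.pi / 2), HasDerivAt y (y' x) x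
  deriv_y' : ∀ x ∈ Ioo (-(Real.pi / 2)) (Real.pi / 2), HasDerivAt y'
    (((N : ℝ) - 1) * Real.tan x * y' x + gam N l / Real.cos x ^ 2 * y x) x
  even : ∀ x, y (-x) = y x
  init : y 0 = 1
  init' : y' 0 = 0
  one_le : ∀ x ∈ Ico 0 (Real.pi / 2), 1 ≤ y x
  deriv_nonneg : ∀ x ∈ Ico 0 (Real.pi / 2), 0 ≤ y' x

theorem exists_isRadialFactor {N : ℕ} (hN : 2 ≤ N) (l : ℕ) :
    ∃ y y' : ℝ → ℝ, IsRadialFactor N l y y' := by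
  have hR : 0 < Real.pi / 2 := by positivity
  have hc : ContinuousOn (fun x : ℝ => Real.cos x ^ (N - 1))
    (Ioo (-(Real.pi / 2)) (Real.pi / 2)) := by fun_prop
  have hpos : ∀ x ∈ Ioo (-(Real.pi / 2)) (Real.pi / 2), 0 < Real.cos x ^ (N - 1) := fun x hx =>
    pow_pos (cos_pos_of_lt hx) _
  -- The coefficient `γ_l cos^{N-3}` is written as a quotient: for `N = 2` the exponent is negative
  -- and natural subtraction would truncate it.
  obtain ⟨y, w, h1, h2, h3, h4, h5, h6, h7⟩ := exists_even_solution hR hc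
    (q := fun x => gam N l * (Real.cos x ^ (N - 1) / Real.cos x ^ 2))
    (continuousOn_const.mul (hc.div (by fun_prop) fun x hx => (pow_pos (cos_pos_of_lt hx) 2).ne'))
    hpos (fun x hx => by have := cos_pos_of_lt hx; have := gam_nonneg hN l; positivity)
    (fun x => by simp) (fun x => by simp)
  have hmem {x : ℝ} (hx : x ∈ Ico 0 (Real.pi / 2)) : x ∈ Ioo (-(Real.pi / 2)) (Real.pi / 2) :=
    ⟨by linarith [hx.1], hx.2⟩
  refine ⟨y, fun x => w x / Real.cos x ^ (N - 1), h1, fun x hx => ?_, h3, h5, by simp [h4], h6,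
    fun x hx => div_nonneg (h7 x hx) (hpos x (hmem hx)).le⟩
  have hcos := cos_pos_of_lt hx
  have hd := (h2 x hx).div ((Real.hasDerivAt_cos x).pow (N - 1)) (hpos x hx).ne'
  refine hd.congr_deriv ?_
  obtain ⟨k, rfl⟩ := Nat.exists_eq_add_of_le hN
  have e1 : 2 + k - 1 = k + 1 := by omega
  rw [Real.tan_eq_sin_div_cos]
  simp only [Pi.pow_apply, e1, Nat.add_sub_cancel]
  push_cast
  field_simp
  ring

section

variable {N l : ℕ} {y y' : ℝ → ℝ}

/-- The logarithmic derivative turns the linear equation into the Riccati equation. Since `y ≥ 1`,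
it does not blow up before `π/2`. -/
theorem IsRadialFactor.isRiccati (h : IsRadialFactor N l y y') :
    IsRiccati N l fun x => y' x / y x := by
  have hmem {x : ℝ} (hx : x ∈ Ico 0 (Real.pi / 2)) : x ∈ Ioo (-(Real.pi / 2)) (Real.pi / 2) :=
    ⟨by linarith [hx.1, Real.pi_pos], hx.2⟩
  have hne {x : ℝ} (hx : x ∈ Ico 0 (Real.pi / 2)) : y x ≠ 0 :=
    (zero_lt_one.trans_le (h.one_le x hx)).ne'
  refine ⟨fun x hx => ?_, by simp [h.init'], fun x hx => ?_⟩
  · exact (((h.deriv_y' x (hmem hx)).continuousAt).div (h.deriv_y x (hmem hx)).continuousAt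
      (hne hx)).continuousWithinAt
  · have hx' : x ∈ Ico 0 (Real.pi / 2) := ⟨hx.1.le, hx.2⟩
    refine ((h.deriv_y' x (hmem hx')).div (h.deriv_y x (hmem hx')) (hne hx')).congr_deriv ?_
    have := hne hx'
    have := (cos_pos_of_lt (hmem hx')).ne'
    unfold gam
    field_simp
    ring

end

/-- A function on `[0, R)` whose derivative is a continuous multiple of itself, with value `0`
at `0`, vanishes. -/
theorem eqOn_zero_of_deriv_eq_mul {R : ℝ} {e a : ℝ → ℝ} (he : ContinuousOn e (Ico 0 R))
    (ha : ContinuousOn a (Ico 0 R)) (h0 : e 0 = 0)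
    (hd : ∀ x ∈ Ioo 0 R, HasDerivAt e (a x * e x) x) : ∀ x ∈ Ico 0 R, e x = 0 := by
  intro x hx
  have hsub : Icc 0 x ⊆ Ico 0 R := fun z hz => ⟨hz.1, hz.2.trans_lt hx.2⟩
  obtain ⟨C, hC⟩ := isCompact_Icc.bddAbove_image ((ha.mono hsub).abs)
  by_contra hne
  have hpos : 0 < x := lt_of_le_of_ne hx.1 fun h => hne (h ▸ h0)
  -- Gronwall in integrated form: with `C` a bound for `|a|`, the function `e² exp(-2Cx)` is
  -- nonincreasing, nonnegative and zero at `0`.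
  have hexp : ContinuousOn (fun z => e z ^ 2 * Real.exp (-2 * C * z)) (Icc 0 x) :=
    ((he.mono hsub).pow 2).mul (by fun_prop)
  have hder : ∀ z ∈ interior (Icc 0 x),
      HasDerivWithinAt (fun z => e z ^ 2 * Real.exp (-2 * C * z))
        (2 * (a z - C) * (e z ^ 2 * Real.exp (-2 * C * z))) (interior (Icc 0 x)) z := by
    rw [interior_Icc]
    intro z hz
    have h1 := (hd z ⟨hz.1, hz.2.trans hx.2⟩).pow 2
    have h2 : HasDerivAt (fun z => Real.exp (-2 * C * z)) (Real.exp (-2 * C * z) * (-2 * C)) z := by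
      simpa using ((hasDerivAt_id z).const_mul (-2 * C)).exp
    refine ((h1.mul h2).congr_deriv ?_).hasDerivWithinAt
    simp
    ring
  have hanti := antitoneOn_of_hasDerivWithinAt_nonpos (convex_Icc 0 x) hexp hder fun z hz => by
    have hz' : z ∈ Icc 0 x := interior_subset hz
    have h3 : |a z| ≤ C := hC (mem_image_of_mem _ hz')
    have h4 := (le_abs_self _).trans h3
    have h5 : 0 ≤ e z ^ 2 * Real.exp (-2 * C * z) := by positivity
    nlinarith
  have hle := hanti ⟨le_rfl, hpos.le⟩ ⟨hpos.le, le_rfl⟩ hpos.le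
  simp only [h0] at hle
  have : 0 < e x ^ 2 * Real.exp (-2 * C * x) := by positivity
  rw [zero_pow two_ne_zero, zero_mul] at hle
  linarith

theorem continuousOn_tan_Ico : ContinuousOn Real.tan (Ico 0 (Real.pi / 2)) :=
  Real.continuousOn_tan_Ioo.mono fun x hx => ⟨by linarith [hx.1, Real.pi_pos], hx.2⟩

/-- The difference `e = f - g` of two solutions satisfies the linear equation `e' = (-(f + g) +
(N-1) tan) e`. -/
theorem IsRiccati.eqOn {N j : ℕ} {f g : ℝ → ℝ} (hf : IsRiccati N j f) (hg : IsRiccati N j g) :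
    EqOn f g (Ico 0 (Real.pi / 2)) := by
  have h := eqOn_zero_of_deriv_eq_mul (e := fun x => f x - g x)
    (a := fun x => -(f x + g x) + ((N : ℝ) - 1) * Real.tan x)
    (hf.continuousOn.sub hg.continuousOn)
    ((hf.continuousOn.add hg.continuousOn).neg.add
      (continuousOn_const.mul continuousOn_tan_Ico))
    (by simp [hf.initial, hg.initial]) fun x hx => by
      refine ((hf.ode x hx).sub (hg.ode x hx)).congr_deriv ?_
      ring
  exact fun x hx => sub_eq_zero.mp (h x hx)

theorem isRiccati_riccati {N : ℕ} (hN : 2 ≤ N) (j : ℕ) : IsRiccati N j (riccati N j) := by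
  obtain ⟨y, y', h⟩ := exists_isRadialFactor hN j
  have hex : ∃ f, IsRiccati N j f := ⟨_, h.isRiccati⟩
  unfold riccati
  rw [dif_pos hex]
  exact hex.choose_spec

/-- The radial factor `y_l`. -/
def radial (N l : ℕ) : ℝ → ℝ := if h : 2 ≤ N then (exists_isRadialFactor h l).choose else 0

/-- The derivative of the radial factor `y_l`. -/
def radial' (N l : ℕ) : ℝ → ℝ :=
  if h : 2 ≤ N then (exists_isRadialFactor h l).choose_spec.choose else 0

theorem isRadialFactor_radial {N : ℕ} (hN : 2 ≤ N) (l : ℕ) :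
    IsRadialFactor N l (radial N l) (radial' N l) := by
  unfold radial radial'
  rw [dif_pos hN, dif_pos hN]
  exact (exists_isRadialFactor hN l).choose_spec.choose_spec

theorem radial'_eq {N : ℕ} (hN : 2 ≤ N) (l : ℕ) {x : ℝ} (hx : x ∈ Ico 0 (Real.pi / 2)) :
    radial' N l x = riccati N l x * radial N l x := by
  have h := isRadialFactor_radial hN l
  have h1 := (isRiccati_riccati hN l).eqOn h.isRiccati hx
  rw [h1, div_mul_cancel₀]
  exact (zero_lt_one.trans_le (h.one_le x hx)).ne'

/-! ### Comparison theorems for the radial factors -/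

/-- Comparison of `y'/y` for two linear second order equations. -/
theorem wronskian_monotone {b : ℝ} {u u' u'' v v' v'' a : ℝ → ℝ} (hb : 0 ≤ b)
    (ha : ∀ x ∈ Icc 0 b, 0 < a x) (had : ∀ x ∈ Icc 0 b, DifferentiableAt ℝ a x)
    (hu : ∀ x ∈ Icc 0 b, HasDerivAt u (u' x) x) (hu' : ∀ x ∈ Icc 0 b, HasDerivAt u' (u'' x) x)
    (hv : ∀ x ∈ Icc 0 b, HasDerivAt v (v' x) x) (hv' : ∀ x ∈ Icc 0 b, HasDerivAt v' (v'' x) x)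
    (h0 : u' 0 = 0) (h0' : v' 0 = 0)
    (hpos : ∀ x ∈ Ioo 0 b, 0 ≤
      deriv a x * (u' x * v x - v' x * u x) + a x * (u'' x * v x - v'' x * u x)) :
    ∀ x ∈ Icc 0 b, 0 ≤ u' x * v x - v' x * u x := by
  -- The weighted Wronskian vanishes at `0`, and `hpos` says that its derivative is nonnegative.
  set W : ℝ → ℝ := fun x => a x * (u' x * v x - v' x * u x) with hW
  have hder (x : ℝ) (hx : x ∈ Icc 0 b) : HasDerivAt W
      (deriv a x * (u' x * v x - v' x * u x) + a x * (u'' x * v x - v'' x * u x)) x := by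
    refine ((had x hx).hasDerivAt.mul (((hu' x hx).mul (hv x hx)).sub
      ((hv' x hx).mul (hu x hx)))).congr_deriv ?_
    simp only [Pi.sub_apply, Pi.mul_apply]
    ring
  have hmono := monotoneOn_of_hasDerivWithinAt_nonneg (convex_Icc 0 b)
    (fun x hx => (hder x hx).continuousAt.continuousWithinAt)
    (fun x hx => (hder x (interior_subset hx)).hasDerivWithinAt)
    (fun x hx => hpos x (by rwa [interior_Icc] at hx))
  intro x hx
  have h1 := hmono ⟨le_rfl, hb⟩ hx hx.1
  have h2 : W 0 = 0 := by simp [hW, h0, h0']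
  rw [h2] at h1
  exact nonneg_of_mul_nonneg_right h1 (ha x hx)

theorem mem_Ioo_of_mem_Icc {b x : ℝ} (hb : b < Real.pi / 2) (hx : x ∈ Icc 0 b) :
    x ∈ Ioo (-(Real.pi / 2)) (Real.pi / 2) :=
  ⟨by linarith [hx.1, Real.pi_pos], hx.2.trans_lt hb⟩

theorem radial_pos {N : ℕ} (hN : 2 ≤ N) (l : ℕ) {x : ℝ} (hx : x ∈ Ico 0 (Real.pi / 2)) :
    0 < radial N l x := zero_lt_one.trans_le ((isRadialFactor_radial hN l).one_le x hx)

/-- Sturm comparison: the weight `cos^{N-1}` cancels the first-order terms, and the weighted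
Wronskian of `y_k` and `y_j` has derivative `cos^{N-1} (γ_k - γ_j) cos^{-2} y_j y_k ≥ 0`. -/
theorem riccati_le_riccati {N : ℕ} (hN : 2 ≤ N) {j k : ℕ} (hjk : j < k) {b : ℝ}
    (hb : b ∈ Ico 0 (Real.pi / 2)) : riccati N j b ≤ riccati N k b := by
  have hj := isRadialFactor_radial hN j
  have hk := isRadialFactor_radial hN k
  have hI {x : ℝ} (hx : x ∈ Icc 0 b) := mem_Ioo_of_mem_Icc hb.2 hx
  have hIco {x : ℝ} (hx : x ∈ Icc 0 b) : x ∈ Ico 0 (Real.pi / 2) := ⟨hx.1, hx.2.trans_lt hb.2⟩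
  have h := wronskian_monotone (a := fun x => Real.cos x ^ (N - 1)) hb.1
    (fun x hx => pow_pos (cos_pos_of_lt (hI hx)) _)
    (fun x hx => (Real.differentiableAt_cos).pow _) (fun x hx => hk.deriv_y x (hI hx))
    (fun x hx => hk.deriv_y' x (hI hx)) (fun x hx => hj.deriv_y x (hI hx))
    (fun x hx => hj.deriv_y' x (hI hx)) hk.init' hj.init' (fun x hx => by
      have hx' : x ∈ Icc 0 b := Ioo_subset_Icc_self hx
      have hcos := cos_pos_of_lt (hI hx')
      have hd : deriv (fun x => Real.cos x ^ (N - 1)) x =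
          -(((N : ℝ) - 1) * Real.tan x * Real.cos x ^ (N - 1)) := by
        rw [((Real.hasDerivAt_cos x).fun_pow (N - 1)).deriv, Real.tan_eq_sin_div_cos]
        obtain ⟨m, rfl⟩ := Nat.exists_eq_add_of_le hN
        have e1 : 2 + m - 1 = m + 1 := by omega
        simp only [e1, Nat.add_sub_cancel]
        push_cast
        field_simp
        ring
      have hg := (gam_lt_gam hN hjk).le
      have h1 := (radial_pos hN j (hIco hx')).le
      have h2 := (radial_pos hN k (hIco hx')).le
      have e : deriv (fun x => Real.cos x ^ (N - 1)) x *
          (radial' N k x * radial N j x - radial' N j x * radial N k x) +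
          Real.cos x ^ (N - 1) *
          ((((N : ℝ) - 1) * Real.tan x * radial' N k x + gam N k / Real.cos x ^ 2 * radial N k x) *
            radial N j x -
          (((N : ℝ) - 1) * Real.tan x * radial' N j x + gam N j / Real.cos x ^ 2 * radial N j x) *
            radial N k x) =
          Real.cos x ^ (N - 1) * ((gam N k - gam N j) / Real.cos x ^ 2 *
            (radial N j x * radial N k x)) := by
        rw [hd]; ring
      rw [e]
      have := sub_nonneg.mpr hg
      positivity) b ⟨hb.1, le_rfl⟩
  rw [radial'_eq hN k hb, radial'_eq hN j hb] at h
  have h3 : 0 < radial N k b * radial N j b := mul_pos (radial_pos hN k hb) (radial_pos hN j hb)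
  have h4 : 0 ≤ (riccati N k b - riccati N j b) * (radial N k b * radial N j b) := by linarith
  exact sub_nonneg.mp (nonneg_of_mul_nonneg_left h4 h3)

/-- At a point of equality, `f_k - f_j ≥ 0` would have a local minimum, hence derivative `0`. But
the two Riccati equations then give the derivative `(γ_k - γ_j)/cos² > 0`. -/
theorem riccati_lt_riccati {N : ℕ} (hN : 2 ≤ N) {j k : ℕ} (hjk : j < k) {b : ℝ}
    (hb : b ∈ Ioo 0 (Real.pi / 2)) : riccati N j b < riccati N k b := by
  refine lt_of_le_of_ne (riccati_le_riccati hN hjk ⟨hb.1.le, hb.2⟩) fun heq => ?_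
  have hd := ((isRiccati_riccati hN k).ode b hb).sub ((isRiccati_riccati hN j).ode b hb)
  have hmin : IsLocalMin (riccati N k - riccati N j) b := by
    filter_upwards [isOpen_Ioo.mem_nhds hb] with x hx
    simp only [Pi.sub_apply, heq, sub_self, sub_nonneg]
    exact riccati_le_riccati hN hjk ⟨hx.1.le, hx.2⟩
  have h0 := hmin.hasDerivAt_eq_zero hd
  have hcos := cos_pos_of_lt (x := b) ⟨by linarith [hb.1, Real.pi_pos], hb.2⟩
  have h1 : (gam N k - gam N j) / Real.cos b ^ 2 = 0 := by
    rw [← h0, heq]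
    unfold gam
    ring
  have h2 : 0 < (gam N k - gam N j) / Real.cos b ^ 2 := by
    have := sub_pos.mpr (gam_lt_gam hN hjk)
    positivity
  linarith

/-- Comparison of `y_l` with `cosh(l x)`. -/
theorem radial'_mul_cosh_ge {N : ℕ} (hN : 2 ≤ N) (l : ℕ) {x : ℝ} (hx : x ∈ Ico 0 (Real.pi / 2)) :
    l * Real.sinh (l * x) * radial N l x ≤ radial' N l x * Real.cosh (l * x) := by
  have h := isRadialFactor_radial hN l
  have hI {z : ℝ} (hz : z ∈ Icc 0 x) := mem_Ioo_of_mem_Icc hx.2 hz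
  have hlin (z : ℝ) : HasDerivAt (fun z : ℝ => (l : ℝ) * z) l z := by
    simpa using (hasDerivAt_id z).const_mul (l : ℝ)
  -- The constant weight suffices: the first-order term `(N-1) tan · y'` is nonnegative, and
  -- `γ_l/cos² ≥ l²`, which is the coefficient of the equation of `cosh(lx)`.
  have hw := wronskian_monotone (a := fun _ => 1) hx.1 (fun _ _ => zero_lt_one)
    (fun _ _ => differentiableAt_const _) (fun z hz => h.deriv_y z (hI hz))
    (fun z hz => h.deriv_y' z (hI hz)) (v := fun z => Real.cosh (l * z))
    (v' := fun z => Real.sinh (l * z) * l) (v'' := fun z => Real.cosh (l * z) * l * l)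
    (fun z _ => (hlin z).cosh) (fun z _ => ((hlin z).sinh).mul_const _) h.init' (by simp)
    (fun z hz => by
      have hz' : z ∈ Icc 0 x := Ioo_subset_Icc_self hz
      have hz2 : z ∈ Ico 0 (Real.pi / 2) := ⟨hz'.1, hz'.2.trans_lt hx.2⟩
      have h1 := h.deriv_nonneg z hz2
      have h2 := (radial_pos hN l hz2).le
      have h3 : 0 ≤ Real.tan z := Real.tan_nonneg_of_nonneg_of_le_pi_div_two hz2.1 hz2.2.le
      have h4 : (0 : ℝ) ≤ (N : ℝ) - 1 := by
        have : (2 : ℝ) ≤ N := by exact_mod_cast hN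
        linarith
      have hcos := cos_pos_of_lt (hI hz')
      have h5 : (l : ℝ) ^ 2 ≤ gam N l / Real.cos z ^ 2 := by
        rw [le_div_iff₀ (by positivity)]
        have h6 : Real.cos z ^ 2 ≤ 1 := Real.cos_sq_le_one z
        have h7 := sq_le_gam hN l
        nlinarith [sq_nonneg (l : ℝ)]
      have h6 := Real.cosh_pos (l * z)
      have h7 : 0 ≤ ((N : ℝ) - 1) * Real.tan z * radial' N l z := by positivity
      have h8 : 0 ≤ (gam N l / Real.cos z ^ 2 - (l : ℝ) ^ 2) * radial N l z :=
        mul_nonneg (sub_nonneg.mpr h5) h2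
      rw [deriv_const, zero_mul, zero_add, one_mul]
      have e : (((N : ℝ) - 1) * Real.tan z * radial' N l z +
          gam N l / Real.cos z ^ 2 * radial N l z) * Real.cosh (l * z) -
          Real.cosh (l * z) * l * l * radial N l z =
          (((N : ℝ) - 1) * Real.tan z * radial' N l z +
          (gam N l / Real.cos z ^ 2 - (l : ℝ) ^ 2) * radial N l z) * Real.cosh (l * z) := by ring
      rw [e]
      positivity) x ⟨hx.1, le_rfl⟩
  linarith

theorem riccati_ge {N : ℕ} (hN : 2 ≤ N) (l : ℕ) {x : ℝ} (hx : x ∈ Ico 0 (Real.pi / 2)) :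
    l * Real.tanh (l * x) ≤ riccati N l x := by
  have h := radial'_mul_cosh_ge hN l hx
  have h1 := radial_pos hN l hx
  have h2 := Real.cosh_pos (l * x)
  rw [radial'_eq hN l hx] at h
  rw [Real.tanh_eq_sinh_div_cosh, ← mul_div_assoc, div_le_iff₀ h2]
  have h3 : l * Real.sinh (l * x) * radial N l x ≤
      (riccati N l x * Real.cosh (l * x)) * radial N l x := by linarith
  exact le_of_mul_le_mul_right h3 h1

/-- The quotient `y_l / cosh(l ·)` is nondecreasing, and `cosh(ls)/cosh(lb) ≤ 2 e^{-l(b-s)}`. This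
exponential decay away from the boundary makes the separated series smooth inside the cylinder. -/
theorem radial_div_le {N : ℕ} (hN : 2 ≤ N) (l : ℕ) {s b : ℝ} (hs : 0 ≤ s) (hsb : s ≤ b)
    (hb : b < Real.pi / 2) :
    radial N l s / radial N l b ≤ 2 * Real.exp (-(l * (b - s))) := by
  have h := isRadialFactor_radial hN l
  have hI {z : ℝ} (hz : z ∈ Icc 0 b) := mem_Ioo_of_mem_Icc hb hz
  have hlin (z : ℝ) : HasDerivAt (fun z : ℝ => (l : ℝ) * z) l z := by
    simpa using (hasDerivAt_id z).const_mul (l : ℝ)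
  have hder (z : ℝ) (hz : z ∈ Icc 0 b) : HasDerivAt (fun z => radial N l z / Real.cosh (l * z))
      ((radial' N l z * Real.cosh (l * z) - radial N l z * (Real.sinh (l * z) * l)) /
        Real.cosh (l * z) ^ 2) z :=
    (h.deriv_y z (hI hz)).div (hlin z).cosh (Real.cosh_pos _).ne'
  have hmono := monotoneOn_of_hasDerivWithinAt_nonneg (convex_Icc 0 b)
    (fun z hz => (hder z hz).continuousAt.continuousWithinAt)
    (fun z hz => (hder z (interior_subset hz)).hasDerivWithinAt)
    (fun z hz => by
      have hz' := interior_subset hz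
      have := radial'_mul_cosh_ge hN l ⟨hz'.1, hz'.2.trans_lt hb⟩
      refine div_nonneg ?_ (sq_nonneg _)
      linarith)
  have hb0 := hs.trans hsb
  have h1 := hmono ⟨hs, hsb⟩ ⟨hb0, le_rfl⟩ hsb
  simp only at h1
  have hyb := radial_pos hN l ⟨hb0, hb⟩
  have hcs := Real.cosh_pos (l * s)
  have hcb := Real.cosh_pos (l * b)
  rw [div_le_div_iff₀ hcs hcb] at h1
  have h2 : Real.cosh (l * s) ≤ Real.exp (l * s) := by
    rw [Real.cosh_eq]
    have : Real.exp (-(l * s)) ≤ Real.exp (l * s) :=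
      Real.exp_le_exp.mpr (by have : 0 ≤ (l : ℝ) * s := by positivity
                              linarith)
    linarith
  have h3 : Real.exp (l * b) ≤ 2 * Real.cosh (l * b) := by
    rw [Real.cosh_eq]
    have := Real.exp_pos (-(l * b))
    linarith
  have h4 : Real.exp (-(l * (b - s))) = Real.exp (l * s) / Real.exp (l * b) := by
    rw [← Real.exp_sub]; congr 1; ring
  rw [div_le_iff₀ hyb, h4, mul_div_assoc', div_mul_eq_mul_div, le_div_iff₀ (Real.exp_pos _)]
  have hys := radial_pos hN l ⟨hs, hsb.trans_lt hb⟩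
  calc radial N l s * Real.exp (l * b) ≤ radial N l s * (2 * Real.cosh (l * b)) := by gcongr
    _ = 2 * (radial N l s * Real.cosh (l * b)) := by ring
    _ ≤ 2 * (radial N l b * Real.cosh (l * s)) := by gcongr
    _ ≤ 2 * (radial N l b * Real.exp (l * s)) := by gcongr
    _ = 2 * Real.exp (l * s) * radial N l b := by ring

theorem gam_le {N : ℕ} (l : ℕ) : gam N l ≤ (N + 1) * ((l : ℝ) + 1) ^ 2 := by
  unfold gam
  have hl : (0 : ℝ) ≤ l := by positivity
  have hN : (0 : ℝ) ≤ N := by positivity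
  nlinarith [mul_nonneg hl hN, mul_nonneg (mul_nonneg hl hl) hN]

/-- A constant `M` of size `l + 1` is a supersolution: where `f_l = M`, the derivative is at most `A
M + B (l + 1)² - M²`, which is negative. Here `A` bounds `(N-1) tan` and `B (l + 1)²` bounds
`γ_l/cos²` on `[0, b]`. -/
theorem exists_riccati_le {N : ℕ} (hN : 2 ≤ N) {b : ℝ} (hb : b ∈ Ioo 0 (Real.pi / 2)) :
    ∃ C : ℝ, 0 < C ∧ ∀ (l : ℕ), ∀ x ∈ Icc 0 b, riccati N l x ≤ C * (l + 1) := by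
  have hN' : (2 : ℝ) ≤ N := by exact_mod_cast hN
  have hcosb := cos_pos_of_lt (x := b) ⟨by linarith [hb.1, Real.pi_pos], hb.2⟩
  have htanb : 0 ≤ Real.tan b := Real.tan_nonneg_of_nonneg_of_le_pi_div_two hb.1.le hb.2.le
  set A : ℝ := ((N : ℝ) - 1) * Real.tan b with hA
  set B : ℝ := (N + 1) / Real.cos b ^ 2 with hB
  have hA0 : 0 ≤ A := mul_nonneg (by linarith) htanb
  have hB0 : 0 ≤ B := by positivity
  -- The summand `1` makes the inequality at a contact point strict.
  refine ⟨A + B + 1, by positivity, fun l x hx => ?_⟩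
  have h := isRadialFactor_radial hN l
  have hI {z : ℝ} (hz : z ∈ Icc 0 b) := mem_Ioo_of_mem_Icc hb.2 hz
  have hIco {z : ℝ} (hz : z ∈ Icc 0 b) : z ∈ Ico 0 (Real.pi / 2) := ⟨hz.1, hz.2.trans_lt hb.2⟩
  have hder (z : ℝ) (hz : z ∈ Icc 0 b) := (h.deriv_y' z (hI hz)).div (h.deriv_y z (hI hz))
    (radial_pos hN l (hIco hz)).ne'
  have key := image_le_of_deriv_right_lt_deriv_boundary
    (f := fun z => radial' N l z / radial N l z) (a := 0) (b := b)
    (B := fun _ => (A + B + 1) * (l + 1)) (B' := fun _ => 0)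
    (fun z hz => (hder z hz).continuousAt.continuousWithinAt)
    (fun z hz => (hder z (Ico_subset_Icc_self hz)).hasDerivWithinAt)
    (by simp only [h.init', zero_div]; positivity) (fun z => hasDerivAt_const _ _)
    (fun z hz hfz => by
      have hz' := Ico_subset_Icc_self hz
      have hy := radial_pos hN l (hIco hz')
      set M : ℝ := (A + B + 1) * (l + 1) with hM
      have hy' : radial' N l z = M * radial N l z := by
        rw [← hfz, div_mul_cancel₀ _ hy.ne']
      have hcos := cos_pos_of_lt (hI hz')
      have h1 : Real.cos b ≤ Real.cos z :=
        Real.cos_le_cos_of_nonneg_of_le_pi hz'.1 (by linarith [hb.2, Real.pi_pos]) hz'.2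
      have h2 : Real.tan z ≤ Real.tan b := by
        rcases hz'.2.eq_or_lt with h | h
        · rw [h]
        · exact (Real.tan_lt_tan_of_lt_of_lt_pi_div_two (hI hz').1 hb.2 h).le
      have h3 : gam N l / Real.cos z ^ 2 ≤ B * ((l : ℝ) + 1) ^ 2 := by
        rw [hB, div_mul_eq_mul_div]
        exact div_le_div₀ (by positivity) (gam_le l) (by positivity) (by gcongr)
      have h4 : ((N : ℝ) - 1) * Real.tan z ≤ A := mul_le_mul_of_nonneg_left h2 (by linarith)
      have hM0 : 0 < M := by positivity
      have e : ((((N : ℝ) - 1) * Real.tan z * radial' N l z +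
          gam N l / Real.cos z ^ 2 * radial N l z) * radial N l z -
          radial' N l z * radial' N l z) / radial N l z ^ 2 =
          ((N : ℝ) - 1) * Real.tan z * M + gam N l / Real.cos z ^ 2 - M ^ 2 := by
        rw [hy']; field_simp
      rw [e]
      have hl1 : (1 : ℝ) ≤ (l : ℝ) + 1 := by
        have : (0 : ℝ) ≤ l := by positivity
        linarith
      have h5 : ((N : ℝ) - 1) * Real.tan z * M ≤ A * M := mul_le_mul_of_nonneg_right h4 hM0.le
      have h6 : A * M ≤ A * ((l : ℝ) + 1) * M := by
        refine mul_le_mul_of_nonneg_right ?_ hM0.le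
        exact le_mul_of_one_le_right hA0 hl1
      have h7 : B * ((l : ℝ) + 1) ^ 2 ≤ B * ((l : ℝ) + 1) * M := by
        have : (l : ℝ) + 1 ≤ M := by
          rw [hM]; exact le_mul_of_one_le_left (by linarith) (by linarith)
        nlinarith [mul_nonneg hB0 (by linarith : (0 : ℝ) ≤ (l : ℝ) + 1)]
      have h8 : M ^ 2 = A * ((l : ℝ) + 1) * M + B * ((l : ℝ) + 1) * M + ((l : ℝ) + 1) * M := by
        rw [sq]; nth_rewrite 1 [hM]; ring
      have h9 : 0 < ((l : ℝ) + 1) * M := by positivity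
      linarith) hx
  have := (isRiccati_riccati hN l).eqOn h.isRiccati (hIco hx)
  rw [this]
  exact key

theorem riccati_nonneg {N : ℕ} (hN : 2 ≤ N) (l : ℕ) {x : ℝ} (hx : x ∈ Ico 0 (Real.pi / 2)) :
    0 ≤ riccati N l x := by
  have h := isRadialFactor_radial hN l
  rw [(isRiccati_riccati hN l).eqOn h.isRiccati hx]
  exact div_nonneg (h.deriv_nonneg x hx) (radial_pos hN l hx).le

/-! ### The eigenvalues -/

theorem deriv_profile_neg {N : ℕ} {lam : ℝ} (hlam : lam ∈ Ioo 0 (Real.pi / 2)) :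
    deriv (profile N) lam < 0 := by
  have hmem : lam ∈ Ioo (-(Real.pi / 2)) (Real.pi / 2) :=
    ⟨by linarith [hlam.1, Real.pi_pos], hlam.2⟩
  rw [(hasDerivAt_profile N hmem).deriv, neg_lt_zero]
  refine div_pos ?_ (pow_pos (cos_pos_of_lt hmem) _)
  refine intervalIntegral.intervalIntegral_pos_of_pos_on
    ((by fun_prop : Continuous fun r : ℝ => Real.cos r ^ (N - 1)).intervalIntegrable _ _)
    (fun x hx => pow_pos (cos_pos_of_lt ⟨by linarith [hx.1, Real.pi_pos], hx.2.trans hlam.2⟩) _)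
    hlam.1

theorem eigval_sub_eigval (N j l : ℕ) (lam : ℝ) : eigval N j lam - eigval N l lam =
    -deriv (profile N) lam * (riccati N j lam - riccati N l lam) := by
  unfold eigval; ring

theorem exists_eigval_bounds {N : ℕ} (hN : 2 ≤ N) {lam : ℝ} (hlam : lam ∈ Ioo 0 (Real.pi / 2)) :
    ∃ C : ℝ, ∀ j : ℕ, eigval N j lam ^ 2 ≤ C * (1 + (j : ℝ) ^ 2) := by
  obtain ⟨C, hC, h⟩ := exists_riccati_le hN hlam
  set D := deriv (profile N) lam
  set A := D * (((N : ℝ) - 1) * Real.tan lam) - 1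
  refine ⟨2 * A ^ 2 + 4 * D ^ 2 * C ^ 2, fun j => ?_⟩
  have h1 := h j lam ⟨hlam.1.le, le_rfl⟩
  have h2 := riccati_nonneg hN j (x := lam) ⟨hlam.1.le, hlam.2⟩
  have h3 : riccati N j lam ^ 2 ≤ C ^ 2 * (2 * (1 + (j : ℝ) ^ 2)) := by
    have h4 : riccati N j lam ^ 2 ≤ (C * (j + 1)) ^ 2 := pow_le_pow_left₀ h2 h1 2
    have h5 : ((j : ℝ) + 1) ^ 2 ≤ 2 * (1 + (j : ℝ) ^ 2) := by nlinarith [sq_nonneg ((j : ℝ) - 1)]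
    rw [mul_pow] at h4
    exact h4.trans (mul_le_mul_of_nonneg_left h5 (sq_nonneg C))
  have e : eigval N j lam = A - D * riccati N j lam := by
    simp only [eigval, A, D]; ring
  rw [e]
  have h6 : (A - D * riccati N j lam) ^ 2 ≤ 2 * A ^ 2 + 2 * (D ^ 2 * riccati N j lam ^ 2) := by
    nlinarith [sq_nonneg (A + D * riccati N j lam)]
  have h7 := mul_le_mul_of_nonneg_left h3 (sq_nonneg D)
  nlinarith [sq_nonneg (j : ℝ), sq_nonneg (A * j)]

/-- For large `j` the bound `f_j ≥ j tanh(jλ)` dominates the fixed `f_l`, so the difference grows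
linearly. The finitely many remaining `j ≠ l` only need a nonzero difference, supplied by strict
monotonicity. -/
theorem exists_eigval_sub_bounds {N : ℕ} (hN : 2 ≤ N) {lam : ℝ}
    (hlam : lam ∈ Ioo 0 (Real.pi / 2)) (l : ℕ) :
    ∃ C : ℝ, (∀ j : ℕ, (eigval N j lam - eigval N l lam) ^ 2 ≤ C * (1 + (j : ℝ) ^ 2)) ∧
      ∀ j : ℕ, j ≠ l → 1 + (j : ℝ) ^ 2 ≤ C * (eigval N j lam - eigval N l lam) ^ 2 := by
  obtain ⟨C, hC⟩ := exists_eigval_bounds hN hlam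
  have hIco : lam ∈ Ico 0 (Real.pi / 2) := ⟨hlam.1.le, hlam.2⟩
  set m : ℕ → ℝ := fun j => eigval N j lam - eigval N l lam with hm
  set D := -deriv (profile N) lam with hD
  have hD0 : 0 < D := neg_pos.mpr (deriv_profile_neg hlam)
  have hne (j : ℕ) (hj : j ≠ l) : m j ≠ 0 := by
    simp only [hm, eigval_sub_eigval]
    refine mul_ne_zero hD0.ne' (sub_ne_zero.mpr ?_)
    rcases lt_or_gt_of_ne hj with h | h
    · exact (riccati_lt_riccati hN h hlam).ne
    · exact (riccati_lt_riccati hN h hlam).ne'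
  set τ := Real.tanh lam with hτ
  have hτ0 : 0 < τ := by
    rw [hτ, Real.tanh_eq_sinh_div_cosh]
    exact div_pos (Real.sinh_pos_iff.mpr hlam.1) (Real.cosh_pos _)
  -- For `j ≥ J` one has `j ≥ 1`, hence `tanh(jλ) ≥ τ`, and `f_l ≤ jτ/2`, so that `f_j - f_l ≥
  -- jτ/2`.
  obtain ⟨J, hJ⟩ := exists_nat_ge (2 * riccati N l lam / τ + 1)
  have hfl := riccati_nonneg hN l hIco
  have hbig (j : ℕ) (hj : J ≤ j) : 1 + (j : ℝ) ^ 2 ≤ 8 / (τ ^ 2 * D ^ 2) * m j ^ 2 := by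
    have hj' : 2 * riccati N l lam / τ + 1 ≤ j := hJ.trans (by exact_mod_cast hj)
    have hq : 0 ≤ 2 * riccati N l lam / τ := by positivity
    have hj1 : (1 : ℝ) ≤ j := by linarith
    have h1 : τ ≤ Real.tanh (j * lam) := by
      have h : lam ≤ j * lam := le_mul_of_one_le_left hlam.1.le hj1
      rw [hτ, Real.tanh_eq_sinh_div_cosh, Real.tanh_eq_sinh_div_cosh,
        div_le_div_iff₀ (Real.cosh_pos _) (Real.cosh_pos _)]
      have h2 := Real.sinh_sub (j * lam) lam
      have h3 : 0 ≤ Real.sinh (j * lam - lam) := Real.sinh_nonneg_iff.mpr (by linarith)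
      linarith
    have h2 := riccati_ge hN j hIco
    have h3 : j * τ ≤ riccati N j lam :=
      (mul_le_mul_of_nonneg_left h1 (by linarith)).trans h2
    have h4 : 2 * riccati N l lam ≤ j * τ := by
      have : 2 * riccati N l lam / τ ≤ j := by linarith
      rwa [div_le_iff₀ hτ0] at this
    have h5 : j * τ / 2 ≤ riccati N j lam - riccati N l lam := by linarith
    have h6 : (j * τ / 2) ^ 2 ≤ (riccati N j lam - riccati N l lam) ^ 2 :=
      pow_le_pow_left₀ (by positivity) h5 2
    simp only [hm, eigval_sub_eigval]
    rw [mul_pow, div_mul_eq_mul_div, le_div_iff₀ (by positivity)]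
    have h7 : (1 + (j : ℝ) ^ 2) * τ ^ 2 ≤ 8 * (riccati N j lam - riccati N l lam) ^ 2 := by
      have : 1 + (j : ℝ) ^ 2 ≤ 2 * (j : ℝ) ^ 2 := by nlinarith
      have := mul_le_mul_of_nonneg_right this (sq_nonneg τ)
      nlinarith
    have h8 := mul_le_mul_of_nonneg_right h7 (sq_nonneg D)
    linarith
  have hr (j : ℕ) : 0 ≤ (1 + (j : ℝ) ^ 2) / m j ^ 2 := by positivity
  -- The sum dominates each of the finitely many ratios; a term with `j = l` is a division by zero
  -- and contributes `0`.
  set S := ∑ j ∈ Finset.range J, (1 + (j : ℝ) ^ 2) / m j ^ 2 with hS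
  have hS0 : 0 ≤ S := Finset.sum_nonneg fun j _ => hr j
  have hC0 : 0 ≤ C := by
    have := (sq_nonneg _).trans (hC 0)
    simpa using this
  refine ⟨2 * C + 2 * eigval N l lam ^ 2 + (8 / (τ ^ 2 * D ^ 2) + S), fun j => ?_,
    fun j hj => ?_⟩
  · have h1 := hC j
    have h2 : (eigval N j lam - eigval N l lam) ^ 2 ≤
        2 * eigval N j lam ^ 2 + 2 * eigval N l lam ^ 2 := by
      nlinarith [sq_nonneg (eigval N j lam + eigval N l lam)]
    have h3 : 0 ≤ 8 / (τ ^ 2 * D ^ 2) + S := by positivity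
    nlinarith [sq_nonneg (j : ℝ), mul_nonneg h3 (sq_nonneg (j : ℝ)),
      sq_nonneg (eigval N l lam * j)]
  · have h0 : 0 ≤ 2 * C + 2 * eigval N l lam ^ 2 := by positivity
    have hm2 : 0 ≤ m j ^ 2 := sq_nonneg _
    change 1 + (j : ℝ) ^ 2 ≤ _ * m j ^ 2
    rcases Nat.lt_or_ge j J with h | h
    · have h1 : (1 + (j : ℝ) ^ 2) / m j ^ 2 ≤ S :=
        Finset.single_le_sum (f := fun j : ℕ => (1 + (j : ℝ) ^ 2) / m j ^ 2)
          (fun j _ => hr j) (Finset.mem_range.mpr h)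
      have h2 : 0 < m j ^ 2 := by have := hne j hj; positivity
      rw [div_le_iff₀ h2] at h1
      have h3 : 0 ≤ 8 / (τ ^ 2 * D ^ 2) := by positivity
      nlinarith [mul_nonneg h3 hm2, mul_nonneg h0 hm2]
    · have h1 := hbig j h
      nlinarith [mul_nonneg hS0 hm2, mul_nonneg h0 hm2]

/-! ### The maximum principle on the cylinder -/

theorem contDiffOn_two_of_hasDerivAt {f f' f'' : ℝ → ℝ} {s : Set ℝ} (hs : IsOpen s)
    (h1 : ∀ x ∈ s, HasDerivAt f (f' x) x) (h2 : ∀ x ∈ s, HasDerivAt f' (f'' x) x)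
    (h3 : ContinuousOn f'' s) : ContDiffOn ℝ 2 f s := by
  have hf' : ContDiffOn ℝ 1 f' s := by
    rw [show (1 : WithTop ℕ∞) = 0 + 1 from rfl, contDiffOn_succ_iff_deriv_of_isOpen hs]
    refine ⟨fun x hx => (h2 x hx).differentiableAt.differentiableWithinAt, by simp, ?_⟩
    rw [contDiffOn_zero]
    exact h3.congr fun x hx => (h2 x hx).deriv
  rw [show (2 : WithTop ℕ∞) = 1 + 1 from rfl, contDiffOn_succ_iff_deriv_of_isOpen hs]
  exact ⟨fun x hx => (h1 x hx).differentiableAt.differentiableWithinAt, by simp,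
    hf'.congr fun x hx => (h1 x hx).deriv⟩

/-- If the second derivative were positive, the point would also be a local minimum. The function
would then be locally constant, with second derivative zero. -/
theorem deriv_deriv_nonpos_of_isLocalMax {f : ℝ → ℝ} {x : ℝ} (h : IsLocalMax f x)
    (hc : ContinuousAt f x) : deriv (deriv f) x ≤ 0 := by
  by_contra! hpos
  have hmin := isLocalMin_of_deriv_deriv_pos hpos h.deriv_eq_zero hc
  have hconst : f =ᶠ[𝓝 x] fun _ => f x := by
    filter_upwards [h, hmin] with y h1 h2 using le_antisymm h1 h2
  have h1 : deriv (deriv f) x = 0 := by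
    rw [hconst.deriv.deriv_eq]; simp
  linarith

theorem pd_pd_nonpos_of_isLocalMax {N : ℕ} {F : Euc N → ℝ} {x : Euc N} (hF : ContDiffAt ℝ 2 F x)
    (h : IsLocalMax F x) (i : Fin N) : pd i (pd i F) x ≤ 0 := by
  have hline (s : ℝ) : HasDerivAt (fun s : ℝ => x + s • stdVec i) (stdVec i) s := by
    simpa using ((hasDerivAt_id s).smul_const (stdVec i)).const_add x
  have hcont : ContinuousAt (fun s : ℝ => x + s • stdVec i) 0 := (hline 0).continuousAt
  have h0 : x + (0 : ℝ) • stdVec i = x := by simp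
  have hev : ∀ᶠ s in 𝓝 (0 : ℝ), ContDiffAt ℝ 2 F (x + s • stdVec i) := by
    have := hF.eventually (by simp)
    rw [← h0] at this
    exact hcont.eventually this
  have hd1 : deriv (fun s : ℝ => F (x + s • stdVec i)) =ᶠ[𝓝 0]
      fun s => pd i F (x + s • stdVec i) := by
    filter_upwards [hev] with s hs
    exact ((hs.differentiableAt (by norm_num)).hasFDerivAt.comp_hasDerivAt s (hline s)).deriv
  have hd2 : deriv (deriv (fun s : ℝ => F (x + s • stdVec i))) 0 = pd i (pd i F) x := by
    rw [hd1.deriv_eq]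
    have h2 : DifferentiableAt ℝ (pd i F) (x + (0 : ℝ) • stdVec i) := by
      rw [h0]
      exact (contDiffAt_pd (m := 1) hF (by norm_num)).differentiableAt (by norm_num)
    have := (h2.hasFDerivAt.comp_hasDerivAt 0 (hline 0)).deriv
    rw [h0] at this
    exact this
  rw [← hd2]
  refine deriv_deriv_nonpos_of_isLocalMax ?_ ?_
  · have h' : ∀ᶠ y in 𝓝 (x + (0 : ℝ) • stdVec i), F y ≤ F x := by rw [h0]; exact h
    filter_upwards [hcont.eventually h'] with s hs
    simpa using hs
  · refine ContinuousAt.comp (g := F) ?_ hcont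
    rw [h0]; exact hF.continuousAt

/-- The extension constant along rays inherits the maximum, now as a local maximum in `ℝ^N`, so each
of its pure second partial derivatives is nonpositive. -/
theorem sphLaplacian_nonpos_of_forall_le {N : ℕ} {f : Sph N → ℝ} (hf : IsC2 f) {σ : Sph N}
    (h : ∀ τ, f τ ≤ f σ) : sphLaplacian f σ ≤ 0 := by
  unfold sphLaplacian
  have hx := hf.contDiffAt (coe_ne_zero σ)
  rw [laplacian_eq_sum_pd hx]
  refine Finset.sum_nonpos fun i _ => pd_pd_nonpos_of_isLocalMax hx ?_ i
  filter_upwards [isOpen_compl_singleton.mem_nhds (coe_ne_zero σ)] with y hy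
  rw [homExt_of_ne f hy, homExt_coe]
  exact h _

/-- Functions on the closed cylinder that are continuous, and twice continuously differentiable
in each of the variables in the interior. -/
structure IsCylRegular {N : ℕ} (u : Sph N → ℝ → ℝ) : Prop where
  continuousOn : ContinuousOn (fun p : Sph N × ℝ => u p.1 p.2) (univ ×ˢ Icc (-1) 1)
  isC2 : ∀ t ∈ Ioo (-1 : ℝ) 1, IsC2 fun σ => u σ t
  contDiffOn : ∀ σ, ContDiffOn ℝ 2 (u σ) (Ioo (-1) 1)

theorem IsCylRegular.add {N : ℕ} {u v : Sph N → ℝ → ℝ} (hu : IsCylRegular u)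
    (hv : IsCylRegular v) : IsCylRegular fun σ t => u σ t + v σ t :=
  ⟨hu.continuousOn.add hv.continuousOn, fun t ht => (hu.isC2 t ht).add (hv.isC2 t ht),
    fun σ => (hu.contDiffOn σ).add (hv.contDiffOn σ)⟩

theorem IsCylRegular.const_mul {N : ℕ} {u : Sph N → ℝ → ℝ} (hu : IsCylRegular u) (c : ℝ) :
    IsCylRegular fun σ t => c * u σ t :=
  ⟨continuousOn_const.mul hu.continuousOn, fun t ht => (hu.isC2 t ht).const_mul c,
    fun σ => contDiffOn_const.mul (hu.contDiffOn σ)⟩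

theorem IsCylRegular.sub {N : ℕ} {u v : Sph N → ℝ → ℝ} (hu : IsCylRegular u)
    (hv : IsCylRegular v) : IsCylRegular fun σ t => u σ t + (-1) * v σ t :=
  hu.add (hv.const_mul (-1))

theorem isCylRegular_of_isC2 {N : ℕ} {f : Sph N → ℝ} (hf : IsC2 f) :
    IsCylRegular fun (σ : Sph N) (_ : ℝ) => f σ :=
  ⟨(hf.continuous.comp continuous_fst).continuousOn, fun _ _ => hf,
    fun _ => contDiffOn_const⟩

theorem isCylRegular_of_time {N : ℕ} {b : ℝ → ℝ} (hb : ContinuousOn b (Icc (-1) 1))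
    (hb' : ContDiffOn ℝ 2 b (Ioo (-1) 1)) : IsCylRegular fun (_ : Sph N) (t : ℝ) => b t :=
  ⟨hb.comp continuousOn_snd fun _ hp => hp.2, fun t _ => isC2_const (b t), fun _ => hb'⟩

theorem IsCylRegular.differentiableAt {N : ℕ} {u : Sph N → ℝ → ℝ} (hu : IsCylRegular u) (σ : Sph N)
    {t : ℝ} (ht : t ∈ Ioo (-1 : ℝ) 1) : DifferentiableAt ℝ (u σ) t :=
  ((hu.contDiffOn σ).contDiffAt (isOpen_Ioo.mem_nhds ht)).differentiableAt (by norm_num)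

theorem IsCylRegular.differentiableAt_deriv {N : ℕ} {u : Sph N → ℝ → ℝ} (hu : IsCylRegular u)
    (σ : Sph N) {t : ℝ} (ht : t ∈ Ioo (-1 : ℝ) 1) : DifferentiableAt ℝ (deriv (u σ)) t := by
  have h := (hu.contDiffOn σ)
  rw [show (2 : WithTop ℕ∞) = 1 + 1 from rfl,
    contDiffOn_succ_iff_deriv_of_isOpen isOpen_Ioo] at h
  exact (h.2.2.contDiffAt (isOpen_Ioo.mem_nhds ht)).differentiableAt (by norm_num)

theorem mul_mem_Ioo {lam t : ℝ} (hlam : lam ∈ Ioo 0 (Real.pi / 2)) (ht : t ∈ Icc (-1 : ℝ) 1) :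
    lam * t ∈ Ioo (-(Real.pi / 2)) (Real.pi / 2) := by
  have := hlam.1
  have := hlam.2
  constructor <;> nlinarith [ht.1, ht.2]

theorem hasDerivAt_cos_mul_pow (n : ℕ) (lam t : ℝ) :
    HasDerivAt (fun s => Real.cos (lam * s) ^ n)
      (n * Real.cos (lam * t) ^ (n - 1) * (-Real.sin (lam * t) * lam)) t := by
  have h : HasDerivAt (fun s : ℝ => lam * s) lam t := by
    simpa using (hasDerivAt_id t).const_mul lam
  exact h.cos.fun_pow n

theorem cylLaplacian_eq {N : ℕ} {lam : ℝ} (hlam : lam ∈ Ioo 0 (Real.pi / 2)) {u : Sph N → ℝ → ℝ}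
    {σ : Sph N} {t : ℝ} (ht : t ∈ Ioo (-1 : ℝ) 1) (hd : DifferentiableAt ℝ (deriv (u σ)) t) :
    cylLaplacian lam u σ t =
      1 / lam ^ 2 * (deriv (deriv (u σ)) t -
        (N - 1 : ℕ) * lam * Real.tan (lam * t) * deriv (u σ) t) +
      1 / Real.cos (lam * t) ^ 2 * sphLaplacian (fun τ => u τ t) σ := by
  have hcos := cos_pos_of_lt (mul_mem_Ioo hlam (Ioo_subset_Icc_self ht))
  have hl := hlam.1
  unfold cylLaplacian
  congr 1
  have h := (hasDerivAt_cos_mul_pow (N - 1) lam t).mul hd.hasDerivAt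
  have e : deriv (fun s => Real.cos (lam * s) ^ (N - 1) * deriv (u σ) s) t = _ := h.deriv
  rw [e, Real.tan_eq_sin_div_cos]
  rcases Nat.eq_zero_or_pos (N - 1) with h0 | h0
  · simp [h0]
  · obtain ⟨k, hk⟩ := Nat.exists_eq_add_of_le' h0
    rw [hk]
    simp only [Nat.add_sub_cancel]
    field_simp
    push_cast
    ring

theorem cylLaplacian_add {N : ℕ} {lam : ℝ} (hlam : lam ∈ Ioo 0 (Real.pi / 2)) {u v : Sph N → ℝ → ℝ}
    (hu : IsCylRegular u) (hv : IsCylRegular v) (σ : Sph N) {t : ℝ} (ht : t ∈ Ioo (-1 : ℝ) 1) :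
    cylLaplacian lam (fun σ t => u σ t + v σ t) σ t =
      cylLaplacian lam u σ t + cylLaplacian lam v σ t := by
  have e : deriv (fun t => u σ t + v σ t) =ᶠ[𝓝 t] fun t => deriv (u σ) t + deriv (v σ) t := by
    filter_upwards [isOpen_Ioo.mem_nhds ht] with s hs
    exact deriv_fun_add (hu.differentiableAt σ hs) (hv.differentiableAt σ hs)
  have hu' := hu.differentiableAt_deriv σ ht
  have hv' := hv.differentiableAt_deriv σ ht
  rw [cylLaplacian_eq hlam ht ((hu.add hv).differentiableAt_deriv σ ht),
    cylLaplacian_eq hlam ht hu', cylLaplacian_eq hlam ht hv', e.deriv_eq, e.eq_of_nhds,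
    deriv_fun_add hu' hv', sphLaplacian_add (hu.isC2 t ht) (hv.isC2 t ht)]
  ring

theorem cylLaplacian_const_mul {N : ℕ} {lam : ℝ} (hlam : lam ∈ Ioo 0 (Real.pi / 2))
    {u : Sph N → ℝ → ℝ} (hu : IsCylRegular u) (c : ℝ) (σ : Sph N) {t : ℝ}
    (ht : t ∈ Ioo (-1 : ℝ) 1) :
    cylLaplacian lam (fun σ t => c * u σ t) σ t = c * cylLaplacian lam u σ t := by
  have e : deriv (fun t => c * u σ t) =ᶠ[𝓝 t] fun t => c * deriv (u σ) t := by
    filter_upwards [isOpen_Ioo.mem_nhds ht] with s hs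
    exact deriv_const_mul c (hu.differentiableAt σ hs)
  have hu' := hu.differentiableAt_deriv σ ht
  rw [cylLaplacian_eq hlam ht ((hu.const_mul c).differentiableAt_deriv σ ht),
    cylLaplacian_eq hlam ht hu', e.deriv_eq, e.eq_of_nhds,
    deriv_const_mul c hu', sphLaplacian_const_mul (hu.isC2 t ht)]
  ring

theorem cylLaplacian_sph {N : ℕ} {lam : ℝ} {f : Sph N → ℝ} (σ : Sph N) (t : ℝ) :
    cylLaplacian lam (fun σ _ => f σ) σ t = 1 / Real.cos (lam * t) ^ 2 * sphLaplacian f σ := by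
  unfold cylLaplacian
  simp

/-! ### The barrier and the maximum principle -/

/-- The barrier `ũ(λ t) - ũ(λ)`. -/
def barrier (N : ℕ) (lam t : ℝ) : ℝ := profile N (lam * t) - profile N lam

theorem hasDerivAt_mul_left (lam t : ℝ) : HasDerivAt (fun s : ℝ => lam * s) lam t := by
  simpa using (hasDerivAt_id t).const_mul lam

theorem hasDerivAt_deriv_profile {N : ℕ} (hN : 2 ≤ N) {θ : ℝ}
    (hθ : θ ∈ Ioo (-(Real.pi / 2)) (Real.pi / 2)) :
    HasDerivAt (deriv (profile N)) (((N : ℝ) - 1) * Real.tan θ * deriv (profile N) θ - 1) θ := by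
  have hcos := cos_pos_of_lt hθ
  have h := (profile_ode N hθ).div ((Real.hasDerivAt_cos θ).fun_pow (N - 1)) (pow_pos hcos _).ne'
  have e : deriv (profile N) =ᶠ[𝓝 θ]
      fun x => Real.cos x ^ (N - 1) * deriv (profile N) x / Real.cos x ^ (N - 1) := by
    filter_upwards [isOpen_Ioo.mem_nhds hθ] with x hx
    have := (pow_pos (cos_pos_of_lt hx) (N - 1)).ne'
    field_simp
  refine (h.congr_of_eventuallyEq e).congr_deriv ?_
  obtain ⟨k, rfl⟩ := Nat.exists_eq_add_of_le hN
  have e1 : 2 + k - 1 = k + 1 := by omega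
  rw [Real.tan_eq_sin_div_cos]
  simp only [e1, Nat.add_sub_cancel]
  push_cast
  field_simp
  ring

theorem hasDerivAt_profile' {N : ℕ} {θ : ℝ} (hθ : θ ∈ Ioo (-(Real.pi / 2)) (Real.pi / 2)) :
    HasDerivAt (profile N) (deriv (profile N) θ) θ :=
  (hasDerivAt_profile N hθ).differentiableAt.hasDerivAt

theorem hasDerivAt_barrier {N : ℕ} {lam t : ℝ} (hlam : lam ∈ Ioo 0 (Real.pi / 2))
    (ht : t ∈ Icc (-1 : ℝ) 1) :
    HasDerivAt (barrier N lam) (deriv (profile N) (lam * t) * lam) t :=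
  ((hasDerivAt_profile' (mul_mem_Ioo hlam ht)).comp t (hasDerivAt_mul_left lam t)).sub_const _

theorem isCylRegular_barrier {N : ℕ} (hN : 2 ≤ N) {lam : ℝ} (hlam : lam ∈ Ioo 0 (Real.pi / 2)) :
    IsCylRegular fun (_ : Sph N) (t : ℝ) => barrier N lam t := by
  refine isCylRegular_of_time (fun t ht => (hasDerivAt_barrier hlam ht).continuousAt.continuousWithinAt) ?_
  have hd2 (t : ℝ) (ht : t ∈ Ioo (-1 : ℝ) 1) :
      HasDerivAt (fun t => deriv (profile N) (lam * t) * lam)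
        ((((N : ℝ) - 1) * Real.tan (lam * t) * deriv (profile N) (lam * t) - 1) * lam * lam) t :=
    ((hasDerivAt_deriv_profile hN (mul_mem_Ioo hlam (Ioo_subset_Icc_self ht))).comp t
      (hasDerivAt_mul_left lam t)).mul_const _
  refine contDiffOn_two_of_hasDerivAt isOpen_Ioo
    (fun t ht => hasDerivAt_barrier hlam (Ioo_subset_Icc_self ht)) hd2 fun t ht => ?_
  have hmem := mul_mem_Ioo hlam (Ioo_subset_Icc_self ht)
  have h1 : ContinuousAt (fun t => Real.tan (lam * t)) t :=
    ContinuousAt.comp (g := Real.tan) (Real.continuousAt_tan.mpr (cos_pos_of_lt hmem).ne')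
      (by fun_prop)
  have h2 : ContinuousAt (fun t => deriv (profile N) (lam * t)) t :=
    ContinuousAt.comp (g := deriv (profile N)) (hasDerivAt_deriv_profile hN hmem).continuousAt
      (by fun_prop)
  exact (((((continuousAt_const.mul h1).mul h2).sub continuousAt_const).mul
    continuousAt_const).mul continuousAt_const).continuousWithinAt

theorem cylLaplacian_barrier {N : ℕ} {lam : ℝ} (hlam : lam ∈ Ioo 0 (Real.pi / 2)) (σ : Sph N)
    {t : ℝ} (ht : t ∈ Ioo (-1 : ℝ) 1) :
    cylLaplacian lam (fun _ t => barrier N lam t) σ t = -1 := by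
  have hmem := mul_mem_Ioo hlam (Ioo_subset_Icc_self ht)
  have hcos := pow_pos (cos_pos_of_lt hmem) (N - 1)
  have hl := hlam.1
  unfold cylLaplacian
  rw [sphLaplacian_const]
  have e : (fun s => Real.cos (lam * s) ^ (N - 1) * deriv (barrier N lam) s) =ᶠ[𝓝 t]
      fun s => (Real.cos (lam * s) ^ (N - 1) * deriv (profile N) (lam * s)) * lam := by
    filter_upwards [isOpen_Ioo.mem_nhds ht] with s hs
    rw [(hasDerivAt_barrier hlam (Ioo_subset_Icc_self hs)).deriv]
    ring
  have h := ((profile_ode N hmem).comp t (hasDerivAt_mul_left lam t)).mul_const lam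
  have h' : deriv (fun s => (Real.cos (lam * s) ^ (N - 1) * deriv (profile N) (lam * s)) * lam) t =
    _ := h.deriv
  change 1 / (lam ^ 2 * Real.cos (lam * t) ^ (N - 1)) *
    deriv (fun s => Real.cos (lam * s) ^ (N - 1) * deriv (barrier N lam) s) t + _ = -1
  rw [e.deriv_eq, h']
  field_simp
  ring

theorem barrier_one (N : ℕ) (lam : ℝ) : barrier N lam 1 = 0 := by simp [barrier]

theorem barrier_neg_one (N : ℕ) (lam : ℝ) : barrier N lam (-1) = 0 := by
  simp [barrier, profile_neg]

/-- The weak maximum principle. -/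
theorem le_of_cylLaplacian_nonneg {N : ℕ} (hN : 2 ≤ N) {lam : ℝ} (hlam : lam ∈ Ioo 0 (Real.pi / 2))
    {u : Sph N → ℝ → ℝ} (hu : IsCylRegular u)
    (h : ∀ σ, ∀ t ∈ Ioo (-1 : ℝ) 1, 0 ≤ cylLaplacian lam u σ t) {M : ℝ}
    (h1 : ∀ σ, u σ 1 ≤ M) (h2 : ∀ σ, u σ (-1) ≤ M) (σ : Sph N) {t : ℝ}
    (ht : t ∈ Icc (-1 : ℝ) 1) : u σ t ≤ M := by
  have hb := isCylRegular_barrier hN hlam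
  -- The barrier has `Δ_{g_λ}` equal to `-1` and vanishes at `t = ±1`. Subtracting `ε` times it
  -- makes the Laplacian strictly positive without changing the boundary values, and this excludes
  -- an interior maximum.
  have key (ε : ℝ) (hε : 0 < ε) : u σ t + (-ε) * barrier N lam t ≤ M := by
    set v : Sph N → ℝ → ℝ := fun σ t => u σ t + (-ε) * barrier N lam t with hv
    have hreg : IsCylRegular v := hu.add (hb.const_mul (-ε))
    have hlap (σ : Sph N) (t : ℝ) (ht : t ∈ Ioo (-1 : ℝ) 1) : 0 < cylLaplacian lam v σ t := by
      rw [hv, cylLaplacian_add hlam hu (hb.const_mul (-ε)) σ ht, cylLaplacian_const_mul hlam hb _ σ ht,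
        cylLaplacian_barrier hlam σ ht]
      have := h σ t ht
      linarith
    have hne : ((univ : Set (Sph N)) ×ˢ Icc (-1 : ℝ) 1).Nonempty := ⟨(σ, t), mem_univ _, ht⟩
    obtain ⟨⟨σ₀, t₀⟩, hmem, hmax⟩ :=
      (isCompact_univ.prod isCompact_Icc).exists_isMaxOn hne hreg.continuousOn
    have hle (τ : Sph N) (s : ℝ) (hs : s ∈ Icc (-1 : ℝ) 1) : v τ s ≤ v σ₀ t₀ :=
      hmax (show (τ, s) ∈ (univ : Set (Sph N)) ×ˢ Icc (-1 : ℝ) 1 from ⟨mem_univ _, hs⟩)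
    refine (hle σ t ht).trans ?_
    have ht₀ : t₀ ∈ Icc (-1 : ℝ) 1 := hmem.2
    rcases ht₀.1.eq_or_lt with he | hlt
    · rw [← he]
      simpa [hv, barrier_neg_one] using h2 σ₀
    rcases ht₀.2.eq_or_lt with he | hgt
    · rw [he]
      simpa [hv, barrier_one] using h1 σ₀
    exfalso
    have hI : t₀ ∈ Ioo (-1 : ℝ) 1 := ⟨hlt, hgt⟩
    have hpos := hlap σ₀ t₀ hI
    have hloc : IsLocalMax (v σ₀) t₀ := by
      filter_upwards [isOpen_Ioo.mem_nhds hI] with s hs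
      exact hle σ₀ s (Ioo_subset_Icc_self hs)
    rw [cylLaplacian_eq hlam hI (hreg.differentiableAt_deriv σ₀ hI), hloc.deriv_eq_zero] at hpos
    have hA := deriv_deriv_nonpos_of_isLocalMax hloc (hreg.differentiableAt σ₀ hI).continuousAt
    have hB := sphLaplacian_nonpos_of_forall_le (hreg.isC2 t₀ hI) fun τ => hle τ t₀ ht₀
    have hl := hlam.1
    have hC : 1 / lam ^ 2 * (deriv (deriv (v σ₀)) t₀ -
        (N - 1 : ℕ) * lam * Real.tan (lam * t₀) * 0) ≤ 0 := by
      rw [mul_zero, sub_zero]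
      exact mul_nonpos_of_nonneg_of_nonpos (by positivity) hA
    have hD : 1 / Real.cos (lam * t₀) ^ 2 * sphLaplacian (fun τ => v τ t₀) σ₀ ≤ 0 :=
      mul_nonpos_of_nonneg_of_nonpos (by positivity) hB
    linarith
  refine le_of_forall_pos_le_add fun δ hδ => ?_
  have hb0 : 0 < |barrier N lam t| + 1 := by positivity
  have h3 := key (δ / (|barrier N lam t| + 1)) (by positivity)
  have h4 : δ / (|barrier N lam t| + 1) * barrier N lam t ≤ δ := by
    rw [div_mul_eq_mul_div, div_le_iff₀ hb0]
    have := le_abs_self (barrier N lam t)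
    nlinarith
  linarith

theorem abs_le_of_cylLaplacian_eq_zero {N : ℕ} (hN : 2 ≤ N) {lam : ℝ}
    (hlam : lam ∈ Ioo 0 (Real.pi / 2)) {u : Sph N → ℝ → ℝ} (hu : IsCylRegular u)
    (h : ∀ σ, ∀ t ∈ Ioo (-1 : ℝ) 1, cylLaplacian lam u σ t = 0) {M : ℝ}
    (h1 : ∀ σ, |u σ 1| ≤ M) (h2 : ∀ σ, |u σ (-1)| ≤ M) (σ : Sph N) {t : ℝ}
    (ht : t ∈ Icc (-1 : ℝ) 1) : |u σ t| ≤ M := by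
  rw [abs_le']
  constructor
  · exact le_of_cylLaplacian_nonneg hN hlam hu (fun σ t ht => (h σ t ht).ge)
      (fun σ => (le_abs_self _).trans (h1 σ)) (fun σ => (le_abs_self _).trans (h2 σ)) σ ht
  · have := le_of_cylLaplacian_nonneg hN hlam (hu.const_mul (-1)) (fun σ t ht => by
      rw [cylLaplacian_const_mul hlam hu _ σ ht, h σ t ht, mul_zero])
      (fun σ => by simpa using (neg_le_abs _).trans (h1 σ))
      (fun σ => by simpa using (neg_le_abs _).trans (h2 σ)) σ ht
    simpa using this

/-- Joint regularity restricts to the slices with one variable fixed, and regularity on slices is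
all that the maximum principle needs. -/
theorem IsDirichletSolution.isCylRegular {N : ℕ} {lam : ℝ} {ω : Sph N → ℝ} {ψ : Sph N → ℝ → ℝ}
    (h : IsDirichletSolution lam ω ψ) : IsCylRegular ψ := by
  refine ⟨h.continuousOn, fun t ht => ?_, fun σ => ?_⟩
  · exact h.contDiffOn.comp (f := fun x : Euc N => (x, t)) (by fun_prop) fun x hx => ⟨hx, ht⟩
  · have := h.contDiffOn.comp (s := Ioo (-1) 1) (f := fun t : ℝ => ((σ : Euc N), t)) (by fun_prop)
      fun t ht => ⟨coe_ne_zero σ, ht⟩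
    refine this.congr fun t _ => ?_
    simp [homExt_coe]

/-- A solution of the Dirichlet problem differs from its boundary values by at most a multiple of
the barrier. -/
theorem abs_sub_le_barrier {N : ℕ} (hN : 2 ≤ N) {lam : ℝ} (hlam : lam ∈ Ioo 0 (Real.pi / 2))
    {u : Sph N → ℝ → ℝ} (hu : IsCylRegular u)
    (h : ∀ σ, ∀ t ∈ Ioo (-1 : ℝ) 1, cylLaplacian lam u σ t = 0) {f : Sph N → ℝ} (hf : IsC2 f)
    (h1 : ∀ σ, u σ 1 = f σ) (h2 : ∀ σ, u σ (-1) = f σ) {K : ℝ}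
    (hK : ∀ σ, |sphLaplacian f σ| ≤ K) (σ : Sph N) {t : ℝ} (ht : t ∈ Icc (-1 : ℝ) 1) :
    |u σ t - f σ| ≤ K / Real.cos lam ^ 2 * barrier N lam t := by
  have hb := isCylRegular_barrier (N := N) hN hlam
  have hF := isCylRegular_of_isC2 hf
  have hcl := cos_pos_of_lt (x := lam) ⟨by linarith [hlam.1, Real.pi_pos], hlam.2⟩
  have hcos (t : ℝ) (ht : t ∈ Ioo (-1 : ℝ) 1) (x : ℝ) (hx : |x| ≤ K) :
      |1 / Real.cos (lam * t) ^ 2 * x| ≤ K / Real.cos lam ^ 2 := by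
    have hmem := mul_mem_Ioo hlam (Ioo_subset_Icc_self ht)
    have hct := cos_pos_of_lt hmem
    have h3 : Real.cos lam ≤ Real.cos (lam * t) := by
      rw [← Real.cos_abs (lam * t)]
      refine Real.cos_le_cos_of_nonneg_of_le_pi (abs_nonneg _) (by linarith [hlam.2, Real.pi_pos]) ?_
      rw [abs_mul, abs_of_pos hlam.1]
      exact mul_le_of_le_one_right hlam.1.le (abs_le.mpr ⟨ht.1.le, ht.2.le⟩)
    rw [abs_mul, abs_of_pos (by positivity), one_div, inv_mul_eq_div]
    exact div_le_div₀ ((abs_nonneg _).trans hx) hx (by positivity) (by gcongr)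
  -- The cases `c = ±1` give the two inequalities. Since `cos λ ≤ cos(λt)`, the term `Δf/cos²(λt)`
  -- is at most `K/cos² λ` in size, and the multiple of the barrier compensates for it.
  have key (c : ℝ) (hc : |c| = 1) :
      c * u σ t + ((-c) * f σ + (-(K / Real.cos lam ^ 2)) * barrier N lam t) ≤ 0 := by
    refine le_of_cylLaplacian_nonneg hN hlam (u := fun σ t =>
      c * u σ t + ((-c) * f σ + (-(K / Real.cos lam ^ 2)) * barrier N lam t))
      ((hu.const_mul c).add ((hF.const_mul (-c)).add (hb.const_mul _))) (fun σ t ht => ?_)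
      (fun σ => ?_) (fun σ => ?_) σ ht
    · rw [cylLaplacian_add hlam (hu.const_mul c) ((hF.const_mul (-c)).add (hb.const_mul _)) σ ht,
        cylLaplacian_add hlam (hF.const_mul (-c)) (hb.const_mul _) σ ht,
        cylLaplacian_const_mul hlam hu _ σ ht, cylLaplacian_const_mul hlam hF _ σ ht,
        cylLaplacian_const_mul hlam hb _ σ ht, cylLaplacian_barrier hlam σ ht, h σ t ht,
        cylLaplacian_sph]
      have h3 := hcos t ht _ (hK σ)
      have h4 : |c * (1 / Real.cos (lam * t) ^ 2 * sphLaplacian f σ)| ≤ K / Real.cos lam ^ 2 := by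
        rwa [abs_mul, hc, one_mul]
      have := (le_abs_self _).trans h4
      linarith
    · rw [h1, barrier_one]
      apply le_of_eq
      ring
    · rw [h2, barrier_neg_one]
      apply le_of_eq
      ring
  have k1 := key 1 (by simp)
  have k2 := key (-1) (by simp)
  rw [abs_le]
  constructor <;> linarith

theorem IsDirichletSolution.eqOn {N : ℕ} (hN : 2 ≤ N) {lam : ℝ} (hlam : lam ∈ Ioo 0 (Real.pi / 2))
    {ω : Sph N → ℝ} {ψ φ : Sph N → ℝ → ℝ} (h : IsDirichletSolution lam ω ψ)
    (h' : IsDirichletSolution lam ω φ) (σ : Sph N) : EqOn (ψ σ) (φ σ) (Icc (-1) 1) := by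
  intro t ht
  have hr := h.isCylRegular
  have hr' := h'.isCylRegular
  have key := abs_le_of_cylLaplacian_eq_zero hN hlam (hr.sub hr') (fun σ t ht => by
    rw [cylLaplacian_add hlam hr (hr'.const_mul (-1)) σ ht, cylLaplacian_const_mul hlam hr' _ σ ht,
      h.harmonic σ t ht, h'.harmonic σ t ht]; ring) (M := 0)
    (fun σ => by simp [(h.boundary σ).1, (h'.boundary σ).1])
    (fun σ => by simp [(h.boundary σ).2, (h'.boundary σ).2]) σ ht
  have := abs_nonpos_iff.mp key
  linarith

/-! ### Rotation invariance and pointwise bounds for spherical harmonics -/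

/-- The action of a linear isometry on the sphere. -/
def sphRot {N : ℕ} (R : Euc N ≃ₗᵢ[ℝ] Euc N) (σ : Sph N) : Sph N :=
  ⟨R σ, by simp⟩

theorem homExt_comp_sphRot {N : ℕ} (R : Euc N ≃ₗᵢ[ℝ] Euc N) (g : Sph N → ℝ) (x : Euc N) :
    homExt (fun σ => g (sphRot R σ)) x = homExt g (R x) := by
  by_cases h : x = 0
  · simp [h, homExt]
  · have h' : R x ≠ 0 := by simpa using h
    rw [homExt_of_ne _ h, homExt_of_ne _ h']
    congr 1
    ext1
    simp [sphRot, toSph]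

/-- Lebesgue measure is invariant under isometries. Multiplying by one fixed radial profile and
passing to polar coordinates transfers the invariance to the sphere, because the radial integral is
nonzero. -/
theorem integral_comp_sphRot {N : ℕ} [Fact (2 ≤ N)] (R : Euc N ≃ₗᵢ[ℝ] Euc N) (g : Sph N → ℝ) :
    ∫ σ, g (sphRot R σ) ∂(sphMeasure N) = ∫ σ, g σ ∂(sphMeasure N) := by
  have h1 := integral_radial_mul (N := N) (fun r => annulusBump (r ^ 2) * r⁻¹ ^ 2)
    (fun σ => g (sphRot R σ))
  have h2 := integral_radial_mul (N := N) (fun r => annulusBump (r ^ 2) * r⁻¹ ^ 2) g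
  have h3 := (R.measurePreserving).integral_comp R.toHomeomorph.measurableEmbedding
    (fun x => annulusBump (‖x‖ ^ 2) * ‖x‖⁻¹ ^ 2 * homExt g x)
  simp only [homExt_comp_sphRot] at h1
  simp only [LinearIsometryEquiv.norm_map] at h3
  rw [h3, h2] at h1
  exact (mul_left_cancel₀ integral_bump_ne_zero h1).symm

/-- The Laplacian can be computed in any orthonormal basis, in particular in the image of the
standard one under `R`. -/
theorem laplacian_comp_isometry {N : ℕ} (R : Euc N ≃ₗᵢ[ℝ] Euc N) {f : Euc N → ℝ}
    (hf : ContDiff ℝ 2 f) (x : Euc N) :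
    Laplacian.laplacian (fun y => f (R y)) x = Laplacian.laplacian f (R x) := by
  rw [InnerProductSpace.laplacian_eq_iteratedFDeriv_orthonormalBasis f
      ((EuclideanSpace.basisFun (Fin N) ℝ).map R),
    InnerProductSpace.laplacian_eq_iteratedFDeriv_orthonormalBasis (fun y => f (R y))
      (EuclideanSpace.basisFun (Fin N) ℝ)]
  refine Finset.sum_congr rfl fun i _ => ?_
  have := (R.toContinuousLinearEquiv : Euc N →L[ℝ] Euc N).iteratedFDeriv_comp_right hf x
    (i := 2) le_rfl
  have e : (fun y => f (R y)) = f ∘ (R.toContinuousLinearEquiv : Euc N →L[ℝ] Euc N) := rfl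
  rw [e, this, ContinuousMultilinearMap.compContinuousLinearMap_apply]
  congr 1
  ext j
  fin_cases j <;> simp

/-- The polynomial `x ↦ p (R x)`. -/
def rotPoly {N : ℕ} (R : Euc N ≃ₗᵢ[ℝ] Euc N) (p : MvPolynomial (Fin N) ℝ) :
    MvPolynomial (Fin N) ℝ :=
  MvPolynomial.aeval
    (fun i => ∑ j, MvPolynomial.C ((R (stdVec j)) i) * MvPolynomial.X j) p

theorem evalE_rotPoly {N : ℕ} (R : Euc N ≃ₗᵢ[ℝ] Euc N) (p : MvPolynomial (Fin N) ℝ) (x : Euc N) :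
    evalE (rotPoly R p) x = evalE p (R x) := by
  unfold evalE rotPoly
  rw [← MvPolynomial.coe_aeval_eq_eval, ← MvPolynomial.coe_aeval_eq_eval]
  simp only [RingHom.coe_coe]
  rw [← AlgHom.comp_apply, MvPolynomial.comp_aeval]
  congr 2
  ext i
  simp only [map_sum, map_mul, MvPolynomial.aeval_X, MvPolynomial.aeval_C]
  have e : x = ∑ j, x j • stdVec j := by
    conv_lhs => rw [← (EuclideanSpace.basisFun (Fin N) ℝ).sum_repr x]
    simp [stdVec]
  conv_rhs => rw [e]
  simp [mul_comm]

theorem rotPoly_mem {N l : ℕ} (R : Euc N ≃ₗᵢ[ℝ] Euc N) {p : MvPolynomial (Fin N) ℝ}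
    (hp : p ∈ harmonicPoly N l) : rotPoly R p ∈ harmonicPoly N l := by
  refine ⟨?_, ?_⟩
  · have h1 : p.IsHomogeneous l := hp.1
    have := h1.aeval (fun i => ∑ j, MvPolynomial.C ((R (stdVec j)) i) * MvPolynomial.X j)
      (n := 1) fun i => MvPolynomial.IsHomogeneous.sum _ _ _ fun j _ => by
        simpa using (MvPolynomial.isHomogeneous_C (Fin N) ((R (stdVec j)) i)).mul
          (MvPolynomial.isHomogeneous_X ℝ j)
    simpa [rotPoly] using this
  · have h2 : polyLaplacian N p = 0 := hp.2
    refine LinearMap.mem_ker.mpr (evalE_injective (funext fun x => ?_))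
    rw [← laplacian_evalE, funext (evalE_rotPoly R p),
      laplacian_comp_isometry R (contDiff_evalE p), laplacian_evalE, h2]
    simp [evalE]

/-- The reflection in the hyperplane orthogonal to `σ - τ` exchanges two vectors of equal length. -/
theorem exists_isometry_map {N : ℕ} (σ τ : Sph N) : ∃ R : Euc N ≃ₗᵢ[ℝ] Euc N, sphRot R σ = τ := by
  refine ⟨Submodule.reflection (ℝ ∙ ((σ : Euc N) - τ))ᗮ, ?_⟩
  ext1
  exact Submodule.reflection_sub (by simp)

theorem inner_rotPoly {N : ℕ} [Fact (2 ≤ N)] (R : Euc N ≃ₗᵢ[ℝ] Euc N)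
    (p q : MvPolynomial (Fin N) ℝ) :
    inner ℝ (toLtwo (polyRestrict N (rotPoly R p))) (toLtwo (polyRestrict N (rotPoly R q))) =
      inner ℝ (toLtwo (polyRestrict N p)) (toLtwo (polyRestrict N q)) := by
  simp only [inner_toLtwo, polyRestrict_apply, evalE_rotPoly]
  exact integral_comp_sphRot R fun σ => evalE p σ * evalE q σ

/-- An orthonormal basis of the spherical harmonics of degree `l`, as polynomials. -/
theorem exists_basis_sphHarm (N l : ℕ) :
    ∃ q : Fin (Module.finrank ℝ (sphHarm N l)) → MvPolynomial (Fin N) ℝ,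
      (∀ a, q a ∈ harmonicPoly N l) ∧
      (∀ a, ∫ σ, evalE (q a) (σ : Euc N) ^ 2 ∂(sphMeasure N) = 1) ∧
      ∀ p ∈ harmonicPoly N l, ∀ σ : Sph N, evalE p (σ : Euc N) =
        ∑ a, inner ℝ (toLtwo (polyRestrict N (q a))) (toLtwo (polyRestrict N p)) *
          evalE (q a) (σ : Euc N) := by
  have h (a) := mem_sphHarm.mp (stdOrthonormalBasis ℝ (sphHarm N l) a).2
  choose q hq hqe using h
  refine ⟨q, hq, fun a => ?_, fun p hp σ => ?_⟩
  · have h1 := (stdOrthonormalBasis ℝ (sphHarm N l)).orthonormal.1 a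
    rw [← Submodule.norm_coe, ← hqe] at h1
    have h2 := inner_toLtwo (polyRestrict N (q a)) (polyRestrict N (q a))
    rw [real_inner_self_eq_norm_sq, h1] at h2
    simp only [polyRestrict_apply, ← sq] at h2
    rw [← h2]; norm_num
  · have hp' := mem_sphHarm.mpr ⟨p, hp, rfl⟩
    have h1 := congrArg Subtype.val
      ((stdOrthonormalBasis ℝ (sphHarm N l)).sum_repr' ⟨_, hp'⟩)
    simp only [Submodule.coe_sum, Submodule.coe_smul, Submodule.coe_inner, ← hqe, ← map_smul,
      ← map_sum] at h1
    have h2 := congrArg (fun f => f σ) (toLtwo_injective h1)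
    simp only [polyRestrict_apply] at h2
    rw [← h2]
    simp [evalE, MvPolynomial.smul_eval]

/-- A form of degree `l` is determined by its coefficients, whose exponents are at most `l`. The
count is crude, but only polynomial growth in `l` is needed. -/
theorem finrank_sphHarm_le (N l : ℕ) : Module.finrank ℝ (sphHarm N l) ≤ (l + 1) ^ N := by
  have h1 : (MvPolynomial.homogeneousSubmodule (Fin N) ℝ l).FG :=
    MvPolynomial.homogeneousSubmodule_fg (Fin N) ℝ l
  have : FiniteDimensional ℝ (MvPolynomial.homogeneousSubmodule (Fin N) ℝ l) :=
    Module.Finite.iff_fg.mpr h1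
  have : FiniteDimensional ℝ (harmonicPoly N l) :=
    Submodule.finiteDimensional_of_le inf_le_left
  refine (Submodule.finrank_map_le _ (harmonicPoly N l)).trans ?_
  let T : harmonicPoly N l →ₗ[ℝ] ((Fin N → Fin (l + 1)) → ℝ) :=
    LinearMap.pi (fun e => MvPolynomial.lcoeff ℝ (Finsupp.equivFunOnFinite.symm fun i => (e i : ℕ)))
      ∘ₗ (harmonicPoly N l).subtype
  have hT : Function.Injective T := by
    rw [← LinearMap.ker_eq_bot, LinearMap.ker_eq_bot']
    rintro ⟨p, hp⟩ h
    ext d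
    by_contra hd
    simp only [Submodule.coe_zero, MvPolynomial.coeff_zero] at hd
    have hdeg := (hp.1 : p.IsHomogeneous l) hd
    have hle (i : Fin N) : d i < l + 1 := by
      have := Finsupp.le_degree i d
      rw [Finsupp.degree_eq_weight_one] at this
      change d i ≤ Finsupp.weight 1 d at this
      omega
    refine hd ?_
    have := congrFun h fun i => ⟨d i, hle i⟩
    simpa [T] using this
  have := LinearMap.finrank_le_finrank_of_injective hT
  simpa using this

/-- The constant in the pointwise bound for spherical harmonics of degree `l`. -/
def supConst (N l : ℕ) : ℝ := √(((l : ℝ) + 1) ^ N / (sphMeasure N).real univ)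

theorem sphMeasure_real_univ_pos {N : ℕ} [Fact (2 ≤ N)] : 0 < (sphMeasure N).real univ := by
  refine ENNReal.toReal_pos ?_ (measure_ne_top _ _)
  rw [Ne, Measure.measure_univ_eq_zero]
  exact Measure.toSphere_ne_zero _

/-- Evaluation at `σ` is the scalar product with the reproducing kernel `k σ`, and `‖k σ‖² = K σ`.
By rotation invariance `K` is constant, and its integral is the dimension of `V_l`; Cauchy-Schwarz
concludes. -/
theorem abs_evalE_le {N l : ℕ} [Fact (2 ≤ N)] {p : MvPolynomial (Fin N) ℝ}
    (hp : p ∈ harmonicPoly N l) (σ : Sph N) :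
    |evalE p (σ : Euc N)| ≤ supConst N l * ‖toLtwo (polyRestrict N p)‖ := by
  obtain ⟨q, hq, hq1, hrep⟩ := exists_basis_sphHarm N l
  set K : Sph N → ℝ := fun σ => ∑ a, evalE (q a) (σ : Euc N) ^ 2 with hK
  let k : Sph N → MvPolynomial (Fin N) ℝ := fun σ => ∑ a, evalE (q a) (σ : Euc N) • q a
  have hk (σ) : k σ ∈ harmonicPoly N l :=
    Submodule.sum_mem _ fun a _ => Submodule.smul_mem _ _ (hq a)
  have hkp (σ : Sph N) (p) (hp : p ∈ harmonicPoly N l) : evalE p (σ : Euc N) =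
      inner ℝ (toLtwo (polyRestrict N (k σ))) (toLtwo (polyRestrict N p)) := by
    rw [hrep p hp σ]
    simp only [k, map_sum, map_smul, sum_inner, real_inner_smul_left, mul_comm]
  have hkk (σ : Sph N) : evalE (k σ) (σ : Euc N) = K σ := by
    simp [k, hK, evalE, MvPolynomial.smul_eval, sq]
  have hnorm (σ : Sph N) : ‖toLtwo (polyRestrict N (k σ))‖ ^ 2 = K σ := by
    rw [← real_inner_self_eq_norm_sq, ← hkp σ _ (hk σ), hkk]
  have hbound (σ : Sph N) (p) (hp : p ∈ harmonicPoly N l) :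
      evalE p (σ : Euc N) ^ 2 ≤ K σ * ‖toLtwo (polyRestrict N p)‖ ^ 2 := by
    rw [← hnorm, ← mul_pow, hkp σ p hp, sq_le_sq]
    refine (abs_real_inner_le_norm _ _).trans (le_abs_self _)
  have hK0 (σ) : 0 ≤ K σ := Finset.sum_nonneg fun a _ => sq_nonneg _
  -- The kernel at `σ`, rotated so that `τ` takes the place of `σ`, has the same norm. The bound at
  -- `τ` then reads `K(σ)² ≤ K(τ) K(σ)`.
  have hKle (σ τ : Sph N) : K σ ≤ K τ := by
    obtain ⟨R, hR⟩ := exists_isometry_map τ σ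
    have h1 := hbound τ _ (rotPoly_mem R (hk σ))
    have h2 : R (τ : Euc N) = σ := congrArg Subtype.val hR
    rw [evalE_rotPoly, h2, hkk, ← real_inner_self_eq_norm_sq, inner_rotPoly,
      real_inner_self_eq_norm_sq, hnorm] at h1
    rcases (hK0 σ).eq_or_lt with h | h
    · rw [← h]; exact hK0 τ
    · nlinarith
  have hint : ∫ τ, K τ ∂(sphMeasure N) = Module.finrank ℝ (sphHarm N l) := by
    rw [hK, integral_finsetSum]
    · simp [hq1]
    · intro a _
      exact integrable_of_continuous
        (((contDiff_evalE (n := 0) (q a)).continuous.comp continuous_subtype_val).pow 2)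
  have hconst : ∫ τ, K τ ∂(sphMeasure N) = (sphMeasure N).real univ * K σ := by
    rw [← smul_eq_mul, ← integral_const]
    exact integral_congr_ae (Filter.Eventually.of_forall fun τ =>
      le_antisymm (hKle τ σ) (hKle σ τ))
  have hKσ : K σ ≤ ((l : ℝ) + 1) ^ N / (sphMeasure N).real univ := by
    rw [le_div_iff₀ sphMeasure_real_univ_pos, mul_comm, ← hconst, hint]
    exact_mod_cast finrank_sphHarm_le N l
  rw [← Real.sqrt_sq_eq_abs, supConst, ← Real.sqrt_sq (norm_nonneg (toLtwo _)),
    ← Real.sqrt_mul (by positivity)]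
  exact Real.sqrt_le_sqrt ((hbound σ p hp).trans (mul_le_mul_of_nonneg_right hKσ (sq_nonneg _)))

/-! ### Derivatives of harmonic polynomials and their growth -/

theorem pderiv_pderiv_comm {N : ℕ} (i j : Fin N) (p : MvPolynomial (Fin N) ℝ) :
    MvPolynomial.pderiv i (MvPolynomial.pderiv j p) =
      MvPolynomial.pderiv j (MvPolynomial.pderiv i p) := by
  have h : ⁅(MvPolynomial.pderiv i : Derivation ℝ (MvPolynomial (Fin N) ℝ) (MvPolynomial (Fin N) ℝ)),
      (MvPolynomial.pderiv j :
        Derivation ℝ (MvPolynomial (Fin N) ℝ) (MvPolynomial (Fin N) ℝ))⁆ = 0 := by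
    refine MvPolynomial.derivation_ext fun k => ?_
    rw [Derivation.commutator_apply, MvPolynomial.pderiv_X, MvPolynomial.pderiv_X]
    by_cases h1 : j = k <;> by_cases h2 : i = k <;> simp [h1, h2]
  have := DFunLike.congr_fun h p
  rw [Derivation.commutator_apply] at this
  exact sub_eq_zero.mp this

theorem pderiv_mem_harmonicPoly {N l : ℕ} {p : MvPolynomial (Fin N) ℝ}
    (hp : p ∈ harmonicPoly N l) (i : Fin N) :
    MvPolynomial.pderiv i p ∈ harmonicPoly N (l - 1) := by
  refine ⟨MvPolynomial.IsHomogeneous.pderiv hp.1, LinearMap.mem_ker.mpr ?_⟩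
  have h2 : polyLaplacian N p = 0 := hp.2
  have h3 : polyLaplacian N (MvPolynomial.pderiv i p) =
      MvPolynomial.pderiv i (polyLaplacian N p) := by
    simp only [polyLaplacian, LinearMap.sum_apply, LinearMap.comp_apply, map_sum,
      Derivation.coeFn_coe]
    refine Finset.sum_congr rfl fun j _ => ?_
    rw [pderiv_pderiv_comm j i, pderiv_pderiv_comm j i]
  rw [h3, h2, map_zero]

/-- The gradient of a spherical harmonic, in `L²`. -/
theorem sum_norm_sq_pderiv {N l : ℕ} [Fact (2 ≤ N)] {p : MvPolynomial (Fin N) ℝ}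
    (hp : p ∈ harmonicPoly N l) :
    ∑ i, ‖toLtwo (polyRestrict N (MvPolynomial.pderiv i p))‖ ^ 2 =
      l * (2 * l + (N : ℝ) - 2) * ‖toLtwo (polyRestrict N p)‖ ^ 2 := by
  have h1 : p.IsHomogeneous l := hp.1
  have h2 : polyLaplacian N p = 0 := hp.2
  -- `p²` is homogeneous of degree `2l`, and its Euclidean Laplacian is `2 |∇p|²` because `p` is
  -- harmonic.
  have hL (σ : Sph N) : sphLaplacian (polyRestrict N (p * p)) σ =
      2 * ∑ i, evalE (MvPolynomial.pderiv i p) (σ : Euc N) ^ 2 -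
        2 * (l * (2 * l + (N : ℝ) - 2)) * evalE p (σ : Euc N) ^ 2 := by
    rw [sphLaplacian_polyRestrict (h1.mul h1), ← laplacian_evalE, funext (evalE_mul p p),
      laplacian_mul (contDiff_evalE p).contDiffAt (contDiff_evalE p).contDiffAt, laplacian_evalE,
      h2]
    simp only [pd_evalE]
    have : evalE (0 : MvPolynomial (Fin N) ℝ) (σ : Euc N) = 0 := by simp [evalE]
    rw [this]
    simp only [sq]
    push_cast; ring
  have hc (q : MvPolynomial (Fin N) ℝ) :
      Integrable (fun σ : Sph N => evalE q (σ : Euc N) ^ 2) (sphMeasure N) :=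
    integrable_of_continuous
      (((contDiff_evalE (n := 0) q).continuous.comp continuous_subtype_val).pow 2)
  have hn (q : MvPolynomial (Fin N) ℝ) : ‖toLtwo (polyRestrict N q)‖ ^ 2 =
      ∫ σ : Sph N, evalE q (σ : Euc N) ^ 2 ∂(sphMeasure N) := by
    rw [← real_inner_self_eq_norm_sq, inner_toLtwo]
    simp only [polyRestrict_apply, sq]
  -- Green's identity against the constant `1`: the spherical Laplacian of `p²` has mean zero.
  have h0 := integral_sphLaplacian_mul (isC2_polyRestrict (h1.mul h1)) (isC2_const (N := N) 1)
  simp only [hL, sphLaplacian_const, mul_one, mul_zero, integral_zero] at h0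
  rw [integral_sub ((integrable_finsetSum _ fun i _ => hc _).const_mul _) ((hc p).const_mul _),
    integral_const_mul, integral_const_mul, integral_finsetSum _ fun i _ => hc _] at h0
  simp only [hn]
  linarith

theorem norm_pderiv_le {N l : ℕ} [Fact (2 ≤ N)] {p : MvPolynomial (Fin N) ℝ}
    (hp : p ∈ harmonicPoly N l) (i : Fin N) :
    ‖toLtwo (polyRestrict N (MvPolynomial.pderiv i p))‖ ≤
      ((N : ℝ) + 2) * (l + 1) * ‖toLtwo (polyRestrict N p)‖ := by
  refine abs_le_of_sq_le_sq' ?_ (by positivity) |>.2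
  calc _ ≤ ∑ i, ‖toLtwo (polyRestrict N (MvPolynomial.pderiv i p))‖ ^ 2 :=
        Finset.single_le_sum (f := fun i => ‖toLtwo (polyRestrict N (MvPolynomial.pderiv i p))‖ ^ 2)
          (fun _ _ => sq_nonneg _) (Finset.mem_univ i)
    _ = _ := sum_norm_sq_pderiv hp
    _ ≤ _ := by
      rw [mul_pow]
      refine mul_le_mul_of_nonneg_right ?_ (sq_nonneg _)
      have hl : (0 : ℝ) ≤ l := l.cast_nonneg
      have hN : (0 : ℝ) ≤ N := N.cast_nonneg
      have := mul_nonneg hl hN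
      nlinarith [mul_nonneg this hN, mul_nonneg this hl, mul_nonneg (mul_nonneg this hN) hl]

/-- A sequence of homogeneous harmonic polynomials, the `l`-th one of degree at most `l`, whose
norms in `L²(S^{N-1})` grow at most polynomially. -/
def IsPolyFamily {N : ℕ} (q : ℕ → MvPolynomial (Fin N) ℝ) : Prop :=
  ∃ (C : ℝ) (m : ℕ), 0 ≤ C ∧ ∀ l, ∃ d ≤ l, q l ∈ harmonicPoly N d ∧
    ‖toLtwo (polyRestrict N (q l))‖ ≤ C * ((l : ℝ) + 1) ^ m

/-- A derivative costs one power of `l + 1`. It lowers the degree while the index `l`, which selects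
the time factor, stays; this is why degrees below the index are admitted. -/
theorem IsPolyFamily.pderiv {N : ℕ} [Fact (2 ≤ N)] {q : ℕ → MvPolynomial (Fin N) ℝ}
    (hq : IsPolyFamily q) (i : Fin N) : IsPolyFamily fun l => MvPolynomial.pderiv i (q l) := by
  obtain ⟨C, m, hC, h⟩ := hq
  refine ⟨((N : ℝ) + 2) * C, m + 1, by positivity, fun l => ?_⟩
  obtain ⟨d, hd, hm, hn⟩ := h l
  refine ⟨d - 1, by omega, pderiv_mem_harmonicPoly hm i, (norm_pderiv_le hm i).trans ?_⟩
  have hd' : (d : ℝ) ≤ l := by exact_mod_cast hd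
  calc _ ≤ ((N : ℝ) + 2) * (l + 1) * (C * ((l : ℝ) + 1) ^ m) := by gcongr
    _ = _ := by ring

theorem exists_eq_norm_smul {N : ℕ} [Fact (2 ≤ N)] (x : Euc N) :
    ∃ σ : Sph N, x = ‖x‖ • (σ : Euc N) := by
  by_cases h : x = 0
  · have : Nonempty (Sph N) := (NormedSpace.sphere_nonempty.mpr zero_le_one).to_subtype
    exact ⟨Classical.arbitrary _, by simp [h]⟩
  · exact ⟨toSph x h, by simp [toSph, smul_smul, mul_inv_cancel₀ (norm_ne_zero_iff.mpr h)]⟩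

theorem IsPolyFamily.exists_bound {N : ℕ} [Fact (2 ≤ N)] {q : ℕ → MvPolynomial (Fin N) ℝ}
    (hq : IsPolyFamily q) : ∃ (C : ℝ) (m : ℕ), 0 ≤ C ∧ ∀ (l : ℕ) (R : ℝ), 1 ≤ R → ∀ x : Euc N,
      ‖x‖ ≤ R → |evalE (q l) x| ≤ C * ((l : ℝ) + 1) ^ m * R ^ l := by
  obtain ⟨C, m, hC, h⟩ := hq
  refine ⟨supConst N 0 * C, N + m, by unfold supConst; positivity, fun l R hR x hx => ?_⟩
  obtain ⟨d, hd, hm, hn⟩ := h l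
  obtain ⟨σ, hσ⟩ := exists_eq_norm_smul x
  have hd' : (d : ℝ) ≤ l := by exact_mod_cast hd
  -- `supConst N 0` is the inverse square root of the area of the sphere, so it carries the
  -- dependence on the measure alone.
  have h1 : supConst N d ≤ supConst N 0 * ((l : ℝ) + 1) ^ N := by
    unfold supConst
    rw [← Real.sqrt_sq (by positivity : (0 : ℝ) ≤ ((l : ℝ) + 1) ^ N),
      ← Real.sqrt_mul (by positivity)]
    refine Real.sqrt_le_sqrt ?_
    have h2 : ((d : ℝ) + 1) ^ N ≤ (((l : ℝ) + 1) ^ N) ^ 2 := by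
      calc ((d : ℝ) + 1) ^ N ≤ ((l : ℝ) + 1) ^ N := by gcongr
        _ ≤ _ := le_self_pow₀ (one_le_pow₀ (by simp)) (by norm_num)
    rw [Nat.cast_zero, zero_add, one_pow, one_div, div_eq_inv_mul]
    have := inv_nonneg.mpr (sphMeasure_real_univ_pos (N := N)).le
    gcongr
  rw [hσ, evalE_smul_arg hm.1, abs_mul, abs_of_nonneg (by positivity), mul_comm]
  calc _ ≤ (supConst N 0 * ((l : ℝ) + 1) ^ N) * (C * ((l : ℝ) + 1) ^ m) * R ^ l := by
        refine mul_le_mul ?_ ?_ (by positivity) (by unfold supConst; positivity)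
        · refine (abs_evalE_le hm σ).trans ?_
          refine mul_le_mul h1 hn (norm_nonneg _) (by unfold supConst; positivity)
        · exact (pow_le_pow_left₀ (norm_nonneg _) hx d).trans (pow_le_pow_right₀ hR hd)
    _ = _ := by ring

/-! ### The time factors of the separated solutions -/

/-- The even function `a_l` on `[-1, 1]`, equal to `1` at `±1`, for which
`Y_l(σ) a_l(t)` is `Δ_{g_lam}`-harmonic for each spherical harmonic `Y_l` of degree `l`, together
with its first two derivatives. -/
def amp (N : ℕ) (lam : ℝ) : ℕ → ℕ → ℝ → ℝ
  | 0, l, t => radial N l (lam * t) / radial N l lam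
  | 1, l, t => lam * (radial' N l (lam * t) / radial N l lam)
  -- The second derivative is read off from the radial equation.
  | _ + 2, l, t =>
    ((N : ℝ) - 1) * lam * Real.tan (lam * t) * (lam * (radial' N l (lam * t) / radial N l lam)) +
      lam ^ 2 * gam N l / Real.cos (lam * t) ^ 2 * (radial N l (lam * t) / radial N l lam)

section

variable {N : ℕ} {lam : ℝ}

theorem amp_two (l : ℕ) (t : ℝ) : amp N lam 2 l t =
    ((N : ℝ) - 1) * lam * Real.tan (lam * t) * amp N lam 1 l t +
      lam ^ 2 * gam N l / Real.cos (lam * t) ^ 2 * amp N lam 0 l t := rfl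

theorem hasDerivAt_amp (hN : 2 ≤ N) (hlam : lam ∈ Ioo 0 (Real.pi / 2)) {k : ℕ} (hk : k < 2) (l : ℕ)
    {t : ℝ} (ht : t ∈ Icc (-1 : ℝ) 1) :
    HasDerivAt (amp N lam k l) (amp N lam (k + 1) l t) t := by
  have h := isRadialFactor_radial hN l
  have hm := mul_mem_Ioo hlam ht
  have hl := hasDerivAt_mul_left lam t
  interval_cases k
  · refine (((h.deriv_y _ hm).comp t hl).div_const (radial N l lam)).congr_deriv ?_
    simp only [amp]; ring
  · refine ((((h.deriv_y' _ hm).comp t hl).div_const (radial N l lam)).const_mul lam).congr_deriv ?_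
    simp only [amp]; ring

theorem lam_mem_Ico (hlam : lam ∈ Ioo 0 (Real.pi / 2)) : lam ∈ Ico 0 (Real.pi / 2) :=
  ⟨hlam.1.le, hlam.2⟩

theorem amp_zero_one (hN : 2 ≤ N) (hlam : lam ∈ Ioo 0 (Real.pi / 2)) (l : ℕ) :
    amp N lam 0 l 1 = 1 := by
  simp [amp, (radial_pos hN l (lam_mem_Ico hlam)).ne']

theorem amp_zero_neg_one (hN : 2 ≤ N) (hlam : lam ∈ Ioo 0 (Real.pi / 2)) (l : ℕ) :
    amp N lam 0 l (-1) = 1 := by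
  simp [amp, (isRadialFactor_radial hN l).even, (radial_pos hN l (lam_mem_Ico hlam)).ne']

theorem amp_one_one (hN : 2 ≤ N) (hlam : lam ∈ Ioo 0 (Real.pi / 2)) (l : ℕ) :
    amp N lam 1 l 1 = lam * riccati N l lam := by
  have := (radial_pos hN l (lam_mem_Ico hlam)).ne'
  simp only [amp, mul_one, radial'_eq hN l (lam_mem_Ico hlam)]
  field_simp

theorem IsRadialFactor.odd {l : ℕ} {y y' : ℝ → ℝ} (h : IsRadialFactor N l y y') {x : ℝ}
    (hx : x ∈ Ioo (-(Real.pi / 2)) (Real.pi / 2)) : y' (-x) = -y' x := by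
  have h1 := (h.deriv_y (-x) ⟨by linarith [hx.2], by linarith [hx.1]⟩).comp x (hasDerivAt_neg x)
  have h2 := h.deriv_y x hx
  have e : y ∘ Neg.neg = y := funext h.even
  rw [e] at h1
  have := h1.unique h2
  linarith

/-- The function itself decays by `radial_div_le`. One derivative costs a factor of order `l + 1`,
by the upper bound for `f_l`; the second derivative is expressed through the equation, which costs
`(l + 1)²`. -/
theorem exists_amp_le (hN : 2 ≤ N) (hlam : lam ∈ Ioo 0 (Real.pi / 2)) :
    ∃ C : ℝ, 0 ≤ C ∧ ∀ k ≤ 2, ∀ l : ℕ, ∀ t ∈ Icc (-1 : ℝ) 1,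
      |amp N lam k l t| ≤ C * ((l : ℝ) + 1) ^ 2 * Real.exp (-(l * (lam * (1 - |t|)))) := by
  obtain ⟨C, hC, hr⟩ := exists_riccati_le hN hlam
  have hl := hlam.1
  have hN' : (2 : ℝ) ≤ N := by exact_mod_cast hN
  have hcl := cos_pos_of_lt (x := lam) ⟨by linarith [hlam.1, Real.pi_pos], hlam.2⟩
  have hmem {t : ℝ} (ht : t ∈ Icc (-1 : ℝ) 1) : lam * |t| ∈ Icc 0 lam :=
    ⟨by positivity, mul_le_of_le_one_right hl.le (abs_le.mpr ht)⟩
  have hcos {t : ℝ} (ht : t ∈ Icc (-1 : ℝ) 1) : Real.cos lam ≤ Real.cos (lam * t) := by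
    rw [← Real.cos_abs (lam * t), abs_mul, abs_of_pos hl]
    exact Real.cos_le_cos_of_nonneg_of_le_pi (hmem ht).1 (by linarith [hlam.2, Real.pi_pos])
      (hmem ht).2
  have h0 (l : ℕ) (t : ℝ) (ht : t ∈ Icc (-1 : ℝ) 1) :
      |amp N lam 0 l t| ≤ 2 * Real.exp (-(l * (lam * (1 - |t|)))) := by
    have e : radial N l (lam * t) = radial N l (lam * |t|) := by
      rcases abs_choice t with h | h <;> rw [h]
      rw [mul_neg, (isRadialFactor_radial hN l).even]
    have h1 := radial_div_le hN l (hmem ht).1 (hmem ht).2 hlam.2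
    have h2 : lam * |t| ∈ Ico 0 (Real.pi / 2) := ⟨(hmem ht).1, (hmem ht).2.trans_lt hlam.2⟩
    simp only [amp, e]
    rw [abs_of_nonneg (div_nonneg (radial_pos hN l h2).le (radial_pos hN l (lam_mem_Ico hlam)).le)]
    convert h1 using 4
    ring
  have h1 (l : ℕ) (t : ℝ) (ht : t ∈ Icc (-1 : ℝ) 1) :
      |amp N lam 1 l t| ≤ lam * (C * (l + 1)) * |amp N lam 0 l t| := by
    have h2 : lam * |t| ∈ Ico 0 (Real.pi / 2) := ⟨(hmem ht).1, (hmem ht).2.trans_lt hlam.2⟩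
    have e : radial N l (lam * t) = radial N l (lam * |t|) := by
      rcases abs_choice t with h | h <;> rw [h]
      rw [mul_neg, (isRadialFactor_radial hN l).even]
    have e' : |radial' N l (lam * t)| = |radial' N l (lam * |t|)| := by
      rcases abs_choice t with h | h <;> rw [h]
      rw [mul_neg, (isRadialFactor_radial hN l).odd (mul_mem_Ioo hlam ht), abs_neg]
    simp only [amp, e, abs_mul, abs_div, e', abs_of_pos hl]
    rw [radial'_eq hN l h2, abs_mul, abs_of_nonneg (riccati_nonneg hN l h2), mul_assoc, mul_div_assoc]
    gcongr
    exact hr l _ (hmem ht)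
  have htan (t : ℝ) (ht : t ∈ Icc (-1 : ℝ) 1) :
      |((N : ℝ) - 1) * lam * Real.tan (lam * t)| ≤ N * lam / Real.cos lam := by
    rw [abs_mul, abs_of_nonneg (by nlinarith), Real.tan_eq_sin_div_cos, abs_div,
      abs_of_pos (hcl.trans_le (hcos ht)), mul_div_assoc, div_eq_mul_one_div (lam : ℝ), ← mul_assoc]
    have := Real.abs_sin_le_one (lam * t)
    have hc0 := hcl.trans_le (hcos ht)
    have := hcos ht
    gcongr
    linarith
  have hgam (l : ℕ) (t : ℝ) (ht : t ∈ Icc (-1 : ℝ) 1) :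
      |lam ^ 2 * gam N l / Real.cos (lam * t) ^ 2| ≤
        lam ^ 2 * ((N + 1) * ((l : ℝ) + 1) ^ 2) / Real.cos lam ^ 2 := by
    have := gam_nonneg hN l
    have := hcos ht
    rw [abs_of_nonneg (by positivity)]
    gcongr
    exact gam_le l
  refine ⟨2 + 2 * (lam * C) + 2 * (N * lam / Real.cos lam * (lam * C) +
    lam ^ 2 * (N + 1) / Real.cos lam ^ 2), by positivity, fun k hk l t ht => ?_⟩
  set E := Real.exp (-(l * (lam * (1 - |t|)))) with hE
  have hE0 : 0 < E := Real.exp_pos _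
  have hl1 : (1 : ℝ) ≤ (l : ℝ) + 1 := by simp
  have hl2 : (l : ℝ) + 1 ≤ ((l : ℝ) + 1) ^ 2 := le_self_pow₀ hl1 (by norm_num)
  have a0 := h0 l t ht
  have a1 : |amp N lam 1 l t| ≤ 2 * (lam * C) * ((l : ℝ) + 1) ^ 2 * E := by
    refine (h1 l t ht).trans ?_
    calc lam * (C * (l + 1)) * |amp N lam 0 l t| ≤
        lam * (C * ((l : ℝ) + 1) ^ 2) * (2 * E) := by gcongr
      _ = _ := by ring
  have p1 : 0 ≤ lam * C := by positivity
  have p2 : 0 ≤ N * lam / Real.cos lam * (lam * C) + lam ^ 2 * (N + 1) / Real.cos lam ^ 2 := by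
    positivity
  have pE : 0 ≤ ((l : ℝ) + 1) ^ 2 * E := by positivity
  interval_cases k
  · refine a0.trans ?_
    have : E ≤ ((l : ℝ) + 1) ^ 2 * E := le_mul_of_one_le_left hE0.le (one_le_pow₀ hl1)
    nlinarith [mul_nonneg p1 pE, mul_nonneg p2 pE]
  · refine a1.trans ?_
    nlinarith [mul_nonneg p1 pE, mul_nonneg p2 pE]
  · rw [amp_two]
    refine (abs_add_le _ _).trans ?_
    rw [abs_mul (((N : ℝ) - 1) * lam * Real.tan (lam * t)),
      abs_mul (lam ^ 2 * gam N l / Real.cos (lam * t) ^ 2)]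
    have b1 := mul_le_mul (htan t ht) a1 (abs_nonneg _) (by positivity)
    have b2 := mul_le_mul (hgam l t ht) a0 (abs_nonneg _) (by positivity)
    refine (add_le_add b1 b2).trans ?_
    have : N * lam / Real.cos lam * (2 * (lam * C) * ((l : ℝ) + 1) ^ 2 * E) +
        lam ^ 2 * ((N + 1) * ((l : ℝ) + 1) ^ 2) / Real.cos lam ^ 2 * (2 * E) =
        2 * (N * lam / Real.cos lam * (lam * C) + lam ^ 2 * (N + 1) / Real.cos lam ^ 2) *
          (((l : ℝ) + 1) ^ 2 * E) := by ring
    rw [this, mul_assoc (_ + _ + _)]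
    refine mul_le_mul_of_nonneg_right ?_ pE
    linarith

end

/-! ### Series of separated solutions -/

/-- The series `∑_l q_l(x) a_l^{(k)}(t)`. -/
def sepSeries {N : ℕ} (lam : ℝ) (q : ℕ → MvPolynomial (Fin N) ℝ) (k : ℕ) (z : Euc N × ℝ) : ℝ :=
  ∑' l, evalE (q l) z.1 * amp N lam k l z.2

/-- The domain `{|x| < R, |t| < T}`. -/
def sepDom (N : ℕ) (R T : ℝ) : Set (Euc N × ℝ) := Metric.ball 0 R ×ˢ Ioo (-T) T

theorem isOpen_sepDom (N : ℕ) (R T : ℝ) : IsOpen (sepDom N R T) :=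
  Metric.isOpen_ball.prod isOpen_Ioo

theorem isPreconnected_sepDom (N : ℕ) (R T : ℝ) : IsPreconnected (sepDom N R T) :=
  ((convex_ball 0 R).prod (convex_Ioo (-T) T)).isPreconnected

theorem hasFDerivAt_evalE {N : ℕ} (p : MvPolynomial (Fin N) ℝ) (x : Euc N) :
    HasFDerivAt (evalE p) (∑ i, evalE (MvPolynomial.pderiv i p) x •
      (EuclideanSpace.proj i : Euc N →L[ℝ] ℝ)) x := by
  refine ((contDiff_evalE (n := 1) p).differentiable (by norm_num) x).hasFDerivAt.congr_fderiv ?_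
  ext y
  have e : y = ∑ j, y j • stdVec j := by
    conv_lhs => rw [← (EuclideanSpace.basisFun (Fin N) ℝ).sum_repr y]
    simp [stdVec]
  conv_lhs => rw [e]
  simp only [map_sum, map_smul, _root_.sum_apply, _root_.smul_apply,
    ← pd_evalE, smul_eq_mul, PiLp.proj_apply]
  exact Finset.sum_congr rfl fun i _ => mul_comm _ _

section

variable {N : ℕ} [hN : Fact (2 ≤ N)] {lam R T : ℝ} {q : ℕ → MvPolynomial (Fin N) ℝ}

/-- On `|x| < R` the polynomials grow like `R^l`, on `|t| < T` the time factors decay like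
`e^{-lλ(1-T)}`. Up to powers of `l + 1`, the terms are dominated by a geometric series with ratio `R
e^{-λ(1-T)} < 1`. -/
theorem exists_summable_bound (hlam : lam ∈ Ioo 0 (Real.pi / 2)) (hT : T ≤ 1) (hR : 1 ≤ R)
    (hRT : R * Real.exp (-(lam * (1 - T))) < 1) (hq : IsPolyFamily q) {k : ℕ} (hk : k ≤ 2) :
    ∃ u : ℕ → ℝ, Summable u ∧ ∀ l, ∀ z ∈ sepDom N R T,
      |evalE (q l) z.1 * amp N lam k l z.2| ≤ u l := by
  obtain ⟨C, m, hC, h⟩ := hq.exists_bound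
  obtain ⟨C', hC', h'⟩ := exists_amp_le hN.out hlam
  set r := R * Real.exp (-(lam * (1 - T))) with hr
  have hr0 : 0 < r := by positivity
  refine ⟨fun l => C * C' * (((l : ℝ) + 1) ^ (m + 2) * r ^ l), ?_, fun l z hz => ?_⟩
  · have hs := (summable_nat_add_iff (f := fun n : ℕ => (n : ℝ) ^ (m + 2) * r ^ n) 1).mpr
      (summable_pow_mul_geometric_of_norm_lt_one (m + 2) (by
        rwa [Real.norm_of_nonneg hr0.le]))
    refine (hs.mul_left (C * C' * r⁻¹)).congr fun l => ?_
    push_cast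
    rw [pow_succ r l]
    field_simp
  · have hz1 : ‖z.1‖ ≤ R := (mem_ball_zero_iff.mp hz.1).le
    have hz2 : |z.2| < T := abs_lt.mpr hz.2
    have ht : z.2 ∈ Icc (-1 : ℝ) 1 := abs_le.mp (hz2.le.trans hT)
    have e : r ^ l = R ^ l * Real.exp (-(l * (lam * (1 - T)))) := by
      rw [hr, mul_pow, ← Real.exp_nat_mul]
      congr 2; ring
    have h3 : Real.exp (-(l * (lam * (1 - |z.2|)))) ≤ Real.exp (-(l * (lam * (1 - T)))) := by
      have := hlam.1
      gcongr
    simp only [abs_mul, e]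
    calc _ ≤ (C * ((l : ℝ) + 1) ^ m * R ^ l) *
          (C' * ((l : ℝ) + 1) ^ 2 * Real.exp (-(l * (lam * (1 - T))))) := by
          refine mul_le_mul (h l R hR _ hz1) ((h' k hk l _ ht).trans ?_) (abs_nonneg _)
            (by positivity)
          gcongr
      _ = _ := by ring

/-- The `i`-th spatial coordinate on `ℝ^N × ℝ`. -/
def coordFst (N : ℕ) (i : Fin N) : Euc N × ℝ →L[ℝ] ℝ :=
  (EuclideanSpace.proj i : Euc N →L[ℝ] ℝ) ∘L ContinuousLinearMap.fst ℝ (Euc N) ℝ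

/-- Derivatives are series of the same kind: a spatial one replaces `q l` by its partial derivative,
a time derivative raises `k`. -/
theorem hasFDerivAt_sepSeries (hlam : lam ∈ Ioo 0 (Real.pi / 2)) (hT : T ≤ 1) (hR : 1 ≤ R)
    (hRT : R * Real.exp (-(lam * (1 - T))) < 1) (hq : IsPolyFamily q) {k : ℕ} (hk : k < 2)
    {z : Euc N × ℝ} (hz : z ∈ sepDom N R T) :
    HasFDerivAt (sepSeries lam q k)
      ((∑ i, sepSeries lam (fun l => MvPolynomial.pderiv i (q l)) k z • coordFst N i) +
        sepSeries lam q (k + 1) z • ContinuousLinearMap.snd ℝ (Euc N) ℝ) z := by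
  obtain ⟨u, hu, hub⟩ := exists_summable_bound hlam hT hR hRT hq hk.le
  obtain ⟨u', hu', hub'⟩ := exists_summable_bound hlam hT hR hRT hq (Nat.succ_le_of_lt hk)
  have hi (i : Fin N) := exists_summable_bound hlam hT hR hRT (hq.pderiv i) hk.le
  choose w hw hwb using hi
  let F' : ℕ → Euc N × ℝ → (Euc N × ℝ →L[ℝ] ℝ) := fun l z =>
    (∑ i, (evalE (MvPolynomial.pderiv i (q l)) z.1 * amp N lam k l z.2) • coordFst N i) +
      (evalE (q l) z.1 * amp N lam (k + 1) l z.2) • ContinuousLinearMap.snd ℝ (Euc N) ℝ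
  have hsum : HasSum (fun l => F' l z)
      ((∑ i, sepSeries lam (fun l => MvPolynomial.pderiv i (q l)) k z • coordFst N i) +
        sepSeries lam q (k + 1) z • ContinuousLinearMap.snd ℝ (Euc N) ℝ) := by
    refine (hasSum_sum fun i _ => HasSum.smul_const ?_ _).add (HasSum.smul_const ?_ _)
    · exact (Summable.of_norm_bounded (hw i) fun l => hwb i l z hz).hasSum
    · exact (Summable.of_norm_bounded hu' fun l => hub' l z hz).hasSum
  rw [← hsum.tsum_eq]
  refine hasFDerivAt_tsum_of_isPreconnected
    (u := fun l => (∑ i, w i l * ‖coordFst N i‖) + u' l * ‖ContinuousLinearMap.snd ℝ (Euc N) ℝ‖)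
    ((summable_sum fun i _ => (hw i).mul_right _).add (hu'.mul_right _)) (isOpen_sepDom N R T)
    (isPreconnected_sepDom N R T) (fun l y hy => ?_) (fun l y hy => ?_) hz
    (Summable.of_norm_bounded hu fun l => hub l z hz) hz
  · have hy2 : |y.2| < T := abs_lt.mpr hy.2
    have h1 := (hasFDerivAt_evalE (q l) y.1).comp y hasFDerivAt_fst
    have h2 := (hasDerivAt_amp hN.out hlam hk l (abs_le.mp (hy2.le.trans hT))).hasFDerivAt.comp y
      hasFDerivAt_snd
    refine (h1.mul h2).congr_fderiv ?_
    ext v <;> simp [F', coordFst, mul_comm, Finset.mul_sum, mul_left_comm]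
  · refine (norm_add_le _ _).trans (add_le_add ((norm_sum_le _ _).trans
      (Finset.sum_le_sum fun i _ => ?_)) ?_)
    · rw [norm_smul]
      exact mul_le_mul_of_nonneg_right (hwb i l y hy) (norm_nonneg _)
    · rw [norm_smul]
      exact mul_le_mul_of_nonneg_right (hub' l y hy) (norm_nonneg _)

theorem continuousOn_sepSeries (hlam : lam ∈ Ioo 0 (Real.pi / 2)) (hT : T ≤ 1) (hR : 1 ≤ R)
    (hRT : R * Real.exp (-(lam * (1 - T))) < 1) (hq : IsPolyFamily q) {k : ℕ} (hk : k ≤ 2) :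
    ContinuousOn (sepSeries lam q k) (sepDom N R T) := by
  obtain ⟨u, hu, hub⟩ := exists_summable_bound hlam hT hR hRT hq hk
  refine continuousOn_tsum (fun l => ?_) hu hub
  refine ((contDiff_evalE (n := 0) (q l)).continuous.comp continuous_fst).continuousOn.mul ?_
  have ha : ContinuousOn (amp N lam k l) (Icc (-1) 1) := by
    intro t ht
    rcases hk.lt_or_eq with h | rfl
    · exact (hasDerivAt_amp hN.out hlam h l ht).continuousAt.continuousWithinAt
    · refine ContinuousAt.continuousWithinAt ?_
      have hc := (cos_pos_of_lt (mul_mem_Ioo hlam ht)).ne'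
      have hl := (hasDerivAt_mul_left lam t).continuousAt
      have h1 : ContinuousAt (fun t => Real.tan (lam * t)) t :=
        (Real.continuousAt_tan.mpr hc).comp hl
      have h2 : ContinuousAt (fun t => Real.cos (lam * t) ^ 2) t := by fun_prop
      have h3 := (hasDerivAt_amp hN.out hlam zero_lt_two l ht).continuousAt
      have h4 := (hasDerivAt_amp hN.out hlam one_lt_two l ht).continuousAt
      exact ((continuousAt_const.mul h1).mul h4).add
        ((continuousAt_const.div h2 (pow_ne_zero 2 hc)).mul h3)
  refine ha.comp continuousOn_snd fun z hz => ?_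
  have hy2 : |z.2| < T := abs_lt.mpr hz.2
  exact abs_le.mp (hy2.le.trans hT)

/-- The induction has to run over all families `q` and orders `k` at once, since differentiating
changes both. -/
theorem contDiffOn_sepSeries (hlam : lam ∈ Ioo 0 (Real.pi / 2)) (hT : T ≤ 1) (hR : 1 ≤ R)
    (hRT : R * Real.exp (-(lam * (1 - T))) < 1) (n : ℕ) :
    ∀ (q : ℕ → MvPolynomial (Fin N) ℝ), IsPolyFamily q → ∀ k : ℕ, n + k ≤ 2 →
      ContDiffOn ℝ n (sepSeries lam q k) (sepDom N R T) := by
  induction n with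
  | zero =>
    intro q hq k hk
    exact contDiffOn_zero.mpr (continuousOn_sepSeries hlam hT hR hRT hq (by omega))
  | succ n ih =>
    intro q hq k hk
    have hd {z} (hz : z ∈ sepDom N R T) :=
      hasFDerivAt_sepSeries hlam hT hR hRT hq (k := k) (by omega) hz
    push_cast
    rw [contDiffOn_succ_iff_fderiv_of_isOpen (isOpen_sepDom N R T)]
    refine ⟨fun z hz => (hd hz).differentiableAt.differentiableWithinAt, by simp, ?_⟩
    refine ContDiffOn.congr ?_ fun z hz => (hd hz).fderiv
    refine (ContDiffOn.sum fun i _ => ?_).add ?_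
    · exact (ih _ (hq.pderiv i) k (by omega)).smul contDiffOn_const
    · exact (ih q hq (k + 1) (by omega)).smul contDiffOn_const

end

/-! ### Harmonicity of the series of separated solutions -/

section

variable {N : ℕ} [hN : Fact (2 ≤ N)] {lam : ℝ} {q : ℕ → MvPolynomial (Fin N) ℝ}

-- Below the boundary there is room for a radius `R > 1`: take `|t| < T < 1` and `R = e^{λ(1-T)/2}`,
-- using half of the available exponent. The domain is then a neighbourhood of the slice of the
-- sphere at time `t`.
omit hN in
theorem exists_sepDom (hlam : lam ∈ Ioo 0 (Real.pi / 2)) {t : ℝ} (ht : t ∈ Ioo (-1 : ℝ) 1) :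
    ∃ R T : ℝ, T ≤ 1 ∧ 1 ≤ R ∧ R * Real.exp (-(lam * (1 - T))) < 1 ∧
      ∀ x : Euc N, ‖x‖ = 1 → (x, t) ∈ sepDom N R T := by
  have hl := hlam.1
  have ht' : |t| < 1 := abs_lt.mpr ht
  obtain ⟨T, hT1, hT2⟩ := exists_between ht'
  have hp : 0 < lam * (1 - T) := mul_pos hl (by linarith)
  refine ⟨Real.exp (lam * (1 - T) / 2), T, hT2.le, Real.one_le_exp (by linarith), ?_,
    fun x hx => ⟨mem_ball_zero_iff.mpr ?_, abs_lt.mp hT1⟩⟩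
  · rw [← Real.exp_add, Real.exp_lt_one_iff]
    linarith
  · rw [hx, Real.one_lt_exp_iff]
    linarith

theorem contDiffAt_sepSeries (hlam : lam ∈ Ioo 0 (Real.pi / 2)) (hq : IsPolyFamily q) {x : Euc N}
    (hx : ‖x‖ = 1) {t : ℝ} (ht : t ∈ Ioo (-1 : ℝ) 1) :
    ContDiffAt ℝ 2 (sepSeries lam q 0) (x, t) := by
  obtain ⟨R, T, hT, hR, hRT, hmem⟩ := exists_sepDom (N := N) hlam ht
  exact (contDiffOn_sepSeries hlam hT hR hRT 2 q hq 0 (by norm_num)).contDiffAt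
    ((isOpen_sepDom N R T).mem_nhds (hmem x hx))

theorem contDiffOn_homExt_sepSeries (hlam : lam ∈ Ioo 0 (Real.pi / 2)) (hq : IsPolyFamily q) :
    ContDiffOn ℝ 2 (fun p : Euc N × ℝ =>
      homExt (fun σ : Sph N => sepSeries lam q 0 ((σ : Euc N), p.2)) p.1)
      ({0}ᶜ ×ˢ Ioo (-1) 1) := by
  intro p hp
  have hp1 : p.1 ≠ 0 := hp.1
  refine ContDiffAt.contDiffWithinAt ?_
  have hg : ContDiffAt ℝ 2 (fun p : Euc N × ℝ => (‖p.1‖⁻¹ • p.1, p.2)) p := by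
    have h1 : ContDiffAt ℝ 2 (fun p : Euc N × ℝ => ‖p.1‖) p := contDiffAt_fst.norm ℝ hp1
    exact ((h1.inv (norm_ne_zero_iff.mpr hp1)).smul contDiffAt_fst).prodMk contDiffAt_snd
  have hn : ‖‖p.1‖⁻¹ • p.1‖ = 1 := by
    simp [norm_smul, inv_mul_cancel₀ (norm_ne_zero_iff.mpr hp1)]
  refine ((contDiffAt_sepSeries hlam hq hn hp.2).comp p hg).congr_of_eventuallyEq ?_
  filter_upwards [(isOpen_compl_singleton.preimage continuous_fst).mem_nhds hp1] with z hz
  rw [homExt_of_ne _ hz]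
  rfl

theorem hasDerivAt_sepSeries (hlam : lam ∈ Ioo 0 (Real.pi / 2)) (hq : IsPolyFamily q) {k : ℕ}
    (hk : k < 2) {x : Euc N} (hx : ‖x‖ = 1) {t : ℝ} (ht : t ∈ Ioo (-1 : ℝ) 1) :
    HasDerivAt (fun s => sepSeries lam q k (x, s)) (sepSeries lam q (k + 1) (x, t)) t := by
  obtain ⟨R, T, hT, hR, hRT, hmem⟩ := exists_sepDom (N := N) hlam ht
  have h := hasFDerivAt_sepSeries hlam hT hR hRT hq hk (hmem x hx)
  have h1 : HasDerivAt (fun s : ℝ => (x, s)) ((0 : Euc N), (1 : ℝ)) t :=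
    (hasDerivAt_const t x).prodMk (hasDerivAt_id t)
  refine (h.comp_hasDerivAt t h1).congr_deriv ?_
  simp [coordFst]

/-- The restriction of `sepSeries` to a slice `S^{N-1} × {t}` converges uniformly. -/
theorem exists_hasSum_sepSeries (hlam : lam ∈ Ioo 0 (Real.pi / 2)) (hq : IsPolyFamily q) {k : ℕ}
    (hk : k ≤ 2) {t : ℝ} (ht : t ∈ Ioo (-1 : ℝ) 1) :
    ∃ F : C(Sph N, ℝ), (∀ σ, F σ = sepSeries lam q k ((σ : Euc N), t)) ∧
      HasSum (fun l => amp N lam k l t • polyRestrict N (q l)) F := by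
  obtain ⟨R, T, hT, hR, hRT, hmem⟩ := exists_sepDom (N := N) hlam ht
  obtain ⟨u, hu, hub⟩ := exists_summable_bound hlam hT hR hRT hq hk
  have hs : Summable fun l => amp N lam k l t • polyRestrict N (q l) := by
    refine Summable.of_norm_bounded hu fun l => ?_
    have hb (σ : Sph N) := hub l _ (hmem (σ : Euc N) (by simp))
    refine (ContinuousMap.norm_le _ ?_).mpr fun σ => ?_
    · obtain ⟨σ, -⟩ := exists_eq_norm_smul (0 : Euc N)
      exact (abs_nonneg _).trans (hb σ)
    · rw [ContinuousMap.smul_apply, smul_eq_mul, mul_comm, Real.norm_eq_abs]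
      exact hb σ
  refine ⟨_, fun σ => ?_, hs.hasSum⟩
  have h1 := hs.hasSum.map (ContinuousMap.evalCLM ℝ σ) (ContinuousMap.evalCLM ℝ σ).continuous
  have h2 := h1.tsum_eq
  simp only [ContinuousMap.evalCLM_apply] at h2
  rw [← h2]
  refine tsum_congr fun l => ?_
  simp [polyRestrict_apply, mul_comm]

theorem proj_sepSeries {k l : ℕ} {t : ℝ} (hql : ∀ l, q l ∈ harmonicPoly N l) {F : C(Sph N, ℝ)}
    (hF : HasSum (fun l => amp N lam k l t • polyRestrict N (q l)) F) :
    proj N l (toLtwo F) = amp N lam k l t • toLtwo (polyRestrict N (q l)) := by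
  have h := hF.map (toLtwo (N := N)) toLtwo.continuous
  simp only [Function.comp_def, map_smul] at h
  exact proj_hasSum (fun l => Submodule.smul_mem _ _ (mem_sphHarm.mpr ⟨q l, hql l, rfl⟩)) h l

theorem isC2_sepSeries (hlam : lam ∈ Ioo 0 (Real.pi / 2)) (hq : IsPolyFamily q) {t : ℝ}
    (ht : t ∈ Ioo (-1 : ℝ) 1) : IsC2 fun σ : Sph N => sepSeries lam q 0 ((σ : Euc N), t) :=
  (contDiffOn_homExt_sepSeries hlam hq).comp (f := fun x : Euc N => (x, t)) (by fun_prop)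
    fun _ hx => ⟨hx, ht⟩

/-- No termwise spherical differentiation is needed: both sides are continuous on the sphere, and by
`proj_sphLaplacian` and `amp_two` they have the same projection to each `V_l`. -/
theorem sphLaplacian_sepSeries (hlam : lam ∈ Ioo 0 (Real.pi / 2)) (hq : IsPolyFamily q)
    (hql : ∀ l, q l ∈ harmonicPoly N l) {t : ℝ} (ht : t ∈ Ioo (-1 : ℝ) 1) (σ : Sph N) :
    lam ^ 2 / Real.cos (lam * t) ^ 2 *
        sphLaplacian (fun τ : Sph N => sepSeries lam q 0 ((τ : Euc N), t)) σ =
      ((N : ℝ) - 1) * lam * Real.tan (lam * t) * sepSeries lam q 1 ((σ : Euc N), t) -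
        sepSeries lam q 2 ((σ : Euc N), t) := by
  obtain ⟨F0, hF0, hs0⟩ := exists_hasSum_sepSeries (N := N) hlam hq (k := 0) (by norm_num) ht
  obtain ⟨F1, hF1, hs1⟩ := exists_hasSum_sepSeries (N := N) hlam hq (k := 1) (by norm_num) ht
  obtain ⟨F2, hF2, hs2⟩ := exists_hasSum_sepSeries (N := N) hlam hq (k := 2) le_rfl ht
  have hC2 := isC2_sepSeries hlam hq ht
  have e0 : (⟨_, hC2.continuous⟩ : C(Sph N, ℝ)) = F0 := by ext τ; exact (hF0 τ).symm
  have key : (lam ^ 2 / Real.cos (lam * t) ^ 2) • (⟨_, hC2.continuous_sphLaplacian⟩ : C(Sph N, ℝ)) =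
      (((N : ℝ) - 1) * lam * Real.tan (lam * t)) • F1 - F2 := by
    refine toLtwo_injective (eq_of_proj_eq fun l => ?_)
    rw [map_smul, map_smul, proj_sphLaplacian hC2, e0, map_sub, map_sub, map_smul, map_smul,
      proj_sepSeries hql hs0, proj_sepSeries hql hs1, proj_sepSeries hql hs2, amp_two]
    simp only [smul_smul, ← sub_smul]
    congr 1
    ring
  have := congrArg (fun f => f σ) key
  simpa [hF1, hF2] using this

theorem cylLaplacian_sepSeries (hlam : lam ∈ Ioo 0 (Real.pi / 2)) (hq : IsPolyFamily q)
    (hql : ∀ l, q l ∈ harmonicPoly N l) {u : Sph N → ℝ → ℝ}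
    (hu : ∀ σ, ∀ t ∈ Ioo (-1 : ℝ) 1, u σ t = sepSeries lam q 0 ((σ : Euc N), t)) (σ : Sph N) {t : ℝ}
    (ht : t ∈ Ioo (-1 : ℝ) 1) : cylLaplacian lam u σ t = 0 := by
  have hσ : ‖(σ : Euc N)‖ = 1 := by simp
  have hd0 {s : ℝ} (hs : s ∈ Ioo (-1 : ℝ) 1) :
      HasDerivAt (u σ) (sepSeries lam q 1 ((σ : Euc N), s)) s := by
    refine (hasDerivAt_sepSeries hlam hq zero_lt_two hσ hs).congr_of_eventuallyEq ?_
    filter_upwards [isOpen_Ioo.mem_nhds hs] with r hr using hu σ r hr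
  have hd1 : HasDerivAt (deriv (u σ)) (sepSeries lam q 2 ((σ : Euc N), t)) t := by
    refine (hasDerivAt_sepSeries hlam hq one_lt_two hσ ht).congr_of_eventuallyEq ?_
    filter_upwards [isOpen_Ioo.mem_nhds ht] with r hr using (hd0 hr).deriv
  have h := sphLaplacian_sepSeries hlam hq hql ht σ
  have hc := (cos_pos_of_lt (mul_mem_Ioo hlam (Ioo_subset_Icc_self ht))).ne'
  have hl := hlam.1.ne'
  have hN' := hN.out
  rw [cylLaplacian_eq hlam ht hd1.differentiableAt, hd1.deriv, (hd0 ht).deriv,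
    funext fun τ => hu τ t ht]
  have e : sphLaplacian (fun τ : Sph N => sepSeries lam q 0 ((τ : Euc N), t)) σ =
      Real.cos (lam * t) ^ 2 / lam ^ 2 * (((N : ℝ) - 1) * lam * Real.tan (lam * t) *
        sepSeries lam q 1 ((σ : Euc N), t) - sepSeries lam q 2 ((σ : Euc N), t)) := by
    rw [← h]; field_simp
  rw [e, Nat.cast_sub (by omega)]
  push_cast
  field_simp
  ring

end

/-! ### Existence for the Dirichlet problem -/

section

variable {N : ℕ} [hN : Fact (2 ≤ N)] {lam : ℝ}

/-- The sequence `q`, truncated to the finite set `s` of degrees. -/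
def truncFamily (s : Finset ℕ) (q : ℕ → MvPolynomial (Fin N) ℝ) (l : ℕ) :
    MvPolynomial (Fin N) ℝ := if l ∈ s then q l else 0

omit hN in
theorem truncFamily_mem {s : Finset ℕ} {q : ℕ → MvPolynomial (Fin N) ℝ}
    (hq : ∀ l, q l ∈ harmonicPoly N l) (l : ℕ) : truncFamily s q l ∈ harmonicPoly N l := by
  unfold truncFamily
  split_ifs
  · exact hq l
  · exact Submodule.zero_mem _

omit hN in
theorem isPolyFamily_truncFamily {s : Finset ℕ} {q : ℕ → MvPolynomial (Fin N) ℝ}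
    (hq : ∀ l, q l ∈ harmonicPoly N l) : IsPolyFamily (truncFamily s q) := by
  refine ⟨∑ l ∈ s, ‖toLtwo (polyRestrict N (q l))‖, 0, Finset.sum_nonneg fun _ _ => norm_nonneg _,
    fun l => ⟨l, le_rfl, truncFamily_mem hq l, ?_⟩⟩
  rw [pow_zero, mul_one]
  unfold truncFamily
  split_ifs with h
  · exact Finset.single_le_sum (f := fun l => ‖toLtwo (polyRestrict N (q l))‖)
      (fun _ _ => norm_nonneg _) h
  · simpa using Finset.sum_nonneg fun l _ => norm_nonneg (toLtwo (polyRestrict N (q l)))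

/-- The finite sum `∑_{l ∈ s} q_l(σ) a_l(t)`. -/
def finSol (lam : ℝ) (s : Finset ℕ) (q : ℕ → MvPolynomial (Fin N) ℝ) (σ : Sph N) (t : ℝ) : ℝ :=
  ∑ l ∈ s, polyRestrict N (q l) σ * amp N lam 0 l t

variable {s : Finset ℕ} {q : ℕ → MvPolynomial (Fin N) ℝ}

-- Read as a series, a finite sum inherits the regularity and harmonicity proved for series.
omit hN in
theorem finSol_eq_sepSeries (σ : Sph N) (t : ℝ) :
    finSol lam s q σ t = sepSeries lam (truncFamily s q) 0 ((σ : Euc N), t) := by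
  unfold finSol sepSeries
  rw [tsum_eq_sum (s := s)]
  · refine Finset.sum_congr rfl fun l hl => ?_
    simp [truncFamily, hl, polyRestrict_apply]
  · intro l hl
    simp [truncFamily, hl, evalE]

theorem finSol_one (hlam : lam ∈ Ioo 0 (Real.pi / 2)) (σ : Sph N) :
    finSol lam s q σ 1 = ∑ l ∈ s, polyRestrict N (q l) σ := by
  simp [finSol, amp_zero_one hN.out hlam]

theorem finSol_neg_one (hlam : lam ∈ Ioo 0 (Real.pi / 2)) (σ : Sph N) :
    finSol lam s q σ (-1) = ∑ l ∈ s, polyRestrict N (q l) σ := by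
  simp [finSol, amp_zero_neg_one hN.out hlam]

theorem continuousOn_finSol (hlam : lam ∈ Ioo 0 (Real.pi / 2)) :
    ContinuousOn (fun p : Sph N × ℝ => finSol lam s q p.1 p.2) (univ ×ˢ Icc (-1) 1) := by
  refine continuousOn_finsetSum _ fun l _ => ?_
  refine ((polyRestrict N (q l)).continuous.comp continuous_fst).continuousOn.mul ?_
  have ha : ContinuousOn (amp N lam 0 l) (Icc (-1) 1) := fun t ht =>
    (hasDerivAt_amp hN.out hlam zero_lt_two l ht).continuousAt.continuousWithinAt
  exact ha.comp continuousOn_snd fun z hz => hz.2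

theorem isDirichletSolution_of_sepSeries (hlam : lam ∈ Ioo 0 (Real.pi / 2)) (hq : IsPolyFamily q)
    (hql : ∀ l, q l ∈ harmonicPoly N l) {ω : Sph N → ℝ} {u : Sph N → ℝ → ℝ}
    (hu : ∀ σ, ∀ t ∈ Ioo (-1 : ℝ) 1, u σ t = sepSeries lam q 0 ((σ : Euc N), t))
    (hc : ContinuousOn (fun p : Sph N × ℝ => u p.1 p.2) (univ ×ˢ Icc (-1) 1))
    (hb : ∀ σ, u σ 1 = ω σ ∧ u σ (-1) = ω σ) : IsDirichletSolution lam ω u := by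
  refine ⟨hc, (contDiffOn_homExt_sepSeries hlam hq).congr fun p hp => ?_,
    fun σ t ht => cylLaplacian_sepSeries hlam hq hql hu σ ht, hb⟩
  simp only [hu _ p.2 hp.2]

theorem isDirichletSolution_finSol (hlam : lam ∈ Ioo 0 (Real.pi / 2))
    (hq : ∀ l, q l ∈ harmonicPoly N l) :
    IsDirichletSolution lam (fun σ => ∑ l ∈ s, polyRestrict N (q l) σ) (finSol lam s q) :=
  isDirichletSolution_of_sepSeries hlam (isPolyFamily_truncFamily hq) (truncFamily_mem hq)
    (fun σ t _ => finSol_eq_sepSeries σ t) (continuousOn_finSol hlam)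
    fun σ => ⟨finSol_one hlam σ, finSol_neg_one hlam σ⟩

omit hN in
theorem IsDirichletSolution.sub (hlam : lam ∈ Ioo 0 (Real.pi / 2)) {ω ω' : Sph N → ℝ}
    {u v : Sph N → ℝ → ℝ} (hu : IsDirichletSolution lam ω u) (hv : IsDirichletSolution lam ω' v) :
    IsCylRegular (fun σ t => u σ t + -1 * v σ t) ∧
      ∀ σ, ∀ t ∈ Ioo (-1 : ℝ) 1, cylLaplacian lam (fun σ t => u σ t + -1 * v σ t) σ t = 0 := by
  refine ⟨hu.isCylRegular.add (hv.isCylRegular.const_mul (-1)), fun σ t ht => ?_⟩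
  rw [cylLaplacian_add hlam hu.isCylRegular (hv.isCylRegular.const_mul (-1)) σ ht,
    cylLaplacian_const_mul hlam hv.isCylRegular _ σ ht, hu.harmonic σ t ht, hv.harmonic σ t ht]
  ring

theorem IsDirichletSolution.abs_sub_le (hlam : lam ∈ Ioo 0 (Real.pi / 2)) {ω ω' : Sph N → ℝ}
    {u v : Sph N → ℝ → ℝ} (hu : IsDirichletSolution lam ω u) (hv : IsDirichletSolution lam ω' v)
    {M : ℝ} (h : ∀ σ, |ω σ - ω' σ| ≤ M) (σ : Sph N) {t : ℝ} (ht : t ∈ Icc (-1 : ℝ) 1) :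
    |u σ t - v σ t| ≤ M := by
  obtain ⟨h1, h2⟩ := hu.sub hlam hv
  have := abs_le_of_cylLaplacian_eq_zero hN.out hlam h1 h2 (M := M)
    (fun σ => by simpa [(hu.boundary σ).1, (hv.boundary σ).1, ← sub_eq_add_neg] using h σ)
    (fun σ => by simpa [(hu.boundary σ).2, (hv.boundary σ).2, ← sub_eq_add_neg] using h σ) σ ht
  simpa [← sub_eq_add_neg] using this

theorem proj_sum_smul (hq : ∀ l, q l ∈ harmonicPoly N l) (c : ℕ → ℝ) (l : ℕ) :
    proj N l (toLtwo (∑ j ∈ s, c j • polyRestrict N (q j))) =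
      c l • proj N l (toLtwo (∑ j ∈ s, polyRestrict N (q j))) := by
  simp only [map_sum, map_smul, Finset.smul_sum]
  refine Finset.sum_congr rfl fun j _ => ?_
  rw [proj_of_mem (mem_sphHarm.mpr ⟨q j, hq j, rfl⟩)]
  split_ifs with h
  · rw [h]
  · simp

/-- Continuous functions are uniform limits of finite sums of spherical harmonics. -/
theorem exists_seq_harmonic_approx (g : C(Sph N, ℝ)) :
    ∃ (s : ℕ → Finset ℕ) (q : ℕ → ℕ → MvPolynomial (Fin N) ℝ),
      (∀ n l, q n l ∈ harmonicPoly N l) ∧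
      ∀ n σ, |g σ - ∑ l ∈ s n, polyRestrict N (q n l) σ| < 1 / ((n : ℝ) + 1) := by
  choose s q h1 h2 using fun n : ℕ => exists_harmonic_approx g
    (show (0 : ℝ) < 1 / ((n : ℝ) + 1) by positivity)
  exact ⟨s, q, h1, h2⟩

omit hN in
theorem cauchySeq_of_abs_sub_le {F : ℕ → C(Sph N, ℝ)} {C : ℝ}
    (h : ∀ m n σ, |F m σ - F n σ| ≤ C * (1 / ((m : ℝ) + 1)) + C * (1 / ((n : ℝ) + 1))) :
    ∃ G : C(Sph N, ℝ), Filter.Tendsto F Filter.atTop (𝓝 G) := by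
  refine cauchySeq_tendsto_of_complete (cauchySeq_of_le_tendsto_0
    (fun n : ℕ => |C| * (1 / ((n : ℝ) + 1)) + |C| * (1 / ((n : ℝ) + 1))) (fun m n k hm hn => ?_) ?_)
  · refine (ContinuousMap.dist_le (by positivity)).mpr fun σ => ?_
    rw [Real.dist_eq]
    refine (h m n σ).trans ?_
    have hm' : (k : ℝ) ≤ m := by exact_mod_cast hm
    have hn' : (k : ℝ) ≤ n := by exact_mod_cast hn
    have := le_abs_self C
    gcongr
  · have := tendsto_one_div_add_atTop_nhds_zero_nat (𝕜 := ℝ)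
    simpa using (this.const_mul |C|).add (this.const_mul |C|)

omit hN in
theorem tendsto_of_abs_sub_lt {g : C(Sph N, ℝ)} {F : ℕ → C(Sph N, ℝ)}
    (h : ∀ n σ, |g σ - F n σ| < 1 / ((n : ℝ) + 1)) : Filter.Tendsto F Filter.atTop (𝓝 g) := by
  rw [tendsto_iff_dist_tendsto_zero]
  refine squeeze_zero (fun _ => dist_nonneg) (fun n => ?_)
    (tendsto_one_div_add_atTop_nhds_zero_nat (𝕜 := ℝ))
  refine (ContinuousMap.dist_le (by positivity)).mpr fun σ => ?_
  rw [dist_comm, Real.dist_eq]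
  exact (h n σ).le

/-- The maximum principle is not yet available for the series, whose boundary behaviour is unknown.
At fixed `t`, finite-sum solutions with boundary values tending to `g` converge uniformly, and their
limit is the series because the projections agree. The estimate between finite sums passes to the
limit. -/
theorem abs_sepSeries_sub_finSol_le (hlam : lam ∈ Ioo 0 (Real.pi / 2)) {g : C(Sph N, ℝ)}
    {y : ℕ → MvPolynomial (Fin N) ℝ} (hy : IsPolyFamily y) (hyl : ∀ l, y l ∈ harmonicPoly N l)
    (hyg : ∀ l, toLtwo (polyRestrict N (y l)) = proj N l (toLtwo g))
    (hq : ∀ l, q l ∈ harmonicPoly N l) {ε : ℝ}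
    (h : ∀ σ, |g σ - ∑ l ∈ s, polyRestrict N (q l) σ| ≤ ε) (σ : Sph N) {t : ℝ}
    (ht : t ∈ Ioo (-1 : ℝ) 1) :
    |sepSeries lam y 0 ((σ : Euc N), t) - finSol lam s q σ t| ≤ ε := by
  have ht' := Ioo_subset_Icc_self ht
  obtain ⟨S, Q, hQ, hg⟩ := exists_seq_harmonic_approx g
  let B : ℕ → C(Sph N, ℝ) := fun n => ∑ l ∈ S n, polyRestrict N (Q n l)
  have hB : Filter.Tendsto B Filter.atTop (𝓝 g) := tendsto_of_abs_sub_lt fun n σ => by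
    simpa [B] using hg n σ
  let F : ℕ → C(Sph N, ℝ) := fun n => ∑ l ∈ S n, amp N lam 0 l t • polyRestrict N (Q n l)
  have hF (n σ) : F n σ = finSol lam (S n) (Q n) σ t := by simp [F, finSol, mul_comm]
  have hsol (n) := isDirichletSolution_finSol (s := S n) hlam (hQ n)
  obtain ⟨G, hG⟩ := cauchySeq_of_abs_sub_le (F := F) (C := 1) fun m n σ => by
    rw [hF, hF]
    refine (hsol m).abs_sub_le hlam (hsol n) (fun σ => ?_) σ ht'
    have h1 := hg m σ
    have h2 := hg n σ
    rw [abs_lt] at h1 h2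
    rw [abs_le]
    constructor <;> linarith [h1.1, h1.2, h2.1, h2.2]
  obtain ⟨H, hH, hHs⟩ := exists_hasSum_sepSeries (N := N) hlam hy (k := 0) (by norm_num) ht
  have hGH : G = H := by
    refine toLtwo_injective (eq_of_proj_eq fun l => ?_)
    rw [proj_sepSeries hyl hHs, hyg]
    have h1 : Filter.Tendsto (fun n => proj N l (toLtwo (F n))) Filter.atTop
        (𝓝 (proj N l (toLtwo G))) := (((proj N l) ∘L toLtwo).continuous.tendsto G).comp hG
    have h2 : Filter.Tendsto (fun n => amp N lam 0 l t • proj N l (toLtwo (B n))) Filter.atTop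
        (𝓝 (amp N lam 0 l t • proj N l (toLtwo g))) :=
      ((((proj N l) ∘L toLtwo).continuous.tendsto g).comp hB).const_smul _
    exact tendsto_nhds_unique h1 (h2.congr fun n =>
      (proj_sum_smul (hQ n) (fun l => amp N lam 0 l t) l).symm)
  rw [← hH, ← hGH]
  have hlim : Filter.Tendsto (fun n => |F n σ - finSol lam s q σ t|) Filter.atTop
      (𝓝 |G σ - finSol lam s q σ t|) :=
    ((((ContinuousMap.evalCLM ℝ σ).continuous.tendsto G).comp hG).sub_const _).abs
  have hlim' : Filter.Tendsto (fun n : ℕ => 1 / ((n : ℝ) + 1) + ε) Filter.atTop (𝓝 ε) := by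
    simpa using (tendsto_one_div_add_atTop_nhds_zero_nat (𝕜 := ℝ)).add_const ε
  refine le_of_tendsto_of_tendsto' hlim hlim' fun n => ?_
  rw [hF]
  refine (hsol n).abs_sub_le hlam (isDirichletSolution_finSol hlam hq) (fun σ => ?_) σ ht'
  have h1 := hg n σ
  have h2 := h σ
  rw [abs_lt] at h1
  rw [abs_le] at h2 ⊢
  constructor <;> linarith [h1.1, h1.2, h2.1, h2.2]

/-- Inside, the solution is the series built from `P_l ω`; at `t = ±1` it is `ω` by definition.
Continuity on the closed cylinder holds because it is a uniform limit of continuous finite sums. -/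
theorem exists_isDirichletSolution (hlam : lam ∈ Ioo 0 (Real.pi / 2)) {ω : Sph N → ℝ}
    (hω : Continuous ω) : ∃ ψ, IsDirichletSolution lam ω ψ := by
  choose y hyl hyg using fun l => mem_sphHarm.mp (proj_mem l (toLtwo (⟨ω, hω⟩ : C(Sph N, ℝ))))
  have hy : IsPolyFamily y := ⟨‖toLtwo (⟨ω, hω⟩ : C(Sph N, ℝ))‖, 0, norm_nonneg _, fun l =>
    ⟨l, le_rfl, hyl l, by rw [hyg, pow_zero, mul_one]; exact norm_proj_le l _⟩⟩
  classical
  let ψ : Sph N → ℝ → ℝ := fun σ t =>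
    if t ∈ Ioo (-1 : ℝ) 1 then sepSeries lam y 0 ((σ : Euc N), t) else ω σ
  have hb (σ : Sph N) : ψ σ 1 = ω σ ∧ ψ σ (-1) = ω σ := by simp [ψ]
  refine ⟨ψ, isDirichletSolution_of_sepSeries hlam hy hyl (fun σ t ht => if_pos ht) ?_ hb⟩
  refine continuousOn_of_uniform_approx_of_continuousOn fun U hU => ?_
  obtain ⟨ε, hε, hεU⟩ := Metric.mem_uniformity_dist.mp hU
  obtain ⟨s, q, hq, hs⟩ := exists_harmonic_approx (⟨ω, hω⟩ : C(Sph N, ℝ)) (half_pos hε)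
  refine ⟨_, continuousOn_finSol (s := s) (q := q) hlam, fun p hp => hεU ?_⟩
  rw [Real.dist_eq]
  refine lt_of_le_of_lt ?_ (half_lt_self hε)
  by_cases ht : p.2 ∈ Ioo (-1 : ℝ) 1
  · simp only [ψ, if_pos ht]
    exact abs_sepSeries_sub_finSol_le hlam hy hyl hyg hq (fun σ => (hs σ).le) p.1 ht
  · have : p.2 = 1 ∨ p.2 = -1 := by
      by_contra! h
      exact ht ⟨lt_of_le_of_ne hp.2.1 (Ne.symm h.2), lt_of_le_of_ne hp.2.2 h.1⟩
    rcases this with h | h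
    · rw [h, (hb p.1).1, finSol_one hlam]; exact (hs p.1).le
    · rw [h, (hb p.1).2, finSol_neg_one hlam]; exact (hs p.1).le

theorem isDirichletSolution_dirichletSolution (hlam : lam ∈ Ioo 0 (Real.pi / 2)) {ω : Sph N → ℝ}
    (hω : Continuous ω) : IsDirichletSolution lam ω (dirichletSolution lam ω) := by
  have h := exists_isDirichletSolution hlam hω
  unfold dirichletSolution
  rw [dif_pos h]
  exact h.choose_spec

end

/-! ### The normal derivative and the linearized operator -/

section

variable {N : ℕ} [hN : Fact (2 ≤ N)] {lam : ℝ}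

-- Near `a`, the difference quotients of `f` and `g n` differ by at most `C/(n+1)`. The
-- neighbourhood may depend on `n`, as one suitable `n` is fixed for each tolerance.
omit hN in
theorem hasDerivWithinAt_of_approx {f : ℝ → ℝ} {I : Set ℝ} {a d : ℝ} (g : ℕ → ℝ → ℝ) (g' : ℕ → ℝ)
    {C : ℝ} (hg : ∀ n, HasDerivWithinAt (g n) (g' n) I a)
    (hd : Filter.Tendsto g' Filter.atTop (𝓝 d))
    (h : ∀ n : ℕ, ∀ᶠ t in 𝓝[I] a,
      |(f t - g n t) - (f a - g n a)| ≤ C * (1 / ((n : ℝ) + 1)) * |t - a|) :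
    HasDerivWithinAt f d I a := by
  rw [hasDerivWithinAt_iff_isLittleO, Asymptotics.isLittleO_iff]
  intro c hc
  have h1 : ∀ᶠ n in Filter.atTop, |g' n - d| < c / 3 := by
    simpa [Real.dist_eq] using (Metric.tendsto_nhds.mp hd) (c / 3) (by positivity)
  have h2 : ∀ᶠ n : ℕ in Filter.atTop, C * (1 / ((n : ℝ) + 1)) < c / 3 := by
    have := (tendsto_one_div_add_atTop_nhds_zero_nat (𝕜 := ℝ)).const_mul C
    rw [mul_zero] at this
    exact this.eventually_lt_const (by positivity)
  obtain ⟨n, hn1, hn2⟩ := (h1.and h2).exists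
  have h3 := (Asymptotics.isLittleO_iff.mp (hasDerivWithinAt_iff_isLittleO.mp (hg n)))
    (show 0 < c / 3 by positivity)
  filter_upwards [h n, h3] with t ht1 ht2
  simp only [smul_eq_mul, Real.norm_eq_abs] at ht2 ⊢
  have e : f t - f a - (t - a) * d = ((f t - g n t) - (f a - g n a)) +
      (g n t - g n a - (t - a) * g' n) + (t - a) * (g' n - d) := by ring
  rw [e]
  refine (abs_add_three _ _ _).trans ?_
  rw [abs_mul]
  have h0 := abs_nonneg (t - a)
  have := mul_le_mul_of_nonneg_left hn1.le h0
  have := mul_le_mul_of_nonneg_right hn2.le h0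
  linarith

omit hN in
/-- If `u` and `v` differ by at most `ε |t - a|` near `a`, their derivatives differ by at most `ε`. -/
theorem abs_sub_deriv_le {w : ℝ → ℝ} {w' ε : ℝ} {I : Set ℝ} {a : ℝ} (hI : (𝓝[I \ {a}] a).NeBot)
    (hw : HasDerivWithinAt w w' I a) (h : ∀ᶠ t in 𝓝[I] a, |w t - w a| ≤ ε * |t - a|) :
    |w'| ≤ ε := by
  have h1 := (hasDerivWithinAt_iff_tendsto_slope.mp hw).abs
  refine le_of_tendsto h1 ?_
  have h2 : ∀ᶠ t in 𝓝[I \ {a}] a, |w t - w a| ≤ ε * |t - a| :=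
    nhdsWithin_mono _ sdiff_subset h
  filter_upwards [h2, self_mem_nhdsWithin] with t ht hta
  have hne : t - a ≠ 0 := sub_ne_zero.mpr hta.2
  rw [slope_def_field, abs_div, div_le_iff₀ (abs_pos.mpr hne)]
  exact ht

theorem hasDerivWithinAt_finSol (hlam : lam ∈ Ioo 0 (Real.pi / 2)) (s : Finset ℕ)
    (q : ℕ → MvPolynomial (Fin N) ℝ) (σ : Sph N) :
    HasDerivWithinAt (finSol lam s q σ)
      ((∑ l ∈ s, (lam * riccati N l lam) • polyRestrict N (q l)) σ) (Icc (-1) 1) 1 := by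
  have h := HasDerivAt.fun_sum (u := s) fun l _ =>
    (hasDerivAt_amp hN.out hlam zero_lt_two l (right_mem_Icc.mpr (by norm_num))).const_mul
      (polyRestrict N (q l) σ)
  refine (h.congr_deriv ?_).hasDerivWithinAt
  simp [amp_one_one hN.out hlam, mul_comm]

/-- Two solutions with close boundary values, measured by the Laplacian. -/
theorem exists_normal_bound (hlam : lam ∈ Ioo 0 (Real.pi / 2)) :
    ∃ M : ℝ, 0 ≤ M ∧ ∀ (ω ω' : Sph N → ℝ) (u v : Sph N → ℝ → ℝ), IsDirichletSolution lam ω u →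
      IsDirichletSolution lam ω' v → IsC2 (fun σ => ω σ + -1 * ω' σ) → ∀ K : ℝ,
      (∀ σ, |sphLaplacian (fun σ => ω σ + -1 * ω' σ) σ| ≤ K) → ∀ σ, ∀ᶠ t in 𝓝[Icc (-1) 1] 1,
        |(u σ t - v σ t) - (u σ 1 - v σ 1)| ≤ M * K * |t - 1| := by
  have h1 : (1 : ℝ) ∈ Icc (-1 : ℝ) 1 := right_mem_Icc.mpr (by norm_num)
  -- The barrier is differentiable and zero at `t = 1`, so it is at most a multiple of `|t - 1|`
  -- near there.
  obtain ⟨c, hc⟩ := ((hasDerivAt_barrier (N := N) hlam h1).isBigO_sub).bound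
  have hb1 : barrier N lam 1 = 0 := by simp [barrier]
  refine ⟨|c| / Real.cos lam ^ 2, by positivity, fun ω ω' u v hu hv hC K hK σ => ?_⟩
  obtain ⟨r1, r2⟩ := hu.sub hlam hv
  have hK0 : 0 ≤ K := (abs_nonneg _).trans (hK σ)
  filter_upwards [nhdsWithin_le_nhds hc, self_mem_nhdsWithin] with t ht htI
  have := abs_sub_le_barrier hN.out hlam r1 r2 hC
    (fun σ => by simp only [(hu.boundary σ).1, (hv.boundary σ).1])
    (fun σ => by simp only [(hu.boundary σ).2, (hv.boundary σ).2]) hK σ htI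
  rw [hb1, sub_zero, Real.norm_eq_abs, Real.norm_eq_abs] at ht
  rw [(hu.boundary σ).1, (hv.boundary σ).1]
  calc |u σ t - v σ t - (ω σ - ω' σ)| = |u σ t + -1 * v σ t - (ω σ + -1 * ω' σ)| := by
        congr 1; ring
    _ ≤ K / Real.cos lam ^ 2 * barrier N lam t := this
    _ ≤ K / Real.cos lam ^ 2 * (|c| * |t - 1|) := by
        gcongr
        refine (le_abs_self _).trans (ht.trans ?_)
        gcongr
        exact le_abs_self c
    _ = _ := by ring

omit hN in
theorem isC2_sum_harmonic {q : ℕ → MvPolynomial (Fin N) ℝ} (hq : ∀ l, q l ∈ harmonicPoly N l)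
    (s : Finset ℕ) : IsC2 (fun σ => ∑ l ∈ s, polyRestrict N (q l) σ) ∧
      ∀ σ, sphLaplacian (fun σ => ∑ l ∈ s, polyRestrict N (q l) σ) σ =
        ∑ l ∈ s, -gam N l * polyRestrict N (q l) σ := by
  induction s using Finset.induction_on with
  | empty =>
    exact ⟨by simpa using isC2_const (0 : ℝ), fun σ => by simpa using sphLaplacian_const (0 : ℝ) σ⟩
  | insert a s ha ih =>
    simp only [Finset.sum_insert ha]
    exact ⟨(isC2_harmonic (hq a)).add ih.1, fun σ => by
      rw [sphLaplacian_add (isC2_harmonic (hq a)) ih.1, ih.2, sphLaplacian_harmonic_gam (hq a)]⟩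

/-- A `C²` function is approximated by finite sums of spherical harmonics, in the sense that the
Laplacian of the difference is small. -/
theorem exists_harmonic_approx_laplacian {ω : Sph N → ℝ} (hω : IsC2 ω) {ε : ℝ} (hε : 0 < ε) :
    ∃ (s : Finset ℕ) (q : ℕ → MvPolynomial (Fin N) ℝ), (∀ l, q l ∈ harmonicPoly N l) ∧
      IsC2 (fun σ => ω σ + -1 * ∑ l ∈ s, polyRestrict N (q l) σ) ∧
      ∀ σ, |sphLaplacian (fun σ => ω σ + -1 * ∑ l ∈ s, polyRestrict N (q l) σ) σ| ≤ ε := by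
  obtain ⟨s, q, hq, hs⟩ :=
    exists_harmonic_approx (⟨_, hω.continuous_sphLaplacian⟩ : C(Sph N, ℝ)) (half_pos hε)
  simp only [ContinuousMap.coe_mk] at hs
  -- The Laplacian is inverted degree by degree. Degree `0`, where `γ_0 = 0`, has to be left out of
  -- the sum.
  let Q : ℕ → MvPolynomial (Fin N) ℝ := fun l => (-(gam N l)⁻¹) • q l
  have hQ (l) : Q l ∈ harmonicPoly N l := Submodule.smul_mem _ _ (hq l)
  obtain ⟨h1, h2⟩ := isC2_sum_harmonic hQ (s.erase 0)
  have hC2 : IsC2 (fun σ => ω σ + -1 * ∑ l ∈ s.erase 0, polyRestrict N (Q l) σ) :=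
    hω.add (h1.const_mul (-1))
  refine ⟨s.erase 0, Q, hQ, hC2, ?_⟩
  have hL (σ) : sphLaplacian (fun σ => ω σ + -1 * ∑ l ∈ s.erase 0, polyRestrict N (Q l) σ) σ =
      sphLaplacian ω σ - ∑ l ∈ s.erase 0, polyRestrict N (q l) σ := by
    rw [sphLaplacian_add hω (h1.const_mul (-1)), sphLaplacian_const_mul h1, h2, neg_one_mul,
      ← sub_eq_add_neg]
    congr 1
    refine Finset.sum_congr rfl fun l hl => ?_
    have hg : gam N l ≠ 0 := by
      have := gam_lt_gam hN.out (Nat.pos_of_ne_zero (Finset.ne_of_mem_erase hl))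
      have h0 : gam N 0 = 0 := by simp [gam]
      linarith
    simp only [Q, map_smul, ContinuousMap.smul_apply, smul_eq_mul]
    field_simp
  -- A form of degree `0` is constant, so the omitted part is a constant `c`.
  obtain ⟨c, hc⟩ : ∃ c : ℝ, ∀ σ, ∑ l ∈ s, polyRestrict N (q l) σ =
      (∑ l ∈ s.erase 0, polyRestrict N (q l) σ) + c := by
    by_cases h0 : 0 ∈ s
    · refine ⟨evalE (q 0) 0, fun σ => ?_⟩
      rw [← Finset.sum_erase_add s _ h0, polyRestrict_apply (q 0)]
      have := evalE_smul_arg (hq 0).1 0 (σ : Euc N)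
      rw [zero_smul, pow_zero, one_mul] at this
      rw [this]
    · exact ⟨0, fun σ => by rw [Finset.erase_eq_of_notMem h0, add_zero]⟩
  -- A spherical Laplacian has mean zero, which forces the omitted constant to be at most `ε/2` as
  -- well.
  have hint := integral_sphLaplacian_mul hC2 (isC2_const (N := N) 1)
  simp only [sphLaplacian_const, mul_one, mul_zero, integral_zero] at hint
  have hsm (σ) : |sphLaplacian
      (fun σ => ω σ + -1 * ∑ l ∈ s.erase 0, polyRestrict N (Q l) σ) σ - c| ≤ ε / 2 := by
    have := (hs σ).le
    rwa [hc, ← sub_sub, ← hL] at this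
  have hS := sphMeasure_real_univ_pos (N := N)
  have hcε : |c| ≤ ε / 2 := by
    have h3 := norm_integral_le_of_norm_le_const (μ := sphMeasure N) (C := ε / 2)
      (f := fun σ => sphLaplacian
        (fun σ => ω σ + -1 * ∑ l ∈ s.erase 0, polyRestrict N (Q l) σ) σ - c)
      (Filter.Eventually.of_forall fun σ => hsm σ)
    rw [integral_sub (integrable_of_continuous hC2.continuous_sphLaplacian) (integrable_const c),
      hint, integral_const, zero_sub, norm_neg, norm_smul, Real.norm_of_nonneg hS.le, mul_comm] at h3
    exact le_of_mul_le_mul_right h3 hS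
  intro σ
  have := hsm σ
  rw [abs_le] at this hcε ⊢
  constructor <;> linarith [this.1, this.2, hcε.1, hcε.2]

theorem riccati_zero (hlam : lam ∈ Ioo 0 (Real.pi / 2)) : riccati N 0 lam = 0 := by
  have h : IsRiccati N 0 fun _ => 0 :=
    ⟨continuousOn_const, rfl, fun x _ => by simpa using hasDerivAt_const x (0 : ℝ)⟩
  exact (isRiccati_riccati hN.out 0).eqOn h (lam_mem_Ico hlam)

/-- The normal derivative at `t = 1` of the solution with `C²` boundary values. -/
theorem exists_normal_derivative (hlam : lam ∈ Ioo 0 (Real.pi / 2)) {ω : Sph N → ℝ} (hω : IsC2 ω) :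
    ∃ D : C(Sph N, ℝ),
      (∀ σ, HasDerivWithinAt (dirichletSolution lam ω σ) (D σ) (Icc (-1) 1) 1) ∧
      ∀ l, proj N l (toLtwo D) =
        (lam * riccati N l lam) • proj N l (toLtwo ⟨ω, hω.continuous⟩) := by
  choose s q hq hC2 hsmall using fun n : ℕ => exists_harmonic_approx_laplacian hω
    (show (0 : ℝ) < 1 / ((n : ℝ) + 1) by positivity)
  obtain ⟨M, hM, hnb⟩ := exists_normal_bound (N := N) hlam
  have hψ := isDirichletSolution_dirichletSolution hlam hω.continuous
  have hsol (n) := isDirichletSolution_finSol (s := s n) hlam (hq n)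
  have happ (n : ℕ) (σ : Sph N) := hnb _ _ _ _ hψ (hsol n) (hC2 n) _ (hsmall n) σ
  let d : ℕ → C(Sph N, ℝ) := fun n =>
    ∑ l ∈ s n, (lam * riccati N l lam) • polyRestrict N (q n l)
  have hd (n σ) := hasDerivWithinAt_finSol hlam (s n) (q n) σ
  -- `1` is an accumulation point of the interval, so one-sided derivatives can be compared there.
  have hne : (𝓝[Icc (-1 : ℝ) 1 \ {1}] 1).NeBot := by
    rw [Icc_sdiff_right]
    have h11 : (-1 : ℝ) < 1 := by norm_num
    exact mem_closure_iff_nhdsWithin_neBot.mp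
      (by rw [closure_Ico h11.ne]; exact right_mem_Icc.mpr h11.le)
  -- Each approximant is close to the true solution to first order at `t = 1`, uniformly in `σ`.
  -- Hence the normal derivatives of the approximants are uniformly Cauchy.
  obtain ⟨D, hD⟩ := cauchySeq_of_abs_sub_le (F := d) (C := M) fun m n σ => by
    refine abs_sub_deriv_le hne ((hd m σ).sub (hd n σ)) ?_
    filter_upwards [happ m σ, happ n σ] with t h1 h2
    rw [add_mul]
    refine (le_of_eq ?_).trans ((abs_sub _ _).trans ((add_le_add h2 h1).trans_eq (add_comm _ _)))
    congr 1
    simp only [Pi.sub_apply]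
    ring
  refine ⟨D, fun σ => ?_, fun l => ?_⟩
  · exact hasDerivWithinAt_of_approx (fun n => finSol lam (s n) (q n) σ) (fun n => d n σ)
      (fun n => hd n σ) (((ContinuousMap.evalCLM ℝ σ).continuous.tendsto D).comp hD)
      (fun n => happ n σ)
  have h1 : Filter.Tendsto (fun n => proj N l (toLtwo (d n))) Filter.atTop
      (𝓝 (proj N l (toLtwo D))) := (((proj N l) ∘L toLtwo).continuous.tendsto D).comp hD
  refine tendsto_nhds_unique h1 ?_
  simp only [d, proj_sum_smul (hq _)]
  -- The approximation controls Laplacians only, so it says nothing about the mean of `ω`. In degree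
  -- `0` this is harmless because `f_0 = 0`; in degree `l > 0` one divides by `γ_l`.
  rcases Nat.eq_zero_or_pos l with rfl | hl
  · simp [riccati_zero hlam]
  refine Filter.Tendsto.const_smul ?_ _
  have hL : Filter.Tendsto
      (fun n => proj N l (toLtwo ⟨_, (hC2 n).continuous_sphLaplacian⟩)) Filter.atTop (𝓝 0) := by
    have h2 : Filter.Tendsto
        (fun n => (⟨_, (hC2 n).continuous_sphLaplacian⟩ : C(Sph N, ℝ))) Filter.atTop (𝓝 0) := by
      rw [tendsto_iff_dist_tendsto_zero]
      refine squeeze_zero (fun _ => dist_nonneg) (fun n => ?_)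
        (tendsto_one_div_add_atTop_nhds_zero_nat (𝕜 := ℝ))
      refine (ContinuousMap.dist_le (by positivity)).mpr fun σ => ?_
      rw [Real.dist_eq]
      simpa using hsmall n σ
    have h3 := (((proj N l) ∘L toLtwo).continuous.tendsto 0).comp h2
    rwa [map_zero] at h3
  have hg : -gam N l ≠ 0 := by
    have := gam_lt_gam hN.out hl
    have h0 : gam N 0 = 0 := by simp [gam]
    linarith
  have h4 : Filter.Tendsto (fun n => proj N l (toLtwo ⟨_, (hC2 n).continuous⟩)) Filter.atTop
      (𝓝 0) := by
    have := hL.const_smul (-gam N l)⁻¹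
    rw [smul_zero] at this
    exact this.congr fun n => by
      rw [proj_sphLaplacian (hC2 n), inv_smul_smul₀ hg]
  have h5 := h4.const_sub (proj N l (toLtwo ⟨ω, hω.continuous⟩))
  rw [sub_zero] at h5
  refine h5.congr fun n => ?_
  rw [← map_sub, ← map_sub]
  congr 2
  ext σ
  simp

theorem deriv_deriv_profile (hlam : lam ∈ Ioo 0 (Real.pi / 2)) :
    deriv (deriv (profile N)) lam = ((N : ℝ) - 1) * Real.tan lam * deriv (profile N) lam - 1 :=
  (hasDerivAt_deriv_profile hN.out ⟨by linarith [hlam.1, Real.pi_pos], hlam.2⟩).deriv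

/-- On `C²` functions, the linearized operator multiplies spherical harmonics by the eigenvalues. -/
theorem exists_linOp (hlam : lam ∈ Ioo 0 (Real.pi / 2)) {ω : Sph N → ℝ} (hω : IsC2 ω) :
    ∃ F : C(Sph N, ℝ), (∀ σ, F σ = linOp lam ω σ) ∧
      ∀ l, proj N l (toLtwo F) = eigval N l lam • proj N l (toLtwo ⟨ω, hω.continuous⟩) := by
  obtain ⟨D, hD, hDp⟩ := exists_normal_derivative hlam hω
  have hl := hlam.1.ne'
  refine ⟨(-(deriv (profile N) lam / lam)) • D +
    deriv (deriv (profile N)) lam • ⟨ω, hω.continuous⟩, fun σ => ?_, fun l => ?_⟩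
  · have hu : UniqueDiffWithinAt ℝ (Icc (-1 : ℝ) 1) 1 :=
      uniqueDiffOn_Icc (by norm_num) 1 (right_mem_Icc.mpr (by norm_num))
    rw [linOp, (hD σ).derivWithin hu]
    rfl
  -- On `V_l` the factor is `-ũ' f_l + ũ''`, and the equation for `ũ''` turns it into `σ_l`.
  · rw [map_add, map_add, map_smul, map_smul, map_smul, map_smul, hDp, smul_smul, ← add_smul,
      deriv_deriv_profile hlam, eigval]
    congr 1
    field_simp
    ring

end

end SerrinSphere
end

/-! ### The proposition -/

theorem proposition4p1 (N : ℕ) (hN : 2 ≤ N) (α : NNReal) (hα₀ : 0 < α) (hα₁ : α < 1)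
    (lam : ℝ) (hlam : lam ∈ Set.Ioo 0 (Real.pi / 2)) :
    -- the functions `f_j` in the definition of the eigenvalues are well defined
    (∀ j, IsRiccati N j (riccati N j) ∧
      ∀ f, IsRiccati N j f → Set.EqOn f (riccati N j) (Set.Ico 0 (Real.pi / 2))) ∧
    -- the operator `L_lam` is well defined on `C^{2,α}`
    (∀ ω : Sph N → ℝ, IsC2Holder α ω →
      IsDirichletSolution lam ω (dirichletSolution lam ω) ∧
      (∀ ψ, IsDirichletSolution lam ω ψ →
        ∀ σ, Set.EqOn (ψ σ) (dirichletSolution lam ω σ) (Set.Icc (-1) 1)) ∧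
      ∀ σ, DifferentiableWithinAt ℝ (dirichletSolution lam ω σ) (Set.Icc (-1) 1) 1) ∧
    ∃ L : Sob N 2 →L[ℝ] Sob N 1,
      -- `L` extends `L_lam`
      (∀ ω : Sph N → ℝ, IsC2Holder α ω →
        ∃ v : Sob N 2, v.toL2 =ᵐ[sphMeasure N] ω ∧ (L v).toL2 =ᵐ[sphMeasure N] linOp lam ω) ∧
      -- `L v = ∑ σ_l(lam) P_l v`, with convergence in `H^1`
      (∀ v : Sob N 2, ∃ p : ℕ → Sob N 1, (∀ l, (p l).toL2 = proj N l v.toL2) ∧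
        HasSum (fun l => eigval N l lam • p l) (L v)) ∧
      -- `L - σ_l(lam) id` is an isomorphism `W^2_l → W^1_l`
      ∀ l : ℕ, ∃ A : sobOrth N 2 l ≃L[ℝ] sobOrth N 1 l, ∀ v : sobOrth N 2 l,
        (A v : Sob N 1).toL2 = (L v).toL2 - eigval N l lam • (v : Sob N 2).toL2 := by
  have : Fact (2 ≤ N) := ⟨hN⟩
  obtain ⟨C, hC⟩ := exists_eigval_bounds hN hlam
  have hm (l : ℕ) : (1 + (l : ℝ) ^ 2) ^ 1 * eigval N l lam ^ 2 ≤ C * (1 + (l : ℝ) ^ 2) ^ 2 := by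
    have := mul_le_mul_of_nonneg_left (hC l) (show 0 ≤ 1 + (l : ℝ) ^ 2 by positivity)
    linarith
  refine ⟨fun j => ⟨isRiccati_riccati hN j, fun f hf => ((isRiccati_riccati hN j).eqOn hf).symm⟩,
    fun ω hω => ?_, multiplier hm, fun ω hω => ?_, fun v => ?_, fun l => ?_⟩
  · have hC2 : IsC2 ω := hω.1
    have hsol := isDirichletSolution_dirichletSolution hlam hC2.continuous
    obtain ⟨D, hD, -⟩ := exists_normal_derivative hlam hC2
    exact ⟨hsol, fun ψ hψ σ => hψ.eqOn hN hlam hsol σ, fun σ => (hD σ).differentiableWithinAt⟩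
  · have hC2 : IsC2 ω := hω.1
    obtain ⟨F, hF, hFp⟩ := exists_linOp hlam hC2
    refine ⟨Sob.mk _ hC2.summable_sob, coeFn_toLtwo _, ?_⟩
    -- The multiplier and the classical operator produce the same class in `L²`, because all
    -- projections agree.
    have h : (multiplier hm (Sob.mk _ hC2.summable_sob)).toL2 = toLtwo F :=
      eq_of_proj_eq fun l => by rw [proj_multiplier, hFp, Sob.toL2_mk]
    rw [h]
    exact (coeFn_toLtwo F).trans (Filter.Eventually.of_forall hF)
  · choose p hp using fun l => exists_sob_proj (N := N) (k := 1) v.toL2 l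
    refine ⟨p, hp, hasSum_sob fun l => ?_⟩
    rw [map_smul, hp, proj_multiplier]
  -- On `W²_l` the operator minus `σ_l` is the multiplier `σ_j - σ_l`, of size comparable to `(1 +
  -- j²)^{1/2}` for `j ≠ l`.
  · obtain ⟨C', h1, h2⟩ := exists_eigval_sub_bounds hN hlam l
    obtain ⟨A, hA⟩ := exists_equiv_of_multiplier (N := N) h1 h2
    refine ⟨A, fun v => eq_of_proj_eq (N := N) fun j => ?_⟩
    rw [hA v j, map_sub, map_smul, proj_multiplier, sub_smul]
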